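/- Let $k$ be a field. Let $P$ be a poset in which every closed interval $[x,y]=\{z: x\le z\le y\}$ is finite, let $\mathrm{Int}(P)$ be the set of all closed intervals $[x,y]$ with $x\le y$, and let $\sim$ be an equivalence relation on $\mathrm{Int}(P)$; write $\widetilde{[x,y]}$ for the class of $[x,y]$, and write $x\sim y$ for $x,y\in P$ if $[x,x]\sim[y,y]$. Assume: 1. (order-compatibility) if $[x,y]\sim[x',y']$ and $[y,z]\sim[y',z']$, then $[x,z]\sim[x',z']$; 2. (invariance) if $[x,y]\sim[x',y']$, then there is exactly one map $\tau:[x,y]\to[x',y']$ such that $[x',\tau(z)]\sim[x,z]$ and $[\tau(z),y']\sim[z,y]$ for all $z\in[x,y]$; 3. (finiteness) the set $P/\!\sim$ is finite; 4. (concatenation) if $x\le y_1$ and $y_2\le z$ with $y_1\sim y_2$, then there are $x'\le y'\le z'$ in $P$ with $[x',y']\sim[x,y_1]$ and $[y',z']\sim[y_2,z]$. Let $A=k[P]_{\mathrm{red}}$ be the reduced incidence algebra: the $k$-vector space with basis $\{\xi_\alpha\}$ indexed by $\alpha\in\mathrm{Int}(P)/\!\sim$, with the $k$-bilinear product in which $\xi_\alpha\xi_\beta=\xi_{\widetilde{[x,z]}}$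 if there are $x\le y\le z$ in $P$ with $[x,y]\in\alpha$ and $[y,z]\in\beta$, and $\xi_\alpha\xi_\beta=0$ otherwise. Write $A=A_0\oplus I$, where $A_0$ is the span of the $\xi_{\widetilde{[x,x]}}$, a subring, and $I$ is the span of the $\xi_{\widetilde{[x,y]}}$ with $x<y$, a two-sided ideal. Then $A$ is a nongraded Koszul ring (with respect to $A=A_0\oplus I$) if and only if for all $x\le y$ in $P$ the open interval $(x,y)=\{z: x<z<y\}$ is sequentially Cohen–Macaulay over $k$. Here the notions are as follows. For an $\mathbb N$-graded ring $R=\bigoplus_{d\ge0}R_d$ with $R_0$ semisimple, a $\mathbb Z$-graded right $R$-module $M$ is *Koszul* if it has a graded projective resolution $\cdots\to P^{(1)}\to P^{(0)}\to M\to0$ in which $P^{(i)}$ is generated by its component of degree $i$. For a ring $A=A_0\oplus I$ with $A_0$ a semisimple subring and $I$ a two-sided ideal, a right $A$-module $M$ is *nongraded Koszul* if $\mathrm{gr}_I M=\bigoplus_{d\ge0}MI^d/MI^{d+1}$ is a Koszul module over $\mathrm{gr}_I A=\bigoplus_{d\ge0}I^d/I^{d+1}$, and $A$ is a *nongraded Koszul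 ring* if the right $A$-module $A/I$ is nongraded Koszul. For an abstract simplicial complex $\Delta$ (the empty set counts as a face, of dimension $-1$), let $\Delta^{\langle j\rangle}$ be the subcomplex generated by the faces of dimension at least $j$. The complex $\Delta$ is *sequentially acyclic over $k$* if the reduced simplicial homology $\tilde H_i(\Delta^{\langle j\rangle};k)$ vanishes for $-1\le i<j\le\dim\Delta$, and *sequentially Cohen–Macaulay over $k$* if the link $\{G\in\Delta: F\cup G\in\Delta,\ F\cap G=\varnothing\}$ of every face $F$ of $\Delta$ is sequentially acyclic over $k$. A poset is sequentially Cohen–Macaulay over $k$ if its order complex, whose faces are its finite chains, is so. -/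

import Mathlib

universe u v

/-! ## Associated graded groups, rings and right modules -/

section AssociatedGraded

/-- The associated graded group `⨁ d, F d / F (d + 1)` of a family `F 0, F 1, …` of subgroups of
an abelian group (only used for descending filtrations). -/
def AssocGr {M : Type u} [AddCommGroup M] (F : ℕ → AddSubgroup M) : Type u :=
  DirectSum ℕ fun d => F d ⧸ (F (d + 1)).addSubgroupOf (F d)

namespace AssocGr

noncomputable instance {M : Type u} [AddCommGroup M] (F : ℕ → AddSubgroup M) :
    AddCommGroup (AssocGr F) :=
  inferInstanceAs (AddCommGroup (DirectSum ℕ fun d => F d ⧸ (F (d + 1)).addSubgroupOf (F d)))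

/-- The class of `x ∈ F d` in the degree `d` part of the associated graded group. -/
noncomputable def mk {M : Type u} [AddCommGroup M] (F : ℕ → AddSubgroup M) (d : ℕ) :
    F d →+ AssocGr F :=
  (DirectSum.of (fun d => F d ⧸ (F (d + 1)).addSubgroupOf (F d)) d).comp
    (QuotientAddGroup.mk' _)

/-- The homogeneous component of degree `d`. -/
noncomputable def component {M : Type u} [AddCommGroup M] (F : ℕ → AddSubgroup M) (d : ℕ) :
    AddSubgroup (AssocGr F) :=
  (mk F d).range

/-- The same grading, extended to all integers by zero in negative degrees. -/
noncomputable def intComponent {M : Type u} [AddCommGroup M] (F : ℕ → AddSubgroup M) :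
    ℤ → AddSubgroup (AssocGr F)
  | Int.ofNat d => component F d
  | Int.negSucc _ => ⊥

theorem mk_congr {M : Type u} [AddCommGroup M] {F : ℕ → AddSubgroup M} {d e : ℕ} {x y : M}
    (h : d = e) (hxy : x = y) (hx : x ∈ F d) (hy : y ∈ F e) :
    mk F d ⟨x, hx⟩ = mk F e ⟨y, hy⟩ := by
  subst h; subst hxy; rfl

theorem mk_eq_zero {M : Type u} [AddCommGroup M] {F : ℕ → AddSubgroup M} {d : ℕ} {x : M}
    (hx : x ∈ F d) (hx' : x ∈ F (d + 1)) : mk F d ⟨x, hx⟩ = 0 := by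
  have h : QuotientAddGroup.mk' ((F (d + 1)).addSubgroupOf (F d)) ⟨x, hx⟩ = 0 :=
    (QuotientAddGroup.eq_zero_iff _).2 hx'
  exact (congrArg (DirectSum.of (fun d => F d ⧸ (F (d + 1)).addSubgroupOf (F d)) d) h).trans
    (map_zero _)

theorem induction {M : Type u} [AddCommGroup M] {F : ℕ → AddSubgroup M} {p : AssocGr F → Prop}
    (x : AssocGr F) (zero : p 0) (hmk : ∀ (d : ℕ) (x : M) (hx : x ∈ F d), p (mk F d ⟨x, hx⟩))
    (hadd : ∀ x y, p x → p y → p (x + y)) : p x := by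
  refine DirectSum.induction_on (motive := p) x zero (fun d y => ?_) hadd
  obtain ⟨y, rfl⟩ := QuotientAddGroup.mk_surjective y
  exact hmk d y.1 y.2

theorem hom_ext {M L : Type*} [AddCommGroup M] [AddCommGroup L] {F : ℕ → AddSubgroup M}
    {f g : AssocGr F →+ L}
    (h : ∀ (d : ℕ) (x : M) (hx : x ∈ F d), f (mk F d ⟨x, hx⟩) = g (mk F d ⟨x, hx⟩)) : f = g := by
  ext x
  induction x using AssocGr.induction with
  | zero => rw [map_zero, map_zero]
  | hmk d x hx => exact h d x hx
  | hadd x y hx hy => rw [map_add, map_add, hx, hy]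

/-- The additive map out of `AssocGr F` with given values on homogeneous elements. -/
noncomputable def lift {M L : Type*} [AddCommGroup M] [AddCommGroup L] (F : ℕ → AddSubgroup M)
    (φ : ∀ d, F d →+ L) (hφ : ∀ (d : ℕ) (x : M) (hx : x ∈ F d), x ∈ F (d + 1) → φ d ⟨x, hx⟩ = 0) :
    AssocGr F →+ L :=
  DirectSum.toAddMonoid fun d => QuotientAddGroup.lift _ (φ d) fun x hx => hφ d x x.2 hx

theorem lift_mk {M L : Type*} [AddCommGroup M] [AddCommGroup L] (F : ℕ → AddSubgroup M)
    (φ : ∀ d, F d →+ L) (hφ : ∀ (d : ℕ) (x : M) (hx : x ∈ F d), x ∈ F (d + 1) → φ d ⟨x, hx⟩ = 0)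
    (d : ℕ) (x : F d) : lift F φ hφ (mk F d x) = φ d x :=
  DirectSum.toAddMonoid_of _ _ _

/-- An additive map carrying each `G j` into `H (i + j)` induces a map of degree `i` on the
associated graded groups. -/
noncomputable def shiftMap {N L : Type*} [AddCommGroup N] [AddCommGroup L]
    (G : ℕ → AddSubgroup N) (H : ℕ → AddSubgroup L) (i : ℕ) (f : N →+ L)
    (hf : ∀ j, ∀ y ∈ G j, f y ∈ H (i + j)) : AssocGr G →+ AssocGr H :=
  lift G (fun j => (mk H (i + j)).comp ((f.comp (G j).subtype).codRestrict (H (i + j))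
      (fun y => hf j y y.2)))
    (fun j y _ hy' => mk_eq_zero _ (hf (j + 1) y hy'))

theorem shiftMap_mk {N L : Type*} [AddCommGroup N] [AddCommGroup L]
    (G : ℕ → AddSubgroup N) (H : ℕ → AddSubgroup L) (i : ℕ) (f : N →+ L)
    (hf : ∀ j, ∀ y ∈ G j, f y ∈ H (i + j)) (j : ℕ) (y : N) (hy : y ∈ G j) :
    shiftMap G H i f hf (mk G j ⟨y, hy⟩) = mk H (i + j) ⟨f y, hf j y hy⟩ :=
  lift_mk G _ _ j ⟨y, hy⟩

/-- A biadditive map carrying `F i × G j` into `H (i + j)` induces a biadditive map on the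
associated graded groups. -/
noncomputable def pairing {M N L : Type*} [AddCommGroup M] [AddCommGroup N] [AddCommGroup L]
    (F : ℕ → AddSubgroup M) (G : ℕ → AddSubgroup N) (H : ℕ → AddSubgroup L)
    (β : M →+ N →+ L) (hβ : ∀ i j, ∀ x ∈ F i, ∀ y ∈ G j, β x y ∈ H (i + j)) :
    AssocGr F →+ AssocGr G →+ AssocGr H :=
  lift F
    (fun i => AddMonoidHom.mk'
      (fun x : F i => shiftMap G H i (β x) (fun j y hy => hβ i j x x.2 y hy))
      (fun x x' => hom_ext fun j y hy => by
        rw [AddMonoidHom.add_apply]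
        refine (shiftMap_mk ..).trans (Eq.trans ?_
          (congrArg₂ (· + ·) (shiftMap_mk ..) (shiftMap_mk ..)).symm)
        refine Eq.trans ?_ (map_add (mk H (i + j)) _ _)
        exact mk_congr rfl (by simp) _ _))
    (fun i x hx hx' => hom_ext fun j y hy => by
      have h := hβ (i + 1) j x hx' y hy
      rw [Nat.add_right_comm] at h
      rw [AddMonoidHom.zero_apply]
      exact (shiftMap_mk G H i (β x) (hβ i · x hx) j y hy).trans (mk_eq_zero _ h))

theorem pairing_mk {M N L : Type*} [AddCommGroup M] [AddCommGroup N] [AddCommGroup L]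
    (F : ℕ → AddSubgroup M) (G : ℕ → AddSubgroup N) (H : ℕ → AddSubgroup L)
    (β : M →+ N →+ L) (hβ : ∀ i j, ∀ x ∈ F i, ∀ y ∈ G j, β x y ∈ H (i + j))
    (i j : ℕ) (x : M) (hx : x ∈ F i) (y : N) (hy : y ∈ G j) :
    pairing F G H β hβ (mk F i ⟨x, hx⟩) (mk G j ⟨y, hy⟩) =
      mk H (i + j) ⟨β x y, hβ i j x hx y hy⟩ :=
  (congrArg (fun f : AssocGr G →+ AssocGr H => f (mk G j ⟨y, hy⟩))
    (lift_mk F _ _ i ⟨x, hx⟩)).trans (shiftMap_mk G H i (β x) (hβ i · x hx) j y hy)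

end AssocGr

/-- The `I`-adic filtration `A = I^0 ⊇ I ⊇ I^2 ⊇ ⋯` of a ring. -/
def adicFiltration {A : Type u} [Ring A] (I : Ideal A) (d : ℕ) : AddSubgroup A :=
  (I ^ d).toAddSubgroup

/-- The `I`-adic filtration `M = M I^0 ⊇ M I ⊇ M I^2 ⊇ ⋯` of a right `A`-module. -/
def adicModuleFiltration {A : Type u} [Ring A] (I : Ideal A) (M : Type v) [AddCommGroup M]
    [Module Aᵐᵒᵖ M] (d : ℕ) : AddSubgroup M :=
  AddSubgroup.closure {z | ∃ m : M, ∃ a ∈ I ^ d, z = MulOpposite.op a • m}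

theorem adicFiltration_mul {A : Type u} [Ring A] (I : Ideal A) [I.IsTwoSided] (i j : ℕ) :
    ∀ x ∈ adicFiltration I i, ∀ y ∈ adicFiltration I j,
      AddMonoidHom.mul x y ∈ adicFiltration I (i + j) := by
  intro x hx y hy
  change x * y ∈ I ^ (i + j)
  rw [Ideal.IsTwoSided.pow_add]
  exact Ideal.mul_mem_mul hx hy

/-- The right action of `A` on `M` as a biadditive map `(m, a) ↦ m a`. -/
def rightAction (A : Type u) [Ring A] (M : Type v) [AddCommGroup M] [Module Aᵐᵒᵖ M] :
    M →+ A →+ M :=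
  AddMonoidHom.mk' (fun m => AddMonoidHom.mk' (fun a => MulOpposite.op a • m)
    (fun a b => by rw [MulOpposite.op_add, add_smul]))
    (fun m n => by ext a; exact smul_add _ _ _)

theorem adicModuleFiltration_smul {A : Type u} [Ring A] (I : Ideal A) [I.IsTwoSided]
    (M : Type v) [AddCommGroup M] [Module Aᵐᵒᵖ M] (i j : ℕ) :
    ∀ x ∈ adicModuleFiltration I M i, ∀ y ∈ adicFiltration I j,
      rightAction A M x y ∈ adicModuleFiltration I M (i + j) := by
  intro x hx y hy
  induction hx using AddSubgroup.closure_induction with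
  | mem z hz =>
    obtain ⟨m, a, ha, rfl⟩ := hz
    refine AddSubgroup.subset_closure ⟨m, a * y, adicFiltration_mul I i j a ha y hy, ?_⟩
    rw [MulOpposite.op_mul, mul_smul]
    rfl
  | zero => rw [map_zero]; exact zero_mem _
  | add z w _ _ hz hw => rw [map_add]; exact add_mem hz hw
  | neg z _ hz => rw [map_neg]; exact neg_mem hz

/-- The underlying group of the associated graded ring `⨁ d, I^d / I^(d+1)`. -/
abbrev GrRing {A : Type u} [Ring A] (I : Ideal A) : Type u := AssocGr (adicFiltration I)

/-- The underlying group of the associated graded module `⨁ d, M I^d / M I^(d+1)`. -/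
abbrev GrModule {A : Type u} [Ring A] (I : Ideal A) (M : Type v) [AddCommGroup M]
    [Module Aᵐᵒᵖ M] : Type v := AssocGr (adicModuleFiltration I M)

/-- Multiplication on `gr_I A`, induced by that of `A`. -/
noncomputable def grMul {A : Type u} [Ring A] (I : Ideal A) [I.IsTwoSided] :
    GrRing I →+ GrRing I →+ GrRing I :=
  AssocGr.pairing _ _ _ AddMonoidHom.mul (adicFiltration_mul I)

/-- The right action of `gr_I A` on `gr_I M`, induced by that of `A` on `M`. -/
noncomputable def grSMul {A : Type u} [Ring A] (I : Ideal A) [I.IsTwoSided]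
    (M : Type v) [AddCommGroup M] [Module Aᵐᵒᵖ M] :
    GrModule I M →+ GrRing I →+ GrModule I M :=
  AssocGr.pairing _ _ _ (rightAction A M) (adicModuleFiltration_smul I M)

/-- The unit of `gr_I A`: the class of `1 ∈ A = I^0` in degree `0`. -/
noncomputable def grOne {A : Type u} [Ring A] (I : Ideal A) : GrRing I :=
  AssocGr.mk _ 0 ⟨1, by
    change (1 : A) ∈ I ^ 0
    rw [Submodule.pow_zero, Ideal.one_eq_top]; trivial⟩

noncomputable instance GrRing.instRing {A : Type u} [Ring A] (I : Ideal A) [I.IsTwoSided] :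
    Ring (GrRing I) where
  __ := (inferInstance : AddCommGroup (GrRing I))
  mul x y := grMul I x y
  one := grOne I
  left_distrib x y z := map_add (grMul I x) y z
  right_distrib x y z := by
    change grMul I (x + y) z = grMul I x z + grMul I y z
    rw [map_add]; rfl
  zero_mul x := by
    change grMul I 0 x = 0
    rw [map_zero]; rfl
  mul_zero x := map_zero (grMul I x)
  mul_assoc x y z := by
    change grMul I (grMul I x y) z = grMul I x (grMul I y z)
    induction x using AssocGr.induction with
    | zero => simp
    | hadd x x' h h' => simp only [map_add, AddMonoidHom.add_apply, h, h']
    | hmk i x hx =>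
    induction y using AssocGr.induction with
    | zero => simp
    | hadd y y' h h' => simp only [map_add, AddMonoidHom.add_apply, h, h']
    | hmk j y hy =>
    induction z using AssocGr.induction with
    | zero => simp
    | hadd z z' h h' => simp only [map_add, h, h']
    | hmk l z hz =>
    simp only [grMul, AssocGr.pairing_mk]
    exact AssocGr.mk_congr (add_assoc i j l) (mul_assoc x y z) _ _
  one_mul x := by
    change grMul I (grOne I) x = x
    induction x using AssocGr.induction with
    | zero => simp
    | hadd x x' h h' => simp only [map_add, h, h']
    | hmk i x hx =>
    simp only [grMul, grOne, AssocGr.pairing_mk]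
    exact AssocGr.mk_congr (zero_add i) (one_mul x) _ _
  mul_one x := by
    change grMul I x (grOne I) = x
    induction x using AssocGr.induction with
    | zero => simp
    | hadd x x' h h' => simp only [map_add, AddMonoidHom.add_apply, h, h']
    | hmk i x hx =>
    simp only [grMul, grOne, AssocGr.pairing_mk]
    exact AssocGr.mk_congr (add_zero i) (mul_one x) _ _

noncomputable instance GrModule.instModule {A : Type u} [Ring A] (I : Ideal A) [I.IsTwoSided]
    (M : Type v) [AddCommGroup M] [Module Aᵐᵒᵖ M] : Module (GrRing I)ᵐᵒᵖ (GrModule I M) where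
  smul r m := grSMul I M m r.unop
  smul_zero r := by
    change grSMul I M 0 r.unop = 0
    rw [map_zero]; rfl
  smul_add r m n := by
    change grSMul I M (m + n) r.unop = grSMul I M m r.unop + grSMul I M n r.unop
    rw [map_add]; rfl
  add_smul r s m := map_add (grSMul I M m) r.unop s.unop
  zero_smul m := map_zero (grSMul I M m)
  one_smul m := by
    change grSMul I M m (grOne I) = m
    induction m using AssocGr.induction with
    | zero => simp
    | hadd x x' h h' => simp only [map_add, AddMonoidHom.add_apply, h, h']
    | hmk i x hx =>
    simp only [grSMul, grOne, AssocGr.pairing_mk]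
    exact AssocGr.mk_congr (add_zero i) (one_smul Aᵐᵒᵖ x) _ _
  mul_smul r s m := by
    change grSMul I M m (grMul I s.unop r.unop) = grSMul I M (grSMul I M m s.unop) r.unop
    generalize r.unop = z
    generalize s.unop = y
    induction m using AssocGr.induction with
    | zero => simp
    | hadd x x' h h' => simp only [map_add, AddMonoidHom.add_apply, h, h']
    | hmk i x hx =>
    induction y using AssocGr.induction with
    | zero => simp
    | hadd y y' h h' => simp only [map_add, AddMonoidHom.add_apply, h, h']
    | hmk j y hy =>
    induction z using AssocGr.induction with
    | zero => simp
    | hadd z z' h h' => simp only [map_add, h, h']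
    | hmk l z hz =>
    simp only [grMul, grSMul, AssocGr.pairing_mk]
    refine AssocGr.mk_congr (add_assoc i j l).symm ?_ _ _
    change MulOpposite.op (y * z) • x = MulOpposite.op z • MulOpposite.op y • x
    rw [MulOpposite.op_mul, mul_smul]

end AssociatedGraded

/-! ## Koszul modules and rings -/

section Koszul

/-- `M = ⨁ j, ℳ j` is a `ℤ`-graded right module over the `ℕ`-graded ring `R = ⨁ d, 𝒜 d`. -/
structure IsGradedRightModule {R : Type u} [Ring R] (𝒜 : ℕ → AddSubgroup R) {M : Type v}
    [AddCommGroup M] [Module Rᵐᵒᵖ M] (ℳ : ℤ → AddSubgroup M) : Prop where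
  isInternal : DirectSum.IsInternal ℳ
  smul_mem : ∀ (j : ℤ) (d : ℕ), ∀ m ∈ ℳ j, ∀ a ∈ 𝒜 d, MulOpposite.op a • m ∈ ℳ (j + d)

/-- A graded right module `M` over an `ℕ`-graded ring `R` (with `R_0` semisimple) is Koszul if it
has a graded projective resolution `⋯ → P 1 → P 0 → M → 0` in which `P i` is generated by its
component of degree `i`. -/
def IsKoszulModule {R : Type u} [Ring R] (𝒜 : ℕ → AddSubgroup R) {M : Type v}
    [AddCommGroup M] [Module Rᵐᵒᵖ M] (ℳ : ℤ → AddSubgroup M) : Prop :=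
  ∃ (P : ℕ → Type (max u v)) (_ : ∀ i, AddCommGroup (P i)) (_ : ∀ i, Module Rᵐᵒᵖ (P i))
    (𝒬 : ∀ i, ℤ → AddSubgroup (P i))
    (δ : ∀ i, P (i + 1) →ₗ[Rᵐᵒᵖ] P i) (ε : P 0 →ₗ[Rᵐᵒᵖ] M),
    (∀ i, IsGradedRightModule 𝒜 (𝒬 i)) ∧
    (∀ i, Module.Projective Rᵐᵒᵖ (P i)) ∧
    (∀ i j, ∀ x ∈ 𝒬 (i + 1) j, δ i x ∈ 𝒬 i j) ∧
    (∀ j, ∀ x ∈ 𝒬 0 j, ε x ∈ ℳ j) ∧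
    Function.Surjective ε ∧
    Function.Exact (δ 0) ε ∧
    (∀ i, Function.Exact (δ (i + 1)) (δ i)) ∧
    (∀ i : ℕ, Submodule.span Rᵐᵒᵖ (𝒬 i (i : ℤ) : Set (P i)) = ⊤)

/-- A right `A`-module `M` is (nongraded) Koszul, with respect to the two-sided ideal `I`, if
`gr_I M` is a Koszul `gr_I A`-module. -/
def IsNongradedKoszulModule {A : Type u} [Ring A] (I : Ideal A) [I.IsTwoSided] (M : Type v)
    [AddCommGroup M] [Module Aᵐᵒᵖ M] : Prop :=
  IsKoszulModule (R := GrRing I) (M := GrModule I M) (AssocGr.component (adicFiltration I))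
    (AssocGr.intComponent (adicModuleFiltration I M))

/-- The right `A`-module structure on `A / I`. -/
@[reducible]
def quotientRightModule {A : Type u} [Ring A] (I : Ideal A) [I.IsTwoSided] :
    Module Aᵐᵒᵖ (A ⧸ I) :=
  Module.compHom (A ⧸ I) (RingHom.op (Ideal.Quotient.mk I))

/-- `A` is a (nongraded) Koszul ring with respect to `A = A₀ ⊕ I`: the subring `A₀` is semisimple,
`I` is a two-sided ideal complementary to it, and the right `A`-module `A / I` is (nongraded)
Koszul. -/
def IsNongradedKoszulRing {A : Type u} [Ring A] (A₀ : Subring A) (I : Ideal A) [I.IsTwoSided] :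
    Prop :=
  IsSemisimpleRing A₀ ∧ IsCompl A₀.toAddSubgroup I.toAddSubgroup ∧
    letI := quotientRightModule I
    IsNongradedKoszulModule I (A ⧸ I)

end Koszul

/-! ## Simplicial complexes, reduced homology, sequential Cohen–Macaulayness -/

section Complexes

/-- An abstract simplicial complex, given by all of its faces. The empty face is a face of every
complex that has a face at all. -/
structure FaceComplex (V : Type u) where
  faces : Set (Finset V)
  down_closed : ∀ F ∈ faces, ∀ G ⊆ F, G ∈ faces

namespace FaceComplex

/-- The link of a finite set of vertices. -/
def link {V : Type u} [DecidableEq V] (Δ : FaceComplex V) (F : Finset V) : FaceComplex V where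
  faces := {G | G ∈ Δ.faces ∧ F ∪ G ∈ Δ.faces ∧ F ∩ G = ∅}
  down_closed := by
    rintro G ⟨h1, h2, h3⟩ H hH
    refine ⟨Δ.down_closed _ h1 _ hH, Δ.down_closed _ h2 _ (Finset.union_subset_union_right hH), ?_⟩
    exact Finset.subset_empty.1 (h3 ▸ Finset.inter_subset_inter_left hH)

/-- The `j`-th sequential layer: the subcomplex generated by the faces of dimension at least
`j`. -/
def layer {V : Type u} (Δ : FaceComplex V) (j : ℤ) : FaceComplex V where
  faces := {G | ∃ F ∈ Δ.faces, j ≤ (F.card : ℤ) - 1 ∧ G ⊆ F}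
  down_closed := by
    rintro G ⟨F, hF, hj, hGF⟩ H hH
    exact ⟨F, hF, hj, hH.trans hGF⟩

/-- The simplicial boundary map: the finite set `F = {v₀ < ⋯ < vₙ}` is sent to
`∑ i, (-1)^i (F \ {vᵢ})`; in particular a single vertex is sent to the empty face. -/
noncomputable def boundary (k : Type v) [Field k] (V : Type u) [LinearOrder V] :
    (Finset V →₀ k) →ₗ[k] (Finset V →₀ k) :=
  Finsupp.linearCombination k fun F : Finset V =>
    ∑ v ∈ F, Finsupp.single (F.erase v) ((-1 : k) ^ (F.filter (· < v)).card)

/-- The `i`-chains: combinations of the `i`-dimensional faces; the empty face spans the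
`(-1)`-chains. -/
noncomputable def chains (k : Type v) [Field k] {V : Type u} (Δ : FaceComplex V) (i : ℤ) :
    Submodule k (Finset V →₀ k) :=
  Finsupp.supported k k {F | F ∈ Δ.faces ∧ (F.card : ℤ) - 1 = i}

/-- The `i`-cycles. -/
noncomputable def cycles (k : Type v) [Field k] {V : Type u} [LinearOrder V] (Δ : FaceComplex V)
    (i : ℤ) : Submodule k (Finset V →₀ k) :=
  Δ.chains k i ⊓ LinearMap.ker (boundary k V)

/-- The `i`-boundaries. -/
noncomputable def boundaries (k : Type v) [Field k] {V : Type u} [LinearOrder V]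
    (Δ : FaceComplex V) (i : ℤ) : Submodule k (Finset V →₀ k) :=
  (Δ.chains k (i + 1)).map (boundary k V)

/-- The reduced simplicial homology of `Δ` over `k` (cycles modulo boundaries) vanishes in degree
`i`: every `i`-cycle is an `i`-boundary. -/
def ReducedHomologyVanishes (k : Type v) [Field k] {V : Type u} [LinearOrder V]
    (Δ : FaceComplex V) (i : ℤ) : Prop :=
  Δ.cycles k i ≤ Δ.boundaries k i

/-- `Δ` is sequentially acyclic over `k`: the reduced homology of its `j`-th layer vanishes in all
degrees `i` with `-1 ≤ i < j ≤ dim Δ`; here `j ≤ dim Δ` says that `Δ` has a face of dimension at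
least `j`. -/
def IsSequentiallyAcyclic (k : Type v) [Field k] {V : Type u} [LinearOrder V]
    (Δ : FaceComplex V) : Prop :=
  ∀ i j : ℤ, -1 ≤ i → i < j → (∃ F ∈ Δ.faces, j ≤ (F.card : ℤ) - 1) →
    (Δ.layer j).ReducedHomologyVanishes k i

/-- `Δ` is sequentially Cohen–Macaulay over `k`: all links of faces are sequentially acyclic. -/
def IsSequentiallyCohenMacaulay (k : Type v) [Field k] {V : Type u} [LinearOrder V]
    (Δ : FaceComplex V) : Prop :=
  ∀ F ∈ Δ.faces, (Δ.link F).IsSequentiallyAcyclic k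

end FaceComplex

/-- The order complex of a poset: its faces are the finite chains. -/
def orderComplex (Q : Type u) [PartialOrder Q] : FaceComplex Q where
  faces := {F | IsChain (· ≤ ·) (F : Set Q)}
  down_closed := fun _ hF _ hG => hF.mono (Finset.coe_subset.2 hG)

/-- A total order on a poset that extends the given partial order. -/
noncomputable abbrev linearExtensionOrder (Q : Type u) [PartialOrder Q] : LinearOrder Q :=
  inferInstanceAs (LinearOrder (LinearExtension Q))

/-- A poset is sequentially Cohen–Macaulay if its order complex is. (The total order of the
vertices, which only serves to orient the faces, is a linear extension of the poset.) -/
def PosetIsSequentiallyCohenMacaulay (k : Type v) [Field k] (Q : Type u) [PartialOrder Q] : Prop :=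
  @FaceComplex.IsSequentiallyCohenMacaulay k _ Q
    (linearExtensionOrder Q) (orderComplex Q)

end Complexes

/-! ## Reduced incidence algebras -/

namespace ReducedIncidence

section Axioms

/-- The closed interval `[x, y]`, as an element of the set `Int(P)` of all closed intervals. -/
abbrev cl {P : Type u} [PartialOrder P] {x y : P} (h : x ≤ y) : NonemptyInterval P := ⟨(x, y), h⟩

/-- If `[x,y] ∼ [x',y']` and `[y,z] ∼ [y',z']` then `[x,z] ∼ [x',z']`. -/
def OrderCompatible {P : Type u} [PartialOrder P] (r : Setoid (NonemptyInterval P)) : Prop :=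
  ∀ (x y z x' y' z' : P) (hxy : x ≤ y) (hyz : y ≤ z) (hxy' : x' ≤ y') (hyz' : y' ≤ z'),
    r (cl hxy) (cl hxy') → r (cl hyz) (cl hyz') →
      r (cl (hxy.trans hyz)) (cl (hxy'.trans hyz'))

/-- The map `[x,y] → (Int(P)/∼) × (Int(P)/∼)` sending `z` to the classes of `[x,z]` and
`[z,y]`. -/
def intervals {P : Type u} [PartialOrder P] (r : Setoid (NonemptyInterval P))
    (J : NonemptyInterval P) (z : Set.Icc J.fst J.snd) : Quotient r × Quotient r :=
  (Quotient.mk r (cl z.2.1), Quotient.mk r (cl z.2.2))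

/-- If `[x,y] ∼ [x',y']` then there is exactly one map `τ : [x,y] → [x',y']` that commutes with
the interval maps. -/
def Invariant {P : Type u} [PartialOrder P] (r : Setoid (NonemptyInterval P)) : Prop :=
  ∀ J J' : NonemptyInterval P, r J J' →
    ∃! τ : Set.Icc J.fst J.snd → Set.Icc J'.fst J'.snd, intervals r J' ∘ τ = intervals r J

/-- The equivalence relation on `P` with `x ∼ y` if `[x,x] ∼ [y,y]`. -/
def pointSetoid {P : Type u} [PartialOrder P] (r : Setoid (NonemptyInterval P)) : Setoid P :=
  r.comap NonemptyInterval.pure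

/-- `P/∼` is finite. -/
def FinitelyManyPoints {P : Type u} [PartialOrder P] (r : Setoid (NonemptyInterval P)) : Prop :=
  Finite (Quotient (pointSetoid r))

/-- If `x ≤ y₁`, `y₂ ≤ z` and `y₁ ∼ y₂`, there are `x' ≤ y' ≤ z'` with `[x',y'] ∼ [x,y₁]` and
`[y',z'] ∼ [y₂,z]`. -/
def Concatenative {P : Type u} [PartialOrder P] (r : Setoid (NonemptyInterval P)) : Prop :=
  ∀ (x y₁ y₂ z : P) (h₁ : x ≤ y₁) (h₂ : y₂ ≤ z), pointSetoid r y₁ y₂ →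
    ∃ (x' y' z' : P) (hxy : x' ≤ y') (hyz : y' ≤ z'),
      r (cl hxy) (cl h₁) ∧ r (cl hyz) (cl h₂)

/-- The four axioms on `(P, ∼)`. -/
class Axioms {P : Type u} [PartialOrder P] (r : Setoid (NonemptyInterval P)) : Prop where
  orderCompatible : OrderCompatible r
  invariant : Invariant r
  finitelyManyPoints : FinitelyManyPoints r
  concatenative : Concatenative r

/-- There are `x ≤ y ≤ z` with `[x,y]`, `[y,z]`, `[x,z]` in the classes `a`, `b`, `c`. -/
def Composes {P : Type u} [PartialOrder P] (r : Setoid (NonemptyInterval P))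
    (a b c : Quotient r) : Prop :=
  ∃ (x y z : P) (hxy : x ≤ y) (hyz : y ≤ z),
    Quotient.mk r (cl hxy) = a ∧ Quotient.mk r (cl hyz) = b ∧
      Quotient.mk r (cl (hxy.trans hyz)) = c

/-- The class of `[x,x]`, for `x` in `P/∼`. -/
def pointClass {P : Type u} [PartialOrder P] (r : Setoid (NonemptyInterval P)) :
    Quotient (pointSetoid r) → Quotient r :=
  Quotient.map' NonemptyInterval.pure (fun _ _ h => h)

theorem point_eq_iff {P : Type u} [PartialOrder P] {r : Setoid (NonemptyInterval P)}
    {x y : P} :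
    Quotient.mk (pointSetoid r) x = Quotient.mk (pointSetoid r) y ↔
    Quotient.mk r (NonemptyInterval.pure x) = Quotient.mk r (NonemptyInterval.pure y) := by
  rw [Quotient.eq, Quotient.eq]
  rfl

variable {P : Type u} [PartialOrder P] {r : Setoid (NonemptyInterval P)} [hr : Axioms r]

theorem exists_split {x z x' z' : P} {hxz : x ≤ z} {hxz' : x' ≤ z'}
    (h : Quotient.mk r (cl hxz) = Quotient.mk r (cl hxz')) {y : P} (h₁ : x ≤ y) (h₂ : y ≤ z) :
    ∃ (y' : P) (h₁' : x' ≤ y') (h₂' : y' ≤ z'),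
      Quotient.mk r (cl h₁') = Quotient.mk r (cl h₁) ∧
        Quotient.mk r (cl h₂') = Quotient.mk r (cl h₂) := by
  obtain ⟨τ, hτ, -⟩ := hr.invariant _ _ (Quotient.exact h)
  have := congrFun hτ ⟨y, h₁, h₂⟩
  exact ⟨(τ ⟨y, h₁, h₂⟩).1, (τ ⟨y, h₁, h₂⟩).2.1, (τ ⟨y, h₁, h₂⟩).2.2,
    congrArg Prod.fst this, congrArg Prod.snd this⟩

theorem eq_of_mk_eq_pure {x y u : P} {h : x ≤ y}
    (h' : Quotient.mk r (cl h) = Quotient.mk r (NonemptyInterval.pure u)) : x = y := by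
  obtain ⟨τ, hτ, -⟩ := hr.invariant _ _ (Quotient.exact h')
  obtain ⟨σ, hσ, -⟩ := hr.invariant _ _ (Quotient.exact h'.symm)
  obtain ⟨ι, -, huniq⟩ := hr.invariant (cl h) (cl h) (r.refl _)
  have h1 : σ ∘ τ = id :=
    (huniq _ (by beta_reduce; rw [← Function.comp_assoc, hσ, hτ])).trans (huniq id rfl).symm
  have h2 : ∀ a b : Set.Icc u u, a = b := fun a b =>
    Subtype.ext ((le_antisymm a.2.2 a.2.1).trans (le_antisymm b.2.2 b.2.1).symm)
  have h3 := congrArg σ (h2 (τ ⟨x, le_rfl, h⟩) (τ ⟨y, h, le_rfl⟩))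
  have h4 := (congrFun h1 ⟨x, le_rfl, h⟩).symm.trans (h3.trans (congrFun h1 ⟨y, h, le_rfl⟩))
  exact congrArg Subtype.val h4

theorem source_eq {x y x' y' : P} {h : x ≤ y} {h' : x' ≤ y'}
    (hh : Quotient.mk r (cl h) = Quotient.mk r (cl h')) :
    Quotient.mk (pointSetoid r) x = Quotient.mk (pointSetoid r) x' := by
  obtain ⟨t, h₁, h₂, e, -⟩ := exists_split hh le_rfl h
  obtain rfl := eq_of_mk_eq_pure (u := x) e
  exact point_eq_iff.2 e.symm

theorem target_eq {x y x' y' : P} {h : x ≤ y} {h' : x' ≤ y'}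
    (hh : Quotient.mk r (cl h) = Quotient.mk r (cl h')) :
    Quotient.mk (pointSetoid r) y = Quotient.mk (pointSetoid r) y' := by
  obtain ⟨t, h₁, h₂, -, e⟩ := exists_split hh h le_rfl
  obtain rfl := eq_of_mk_eq_pure (u := y) e
  exact point_eq_iff.2 e.symm

theorem Composes.unique {a b c c' : Quotient r} (h : Composes r a b c) (h' : Composes r a b c') :
    c = c' := by
  obtain ⟨x, y, z, hxy, hyz, rfl, rfl, rfl⟩ := h
  obtain ⟨x', y', z', hxy', hyz', h1, h2, rfl⟩ := h'
  exact (Quotient.sound (hr.orderCompatible _ _ _ _ _ _ _ _ _ _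
    (Quotient.exact h1) (Quotient.exact h2))).symm

theorem Composes.assoc {a b c d e : Quotient r} (h : Composes r a b d) (h' : Composes r d c e) :
    ∃ f, Composes r b c f ∧ Composes r a f e := by
  obtain ⟨x, y, z, hxy, hyz, rfl, rfl, rfl⟩ := h
  obtain ⟨x', z', w', hxz', hzw', h1, rfl, rfl⟩ := h'
  obtain ⟨y', h₁, h₂, e1, e2⟩ := exists_split h1.symm hxy hyz
  exact ⟨_, ⟨y', z', w', h₂, hzw', e2, rfl, rfl⟩, x', y', w', h₁, h₂.trans hzw', e1, rfl, rfl⟩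

theorem Composes.assoc' {a b c f e : Quotient r} (h : Composes r b c f) (h' : Composes r a f e) :
    ∃ d, Composes r a b d ∧ Composes r d c e := by
  obtain ⟨y, z, w, hyz, hzw, rfl, rfl, rfl⟩ := h
  obtain ⟨x', y', w', hxy', hyw', rfl, h1, rfl⟩ := h'
  obtain ⟨z', h₁, h₂, e1, e2⟩ := exists_split h1.symm hyz hzw
  exact ⟨_, ⟨x', y', z', hxy', h₁, rfl, e1, rfl⟩, x', z', w', hxy'.trans h₁, h₂, rfl, e2, rfl⟩

theorem composes_pointClass_left {x y : P} (h : x ≤ y) (p : Quotient (pointSetoid r))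
    (c : Quotient r) : Composes r (pointClass r p) (Quotient.mk r (cl h)) c ↔
      p = Quotient.mk (pointSetoid r) x ∧ c = Quotient.mk r (cl h) := by
  induction p using Quotient.inductionOn with | h p =>
  constructor
  · rintro ⟨s, t, w, hst, htw, e1, e2, rfl⟩
    obtain rfl := eq_of_mk_eq_pure (u := p) e1
    exact ⟨(point_eq_iff.2 e1.symm).trans (source_eq e2), e2⟩
  · rintro ⟨e, rfl⟩
    exact ⟨x, x, y, le_rfl, h, point_eq_iff.1 e.symm, rfl, rfl⟩

theorem composes_pointClass_right {x y : P} (h : x ≤ y) (p : Quotient (pointSetoid r))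
    (c : Quotient r) : Composes r (Quotient.mk r (cl h)) (pointClass r p) c ↔
      p = Quotient.mk (pointSetoid r) y ∧ c = Quotient.mk r (cl h) := by
  induction p using Quotient.inductionOn with | h p =>
  constructor
  · rintro ⟨s, t, w, hst, htw, e1, e2, rfl⟩
    obtain rfl := eq_of_mk_eq_pure (u := p) e2
    exact ⟨(point_eq_iff.2 e2.symm).trans (target_eq e1), e1⟩
  · rintro ⟨e, rfl⟩
    exact ⟨x, y, y, h, le_rfl, rfl, point_eq_iff.1 e.symm, rfl⟩

end Axioms

end ReducedIncidence

/-- The reduced incidence algebra `k[P]_red`: the `k`-vector space with basis `Int(P)/∼`. -/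
def ReducedIncidenceAlgebra (k : Type u) [Field k] {P : Type v} [PartialOrder P]
    (r : Setoid (NonemptyInterval P)) : Type (max u v) :=
  Quotient r →₀ k

namespace ReducedIncidenceAlgebra

open ReducedIncidence

section Basic

variable (k : Type u) [Field k] {P : Type v} [PartialOrder P] (r : Setoid (NonemptyInterval P))

noncomputable instance : AddCommGroup (ReducedIncidenceAlgebra k r) :=
  inferInstanceAs (AddCommGroup (Quotient r →₀ k))

noncomputable instance : Module k (ReducedIncidenceAlgebra k r) :=
  inferInstanceAs (Module k (Quotient r →₀ k))

/-- The basis vectors. -/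
noncomputable def ξ (a : Quotient r) : ReducedIncidenceAlgebra k r :=
  Finsupp.single (M := k) a 1

open Classical in
/-- The product of two basis vectors: `ξ_a ξ_b = ξ_c` if there are `x ≤ y ≤ z` with `[x,y] ∈ a`,
`[y,z] ∈ b`, `[x,z] ∈ c`, and `ξ_a ξ_b = 0` if there are none. -/
noncomputable def basisMul (a b : Quotient r) : ReducedIncidenceAlgebra k r :=
  if h : ∃ c, Composes r a b c then ξ k r h.choose else 0

/-- The bilinear extension of the product of basis vectors. -/
noncomputable def mulLinear :
    ReducedIncidenceAlgebra k r →ₗ[k] ReducedIncidenceAlgebra k r →ₗ[k]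
      ReducedIncidenceAlgebra k r :=
  Finsupp.linearCombination k fun a =>
    (Finsupp.linearCombination k fun b => basisMul k r a b :
      (Quotient r →₀ k) →ₗ[k] ReducedIncidenceAlgebra k r)

theorem mulLinear_ξ (a b : Quotient r) : mulLinear k r (ξ k r a) (ξ k r b) = basisMul k r a b := by
  unfold mulLinear ξ
  erw [Finsupp.linearCombination_single, one_smul, Finsupp.linearCombination_single, one_smul]

theorem induction {p : ReducedIncidenceAlgebra k r → Prop} (x : ReducedIncidenceAlgebra k r)
    (hzero : p 0) (hξ : ∀ a, p (ξ k r a)) (hadd : ∀ x y, p x → p y → p (x + y))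
    (hsmul : ∀ (c : k) x, p x → p (c • x)) : p x := by
  refine Finsupp.induction_linear (motive := p) x hzero hadd fun a c => ?_
  have h : (Finsupp.single a c : Quotient r →₀ k) = c • ξ k r a := by
    unfold ξ
    erw [Finsupp.smul_single, smul_eq_mul, mul_one]
  exact (congrArg p h).mpr (hsmul c _ (hξ a))

theorem basisMul_of_composes [Axioms r] {a b c : Quotient r} (h : Composes r a b c) :
    basisMul k r a b = ξ k r c := by
  have h' : ∃ c, Composes r a b c := ⟨c, h⟩
  rw [basisMul, dif_pos h', h'.choose_spec.unique h]

theorem basisMul_of_not {a b : Quotient r} (h : ¬ ∃ c, Composes r a b c) :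
    basisMul k r a b = 0 := by
  rw [basisMul, dif_neg h]

/-- `P/∼` is a finite type. -/
@[reducible]
noncomputable def pointFintype {P : Type v} [PartialOrder P] (r : Setoid (NonemptyInterval P))
    [hr : Axioms r] : Fintype (Quotient (pointSetoid r)) :=
  @Fintype.ofFinite _ hr.finitelyManyPoints

/-- The unit: the sum of all `ξ_[x,x]`, over the finitely many classes in `P/∼`. -/
noncomputable def unit [hr : Axioms r] : ReducedIncidenceAlgebra k r :=
  letI := pointFintype r
  ∑ p : Quotient (pointSetoid r), ξ k r (pointClass r p)

theorem unit_mul [hr : Axioms r] (a : Quotient r) :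
    mulLinear k r (unit k r) (ξ k r a) = ξ k r a := by
  let _ := pointFintype r
  induction a using Quotient.inductionOn with | h J =>
  simp only [unit, map_sum, LinearMap.sum_apply, mulLinear_ξ]
  rw [Finset.sum_eq_single (Quotient.mk (pointSetoid r) J.fst)]
  · exact basisMul_of_composes k r ((composes_pointClass_left J.fst_le_snd _ _).2 ⟨rfl, rfl⟩)
  · intro p _ hp
    refine basisMul_of_not k r ?_
    rintro ⟨c, hc⟩
    exact hp ((composes_pointClass_left J.fst_le_snd _ _).1 hc).1
  · intro h
    exact absurd (Finset.mem_univ _) h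

theorem mul_unit [hr : Axioms r] (a : Quotient r) :
    mulLinear k r (ξ k r a) (unit k r) = ξ k r a := by
  let _ := pointFintype r
  induction a using Quotient.inductionOn with | h J =>
  simp only [unit, map_sum, mulLinear_ξ]
  rw [Finset.sum_eq_single (Quotient.mk (pointSetoid r) J.snd)]
  · exact basisMul_of_composes k r ((composes_pointClass_right J.fst_le_snd _ _).2 ⟨rfl, rfl⟩)
  · intro p _ hp
    refine basisMul_of_not k r ?_
    rintro ⟨c, hc⟩
    exact hp ((composes_pointClass_right J.fst_le_snd _ _).1 hc).1
  · intro h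
    exact absurd (Finset.mem_univ _) h

theorem basis_assoc [Axioms r] (a b c : Quotient r) :
    mulLinear k r (mulLinear k r (ξ k r a) (ξ k r b)) (ξ k r c) =
      mulLinear k r (ξ k r a) (mulLinear k r (ξ k r b) (ξ k r c)) := by
  simp only [mulLinear_ξ]
  by_cases hl : ∃ d, Composes r a b d ∧ ∃ e, Composes r d c e
  · obtain ⟨d, h1, e, h2⟩ := hl
    obtain ⟨f, h3, h4⟩ := h1.assoc h2
    rw [basisMul_of_composes k r h1, basisMul_of_composes k r h3, mulLinear_ξ, mulLinear_ξ,
      basisMul_of_composes k r h2, basisMul_of_composes k r h4]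
  · have hright : ¬ ∃ f, Composes r b c f ∧ ∃ e, Composes r a f e := by
      rintro ⟨f, h1, e, h2⟩
      obtain ⟨d, h3, h4⟩ := h1.assoc' h2
      exact hl ⟨d, h3, e, h4⟩
    have h1 : mulLinear k r (basisMul k r a b) (ξ k r c) = 0 := by
      by_cases h : ∃ d, Composes r a b d
      · obtain ⟨d, hd⟩ := h
        rw [basisMul_of_composes k r hd, mulLinear_ξ]
        exact basisMul_of_not k r fun he => hl ⟨d, hd, he⟩
      · rw [basisMul_of_not k r h, map_zero, LinearMap.zero_apply]
    have h2 : mulLinear k r (ξ k r a) (basisMul k r b c) = 0 := by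
      by_cases h : ∃ f, Composes r b c f
      · obtain ⟨f, hf⟩ := h
        rw [basisMul_of_composes k r hf, mulLinear_ξ]
        exact basisMul_of_not k r fun he => hright ⟨f, hf, he⟩
      · rw [basisMul_of_not k r h, map_zero]
    rw [h1, h2]

noncomputable instance [Axioms r] : Ring (ReducedIncidenceAlgebra k r) where
  __ := (inferInstance : AddCommGroup (ReducedIncidenceAlgebra k r))
  mul x y := mulLinear k r x y
  one := unit k r
  left_distrib x y z := map_add (mulLinear k r x) y z
  right_distrib x y z := by
    change mulLinear k r (x + y) z = mulLinear k r x z + mulLinear k r y z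
    rw [map_add, LinearMap.add_apply]
  zero_mul x := by
    change mulLinear k r 0 x = 0
    rw [map_zero, LinearMap.zero_apply]
  mul_zero x := map_zero (mulLinear k r x)
  mul_assoc x y z := by
    change mulLinear k r (mulLinear k r x y) z = mulLinear k r x (mulLinear k r y z)
    induction x using ReducedIncidenceAlgebra.induction with
    | hzero => simp
    | hadd x x' h h' => simp only [map_add, LinearMap.add_apply, h, h']
    | hsmul c x h => simp only [map_smul, LinearMap.smul_apply, h]
    | hξ a =>
    induction y using ReducedIncidenceAlgebra.induction with
    | hzero => simp
    | hadd x x' h h' => simp only [map_add, LinearMap.add_apply, h, h']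
    | hsmul c x h => simp only [map_smul, LinearMap.smul_apply, h]
    | hξ b =>
    induction z using ReducedIncidenceAlgebra.induction with
    | hzero => simp
    | hadd x x' h h' => simp only [map_add, h, h']
    | hsmul c x h => simp only [map_smul, h]
    | hξ c => exact basis_assoc k r a b c
  one_mul x := by
    change mulLinear k r (unit k r) x = x
    induction x using ReducedIncidenceAlgebra.induction with
    | hzero => simp
    | hadd x x' h h' => simp only [map_add, h, h']
    | hsmul c x h => simp only [map_smul, h]
    | hξ a => exact unit_mul k r a
  mul_one x := by
    change mulLinear k r x (unit k r) = x
    induction x using ReducedIncidenceAlgebra.induction with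
    | hzero => simp
    | hadd x x' h h' => simp only [map_add, LinearMap.add_apply, h, h']
    | hsmul c x h => simp only [map_smul, LinearMap.smul_apply, h]
    | hξ a => exact mul_unit k r a

theorem ξ_mul_ξ [Axioms r] (a b : Quotient r) : ξ k r a * ξ k r b = basisMul k r a b :=
  mulLinear_ξ k r a b

noncomputable instance [Axioms r] : Algebra k (ReducedIncidenceAlgebra k r) :=
  Algebra.ofModule
    (fun c x y => by
      change mulLinear k r (c • x) y = c • mulLinear k r x y
      rw [map_smul, LinearMap.smul_apply])
    (fun c x y => map_smul (mulLinear k r x) c y)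

/-- The span of the `ξ_[x,x]`. -/
noncomputable def degreeZeroSpan : Submodule k (ReducedIncidenceAlgebra k r) :=
  Submodule.span k {f | ∃ x : P, f = ξ k r (Quotient.mk r (NonemptyInterval.pure x))}

/-- The span of the `ξ_[x,y]` with `x < y`. -/
noncomputable def properSpan : Submodule k (ReducedIncidenceAlgebra k r) :=
  Submodule.span k {f | ∃ (x y : P) (h : x < y), f = ξ k r (Quotient.mk r (cl h.le))}

/-- The subring `A₀` of `A = k[P]_red`: the `k`-span of the `ξ_[x,x]`. -/
noncomputable def degreeZero [hr : Axioms r] : Subring (ReducedIncidenceAlgebra k r) where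
  carrier := degreeZeroSpan k r
  zero_mem' := (degreeZeroSpan k r).zero_mem
  add_mem' := (degreeZeroSpan k r).add_mem
  neg_mem' := (degreeZeroSpan k r).neg_mem
  one_mem' := by
    let _ := pointFintype r
    change unit k r ∈ degreeZeroSpan k r
    refine Submodule.sum_mem _ fun p _ => ?_
    induction p using Quotient.inductionOn with | h x =>
    exact Submodule.subset_span ⟨x, rfl⟩
  mul_mem' := by
    intro f g hf hg
    have hf' : f ∈ degreeZeroSpan k r := hf
    have hg' : g ∈ degreeZeroSpan k r := hg
    change f * g ∈ degreeZeroSpan k r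
    clear hf hg
    unfold degreeZeroSpan at hf' hg'
    induction hf' using Submodule.span_induction with
    | zero => rw [zero_mul]; exact zero_mem _
    | add x y _ _ h h' => rw [add_mul]; exact add_mem h h'
    | smul c x _ h => rw [smul_mul_assoc]; exact Submodule.smul_mem _ c h
    | mem f hf =>
    induction hg' using Submodule.span_induction with
    | zero => rw [mul_zero]; exact zero_mem _
    | add x y _ _ h h' => rw [mul_add]; exact add_mem h h'
    | smul c x _ h => rw [mul_smul_comm]; exact Submodule.smul_mem _ c h
    | mem g hg =>
    obtain ⟨x, rfl⟩ := hf
    obtain ⟨y, rfl⟩ := hg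
    rw [ξ_mul_ξ]
    by_cases h : ∃ c, Composes r (Quotient.mk r (NonemptyInterval.pure x))
        (Quotient.mk r (NonemptyInterval.pure y)) c
    · obtain ⟨c, hc⟩ := h
      rw [basisMul_of_composes k r hc]
      obtain ⟨-, rfl⟩ := (composes_pointClass_left (le_refl y) (Quotient.mk _ x) c).1 hc
      exact Submodule.subset_span ⟨y, rfl⟩
    · rw [basisMul_of_not k r h]; exact zero_mem _

theorem mul_mem_properSpan_left [Axioms r] (f g : ReducedIncidenceAlgebra k r)
    (hg : g ∈ properSpan k r) : f * g ∈ properSpan k r := by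
  unfold properSpan at hg
  induction f using ReducedIncidenceAlgebra.induction with
  | hzero => rw [zero_mul]; exact zero_mem _
  | hadd x y h h' => rw [add_mul]; exact add_mem h h'
  | hsmul c x h => rw [smul_mul_assoc]; exact Submodule.smul_mem _ c h
  | hξ a =>
  induction hg using Submodule.span_induction with
  | zero => rw [mul_zero]; exact zero_mem _
  | add x y _ _ h h' => rw [mul_add]; exact add_mem h h'
  | smul c x _ h => rw [mul_smul_comm]; exact Submodule.smul_mem _ c h
  | mem g hg =>
  obtain ⟨x, y, hxy, rfl⟩ := hg
  rw [ξ_mul_ξ]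
  by_cases h : ∃ c, Composes r a (Quotient.mk r (cl hxy.le)) c
  · obtain ⟨c, hc⟩ := h
    rw [basisMul_of_composes k r hc]
    obtain ⟨s, t, w, hst, htw, -, e, rfl⟩ := hc
    refine Submodule.subset_span ⟨s, w, lt_of_le_of_lt hst (lt_of_le_of_ne htw ?_), rfl⟩
    rintro rfl
    exact hxy.ne (eq_of_mk_eq_pure (u := t) e.symm)
  · rw [basisMul_of_not k r h]; exact zero_mem _

theorem mul_mem_properSpan_right [Axioms r] (f g : ReducedIncidenceAlgebra k r)
    (hf : f ∈ properSpan k r) : f * g ∈ properSpan k r := by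
  unfold properSpan at hf
  induction g using ReducedIncidenceAlgebra.induction with
  | hzero => rw [mul_zero]; exact zero_mem _
  | hadd x y h h' => rw [mul_add]; exact add_mem h h'
  | hsmul c x h => rw [mul_smul_comm]; exact Submodule.smul_mem _ c h
  | hξ a =>
  induction hf using Submodule.span_induction with
  | zero => rw [zero_mul]; exact zero_mem _
  | add x y _ _ h h' => rw [add_mul]; exact add_mem h h'
  | smul c x _ h => rw [smul_mul_assoc]; exact Submodule.smul_mem _ c h
  | mem f hf =>
  obtain ⟨x, y, hxy, rfl⟩ := hf
  rw [ξ_mul_ξ]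
  by_cases h : ∃ c, Composes r (Quotient.mk r (cl hxy.le)) a c
  · obtain ⟨c, hc⟩ := h
    rw [basisMul_of_composes k r hc]
    obtain ⟨s, t, w, hst, htw, e, -, rfl⟩ := hc
    refine Submodule.subset_span ⟨s, w, lt_of_lt_of_le (lt_of_le_of_ne hst ?_) htw, rfl⟩
    rintro rfl
    exact hxy.ne (eq_of_mk_eq_pure (u := s) e.symm)
  · rw [basisMul_of_not k r h]; exact zero_mem _

/-- The two-sided ideal `I` of `A = k[P]_red`: the `k`-span of the `ξ_[x,y]` with `x < y`. -/
noncomputable def properIdeal [Axioms r] : Ideal (ReducedIncidenceAlgebra k r) where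
  carrier := properSpan k r
  zero_mem' := (properSpan k r).zero_mem
  add_mem' := (properSpan k r).add_mem
  smul_mem' f g hg := mul_mem_properSpan_left k r f g hg

instance [Axioms r] : (properIdeal k r).IsTwoSided :=
  ⟨fun {f} g hf => mul_mem_properSpan_right k r f g hf⟩

end Basic

end ReducedIncidenceAlgebra

-- Koszulness and sequential Cohen–Macaulayness are both vanishing statements about complexes of
-- chains x < z₁ < ⋯ < zₙ < y, and the proof identifies these complexes.
--
-- Let the length of a class be the largest number of non-identities in a factorization of it; by
-- invariance this is the length of a longest chain in any representing interval. Lengths are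
-- superadditive under composition, so I^d is spanned by the classes of length at least d
-- (`mem_pow_iff`). Hence gr_I A has a basis indexed by the classes, in which a product of basis
-- vectors is the composite if the lengths add up, and zero otherwise (`grBasis`). The graded module
-- of A/I sits in degree zero and is one-dimensional at each vertex.
--
-- For a module over such a ring that is concentrated in degree zero, a linear projective resolution
-- exists if and only if the normalised bar construction is exact in homological degree i and
-- internal degree p whenever i < p (`PathBasis.isKoszulModule_iff`). One direction is dimension
-- shifting along the given resolution (`bar_exact_of_resolution`). The other builds a minimal
-- resolution one projective cover at a time (`LinMod.exists_cover`, `LinCover.next`).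
--
-- For A/I the bar construction is spanned by composable lists of classes. Merging neighbours
-- preserves the composite of the whole list, so the complex splits according to composites, and by
-- invariance the lists with composite the class of [x,y] are the chains from x to y. A merge erases
-- a point of the chain, and it survives in gr_I A exactly if the total length of the steps, the
-- weight, is unchanged (`bar_steps`, `listExactAt_iff_linExactThrough`). So the complex is the
-- weight-preserving part of the reduced chain complex of the order complex of (x,y), filtered by
-- weight. The weight of a chain is the number of steps of its longest refinement, so the filtration
-- layers are, up to a shift of indices, the sequential layers Δ^⟨j⟩. Induction on the filtration
-- (`Finsupp.IsFiltered.linExact_iff`) turns exactness of the weight-preserving part below the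
-- diagonal into sequential acyclicity.
--
-- It remains to treat links. Chains through a fixed chain F are tuples of chains in the successive
-- intervals cut out by F, and weights add up. The complex of a link is therefore a tensor product
-- of complexes of intervals, and the Künneth argument `Finsupp.LinExact.prod` carries the vanishing
-- from all intervals to all links. Conversely, an open interval is the link of its own empty face.

universe w x

/-! ### Rings with a path basis and the bar differential on lists -/

section

open MulOpposite

/-- A ring with a `k`-basis of homogeneous paths of non-negative length, where the product
of two basis vectors is again a basis vector or zero. -/
structure PathBasis (k : Type u) [Field k] (R : Type w) [Ring R] (O Q : Type v)
    [Fintype O] where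
  src : Q → O
  tgt : Q → O
  one : O → Q
  len : Q → ℕ
  mul : Q → Q → Option Q
  src_one : ∀ p, src (one p) = p
  tgt_one : ∀ p, tgt (one p) = p
  len_one : ∀ p, len (one p) = 0
  eq_one : ∀ a, len a = 0 → a = one (src a)
  mul_some : ∀ a b c, mul a b = some c →
    tgt a = src b ∧ src c = src a ∧ tgt c = tgt b ∧ len c = len a + len b
  assoc : ∀ a b c, (mul a b).bind (fun x => mul x c) = (mul b c).bind (fun x => mul a x)
  one_mul : ∀ a, mul (one (src a)) a = some a
  mul_one : ∀ a, mul a (one (tgt a)) = some a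
  mon : Q → k →+ R
  coef : R →+ (Q →₀ k)
  coef_mon : ∀ a c, coef (mon a c) = Finsupp.single a c
  sum_coef : ∀ x, Finsupp.liftAddHom mon (coef x) = x
  mon_mul : ∀ a b c c', mon a c * mon b c' = (mul a b).elim 0 fun g => mon g (c * c')
  one_eq : (1 : R) = ∑ p, mon (one p) 1

/-- The elements `m` of a subgroup that vanish unless `p` holds. -/
def AddSubgroup.cell {M : Type*} [AddCommGroup M] (p : Prop) (S : AddSubgroup M) :
    AddSubgroup M where
  carrier := {m | m = 0 ∨ (p ∧ m ∈ S)}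
  zero_mem' := Or.inl rfl
  add_mem' := by
    rintro a b (rfl | ha) (rfl | hb)
    · simp
    · simpa using Or.inr hb
    · simpa using Or.inr ha
    · exact Or.inr ⟨ha.1, S.add_mem ha.2 hb.2⟩
  neg_mem' := by
    rintro a (rfl | ha)
    · simp
    · exact Or.inr ⟨ha.1, S.neg_mem ha.2⟩

theorem AddSubgroup.mem_cell {M : Type*} [AddCommGroup M] {p : Prop} {S : AddSubgroup M} {m : M} :
    m ∈ AddSubgroup.cell p S ↔ m = 0 ∨ (p ∧ m ∈ S) := Iff.rfl

/-- Finitely supported functions with pointwise constraints. -/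
def Finsupp.constrained {ι M : Type*} [AddCommGroup M] (C : ι → AddSubgroup M) :
    AddSubgroup (ι →₀ M) where
  carrier := {f | ∀ i, f i ∈ C i}
  zero_mem' _ := zero_mem _
  add_mem' ha hb i := add_mem (ha i) (hb i)
  neg_mem' ha i := neg_mem (ha i)

theorem Finsupp.mem_constrained {ι M : Type*} [AddCommGroup M] {C : ι → AddSubgroup M}
    {f : ι →₀ M} : f ∈ Finsupp.constrained C ↔ ∀ i, f i ∈ C i := Iff.rfl

theorem Finsupp.single_mem_constrained {ι M : Type*} [AddCommGroup M] {C : ι → AddSubgroup M}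
    {i : ι} {m : M} (h : m ∈ C i) : Finsupp.single i m ∈ Finsupp.constrained C := by
  classical
  intro j
  rw [Finsupp.single_apply]
  split_ifs with hij
  · exact hij ▸ h
  · exact zero_mem _

/-- A constrained function is the sum of its one-point parts, which obey the same constraints.
Claims about a homogeneous piece of the bar construction can thus be checked on one list with one
coefficient. -/
theorem Finsupp.map_mem_of_constrained {ι M N : Type*} [AddCommGroup M] [AddCommGroup N]
    {C : ι → AddSubgroup M} (T : (ι →₀ M) →+ N) (K : AddSubgroup N)
    (h : ∀ i, ∀ m ∈ C i, T (Finsupp.single i m) ∈ K) {f : ι →₀ M}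
    (hf : f ∈ Finsupp.constrained C) : T f ∈ K := by
  rw [← Finsupp.sum_single f, Finsupp.sum, map_sum]
  exact sum_mem fun i _ => h i _ (hf i)

theorem Finsupp.map_eq_of_constrained {ι M N : Type*} [AddCommGroup M] [AddCommGroup N]
    {C : ι → AddSubgroup M} (T T' : (ι →₀ M) →+ N)
    (h : ∀ i, ∀ m ∈ C i, T (Finsupp.single i m) = T' (Finsupp.single i m)) {f : ι →₀ M}
    (hf : f ∈ Finsupp.constrained C) : T f = T' f := by
  rw [← Finsupp.sum_single f, Finsupp.sum, map_sum, map_sum]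
  exact Finset.sum_congr rfl fun i _ => h i _ (hf i)

namespace PathBasis

variable {k : Type u} [Field k] {R : Type w} [Ring R] {O Q : Type v} [Fintype O]
  (β : PathBasis k R O Q)

section Lists

variable (M : Type*) [AddCommGroup M]

/-- Multiply the head of a list by `a` from the left. -/
noncomputable def merge (a : Q) : (List Q →₀ M) →+ (List Q →₀ M) :=
  Finsupp.liftAddHom fun l => match l with
    | [] => 0
    | b :: l => (β.mul a b).elim 0 fun c => Finsupp.singleAddHom (c :: l)

/-- Prepend `a`. -/
noncomputable def consHom (a : Q) : (List Q →₀ M) →+ (List Q →₀ M) :=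
  Finsupp.mapDomain.addMonoidHom (List.cons a)

variable {M}

@[simp] theorem merge_nil (a : Q) (m : M) : β.merge M a (Finsupp.single [] m) = 0 := by
  simp [merge]

theorem merge_cons (a b : Q) (l : List Q) (m : M) : β.merge M a (Finsupp.single (b :: l) m) =
    (β.mul a b).elim 0 fun c => Finsupp.single (c :: l) m := by
  simp only [merge, Finsupp.liftAddHom_apply_single]
  cases β.mul a b <;> simp

@[simp] theorem consHom_single (a : Q) (l : List Q) (m : M) :
    consHom M a (Finsupp.single l m) = Finsupp.single (a :: l) m := by
  simp [consHom]

theorem merge_consHom (a b : Q) (w : List Q →₀ M) : β.merge M a (consHom M b w) =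
    (β.mul a b).elim 0 fun c => consHom M c w := by
  cases h : β.mul a b with
  | none =>
    suffices (β.merge M a).comp (consHom M b) = 0 from DFunLike.congr_fun this w
    ext l m : 2
    simp [merge_cons, h]
  | some c =>
    suffices (β.merge M a).comp (consHom M b) = consHom M c from DFunLike.congr_fun this w
    ext l m : 2
    simp [merge_cons, h]

/-- Associativity of the partial product, applied to the head. On the empty list both sides vanish.
-/
theorem merge_merge (a b : Q) (w : List Q →₀ M) : β.merge M a (β.merge M b w) =
    (β.mul a b).elim 0 fun c => β.merge M c w := by
  have key : ∀ l m, β.merge M a (β.merge M b (Finsupp.single l m)) =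
      (β.mul a b).elim 0 fun c => β.merge M c (Finsupp.single l m) := by
    intro l m
    cases l with
    | nil => simp; cases β.mul a b <;> simp
    | cons d l =>
      rw [merge_cons]
      have h := β.assoc a b d
      cases h1 : β.mul a b <;> cases h2 : β.mul b d <;> simp [h1, h2] at h ⊢
      · simp [merge_cons, ← h]
      · simp [merge_cons, h]
      · simp [merge_cons, h]
  cases h : β.mul a b with
  | none =>
    suffices (β.merge M a).comp (β.merge M b) = 0 from DFunLike.congr_fun this w
    ext l m : 2
    simpa [h] using key l m
  | some c =>
    suffices (β.merge M a).comp (β.merge M b) = β.merge M c from DFunLike.congr_fun this w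
    ext l m : 2
    simpa [h] using key l m

/-- The differential of the bar construction on one list, merging neighbours. -/
noncomputable def barList : List Q → M →+ (List Q →₀ M)
  | [] => 0
  | a :: l => (β.merge M a).comp (Finsupp.singleAddHom l) - (consHom M a).comp (barList l)

variable (M) in
/-- The differential of the bar construction on lists, merging neighbours. -/
noncomputable def bar : (List Q →₀ M) →+ (List Q →₀ M) := Finsupp.liftAddHom β.barList

@[simp] theorem bar_nil (m : M) : β.bar M (Finsupp.single [] m) = 0 := by
  rw [bar, Finsupp.liftAddHom_apply_single, barList]
  rfl

/-- This recursion replaces the alternating sum over positions: the first merge is split off and the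
remaining ones change sign. All later identities for `bar` follow from it by induction. -/
theorem bar_consHom (a : Q) (w : List Q →₀ M) :
    β.bar M (consHom M a w) = β.merge M a w - consHom M a (β.bar M w) := by
  suffices (β.bar M).comp (consHom M a) = β.merge M a - (consHom M a).comp (β.bar M) from
    DFunLike.congr_fun this w
  ext l m : 2
  simp [bar, barList]

theorem bar_cons (a : Q) (l : List Q) (m : M) : β.bar M (Finsupp.single (a :: l) m) =
    β.merge M a (Finsupp.single l m) - consHom M a (β.bar M (Finsupp.single l m)) := by
  rw [← bar_consHom, consHom_single]

/-- Multiplying the head from the left commutes with the first merge by associativity and does not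
touch the others. This is what cancels the cross terms in `bar_bar`. -/
theorem bar_merge (a : Q) (w : List Q →₀ M) : β.bar M (β.merge M a w) = β.merge M a (β.bar M w) := by
  suffices (β.bar M).comp (β.merge M a) = (β.merge M a).comp (β.bar M) from
    DFunLike.congr_fun this w
  ext l m : 2
  cases l with
  | nil => simp
  | cons b l =>
    simp only [AddMonoidHom.comp_apply, Finsupp.singleAddHom_apply, merge_cons, bar_cons, map_sub,
      merge_merge, merge_consHom]
    cases β.mul a b <;> simp [bar_cons]

theorem bar_bar (w : List Q →₀ M) : β.bar M (β.bar M w) = 0 := by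
  suffices (β.bar M).comp (β.bar M) = 0 from DFunLike.congr_fun this w
  ext l m : 2
  simp only [AddMonoidHom.comp_apply, Finsupp.singleAddHom_apply]
  induction l with
  | nil => simp
  | cons a l ih =>
    rw [bar_cons, map_sub, bar_merge, bar_consHom, ih]
    simp

theorem merge_mapRange {N : Type*} [AddCommGroup N] (φ : M →+ N) (a : Q) (w : List Q →₀ M) :
    β.merge N a (Finsupp.mapRange.addMonoidHom φ w) =
      Finsupp.mapRange.addMonoidHom φ (β.merge M a w) := by
  suffices (β.merge N a).comp (Finsupp.mapRange.addMonoidHom φ) =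
    (Finsupp.mapRange.addMonoidHom φ).comp (β.merge M a) from DFunLike.congr_fun this w
  ext l m : 2
  cases l with
  | nil => simp
  | cons b l => simp [merge_cons]; cases β.mul a b <;> simp

theorem consHom_mapRange {N : Type*} [AddCommGroup N] (φ : M →+ N) (a : Q) (w : List Q →₀ M) :
    consHom N a (Finsupp.mapRange.addMonoidHom φ w) =
      Finsupp.mapRange.addMonoidHom φ (consHom M a w) := by
  suffices (consHom N a).comp (Finsupp.mapRange.addMonoidHom φ) =
    (Finsupp.mapRange.addMonoidHom φ).comp (consHom M a) from DFunLike.congr_fun this w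
  ext l m : 2
  simp

/-- The differential never looks at coefficients, so it commutes with any additive change of
coefficients. This is used for module maps, for homogeneous projections and for scalars. -/
theorem bar_mapRange {N : Type*} [AddCommGroup N] (φ : M →+ N) (w : List Q →₀ M) :
    β.bar N (Finsupp.mapRange.addMonoidHom φ w) = Finsupp.mapRange.addMonoidHom φ (β.bar M w) := by
  suffices (β.bar N).comp (Finsupp.mapRange.addMonoidHom φ) =
      (Finsupp.mapRange.addMonoidHom φ).comp (β.bar M) from DFunLike.congr_fun this w
  ext l m : 2
  simp only [AddMonoidHom.comp_apply, Finsupp.singleAddHom_apply]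
  induction l with
  | nil => simp
  | cons a l ih =>
    rw [← consHom_single, ← consHom_mapRange, bar_consHom, bar_consHom, ih, map_sub,
      merge_mapRange, consHom_mapRange]

/-- The sum of the lengths of the members of a list. -/
def wt (l : List Q) : ℕ := (l.map β.len).sum

@[simp] theorem wt_nil : β.wt [] = 0 := rfl
@[simp] theorem wt_cons (a : Q) (l : List Q) : β.wt (a :: l) = β.len a + β.wt l := by simp [wt]

/-- Composable lists of paths of positive length. -/
def Valid (l : List Q) : Prop :=
  l.IsChain (fun a b => β.tgt a = β.src b) ∧ ∀ a ∈ l, β.len a ≠ 0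

theorem valid_nil : β.Valid [] := ⟨List.isChain_nil, by simp⟩

theorem valid_cons {a : Q} {l : List Q} : β.Valid (a :: l) ↔
    β.len a ≠ 0 ∧ (∀ b ∈ l.head?, β.tgt a = β.src b) ∧ β.Valid l := by
  simp only [Valid, List.isChain_cons, List.mem_cons, forall_eq_or_imp]
  tauto

/-- The source of the head is recorded because it is needed twice: to keep the list composable after
a further entry is put in front, and to keep the coefficient attached to the right vertex. -/
theorem bar_single_mem {l : List Q} (hl : β.Valid l) {S : AddSubgroup M} {m : M} (hm : m ∈ S) :
    β.bar M (Finsupp.single l m) ∈ Finsupp.constrained fun l' => S.cell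
      (β.Valid l' ∧ l'.length + 1 = l.length ∧ β.wt l' = β.wt l ∧
        l'.head?.map β.src = l.head?.map β.src) := by
  induction l with
  | nil => rw [bar_nil]; exact zero_mem _
  | cons a l ih =>
    obtain ⟨h1, h2, h3⟩ := β.valid_cons.1 hl
    rw [bar_cons]
    refine sub_mem ?_ ?_
    · cases l with
      | nil => simp
      | cons b l =>
        rw [merge_cons]
        cases h : β.mul a b with
        | none => exact zero_mem _
        | some c =>
          refine Finsupp.single_mem_constrained (Or.inr ⟨?_, hm⟩)
          obtain ⟨e1, e2, e3, e4⟩ := β.mul_some _ _ _ h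
          obtain ⟨h4, h5, h6⟩ := β.valid_cons.1 h3
          refine ⟨β.valid_cons.2 ⟨by omega, ?_, h6⟩, by simp, by simp; omega, by simp [e2]⟩
          intro d hd
          rw [e3]; exact h5 d hd
    · refine Finsupp.map_mem_of_constrained _ _ ?_ (ih h3)
      rintro l' m' (rfl | ⟨⟨g1, g2, g3, g4⟩, hm'⟩)
      · simp
      · rw [consHom_single]
        refine Finsupp.single_mem_constrained (Or.inr ⟨?_, hm'⟩)
        refine ⟨β.valid_cons.2 ⟨h1, ?_, g1⟩, by simp [g2], by simp [g3], by simp⟩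
        intro d hd
        have : l'.head?.map β.src = some (β.src d) := by rw [Option.mem_def.1 hd]; rfl
        rw [g4, Option.map_eq_some_iff] at this
        obtain ⟨b, hb, e⟩ := this
        rw [h2 b hb, e]

end Lists

end PathBasis

end

/-! ### The bar construction with coefficients in a right module -/

section

open MulOpposite
namespace PathBasis

variable {k : Type u} [Field k] {R : Type w} [Ring R] {O Q : Type v} [Fintype O]
  (β : PathBasis k R O Q)

section Modules

variable (M : Type*) [AddCommGroup M] [Module Rᵐᵒᵖ M]

/-- The right action of a basis vector on a right module. -/
def act (a : Q) : M →+ M := DistribSMul.toAddMonoidHom M (op (β.mon a 1))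

variable {M}

theorem act_apply (a : Q) (m : M) : β.act M a m = op (β.mon a 1) • m := rfl

theorem mon_mul_mon (a b : Q) (c c' : k) : β.mon a c * β.mon b c' =
    (β.mul a b).elim 0 fun g => β.mon g (c * c') := β.mon_mul a b c c'

theorem act_act (a b : Q) (m : M) : β.act M b (β.act M a m) =
    (β.mul a b).elim 0 fun c => β.act M c m := by
  simp only [act_apply, smul_smul, ← op_mul, mon_mul_mon]
  cases β.mul a b <;> simp

theorem act_act_one (a : Q) (m : M) : β.act M (β.one (β.tgt a)) (β.act M a m) = β.act M a m := by
  rw [act_act, β.mul_one]; rfl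

theorem sum_act_one (m : M) : ∑ p, β.act M (β.one p) m = m := by
  simp only [act_apply]
  rw [← Finset.sum_smul, ← Finset.op_sum, ← β.one_eq, op_one, one_smul]

variable (M) in
/-- Let the head of a list act on the coefficient. -/
noncomputable def actHead : (List Q →₀ M) →+ (List Q →₀ M) :=
  Finsupp.liftAddHom fun l => match l with
    | [] => 0
    | a :: l => (Finsupp.singleAddHom l).comp (β.act M a)

@[simp] theorem actHead_nil (m : M) : β.actHead M (Finsupp.single [] m) = 0 := by
  simp [actHead]

theorem actHead_cons (a : Q) (l : List Q) (m : M) : β.actHead M (Finsupp.single (a :: l) m) =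
    Finsupp.single l (β.act M a m) := by
  simp [actHead]

theorem actHead_consHom (a : Q) (w : List Q →₀ M) :
    β.actHead M (consHom M a w) = Finsupp.mapRange.addMonoidHom (β.act M a) w := by
  suffices (β.actHead M).comp (consHom M a) = Finsupp.mapRange.addMonoidHom (β.act M a) from
    DFunLike.congr_fun this w
  ext l m : 2
  simp [actHead_cons]

variable (M) in
/-- The differential of the bar construction with coefficients in a right module. -/
noncomputable def bd : (List Q →₀ M) →+ (List Q →₀ M) := β.actHead M - β.bar M

theorem bd_apply (w : List Q →₀ M) : β.bd M w = β.actHead M w - β.bar M w := rfl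

@[simp] theorem bd_nil (m : M) : β.bd M (Finsupp.single [] m) = 0 := by
  simp [bd_apply]

theorem bd_consHom (a : Q) (w : List Q →₀ M) : β.bd M (consHom M a w) =
    Finsupp.mapRange.addMonoidHom (β.act M a) w - (β.merge M a w - consHom M a (β.bar M w)) := by
  rw [bd_apply, actHead_consHom, bar_consHom]

theorem mapRange_act_act (a b : Q) (w : List Q →₀ M) :
    Finsupp.mapRange.addMonoidHom (β.act M b) (Finsupp.mapRange.addMonoidHom (β.act M a) w) =
    (β.mul a b).elim 0 fun c => Finsupp.mapRange.addMonoidHom (β.act M c) w := by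
  ext l
  have := β.act_act a b (w l)
  cases h : β.mul a b <;> simpa [h] using this

/-- Besides `bar_bar`, two cancellations are needed. Letting the first two entries act in turn
agrees with merging them and letting the product act; and letting the head act commutes with merges
further along the list. -/
theorem bd_bd (w : List Q →₀ M) : β.bd M (β.bd M w) = 0 := by
  suffices (β.bd M).comp (β.bd M) = 0 from DFunLike.congr_fun this w
  ext l m : 2
  simp only [AddMonoidHom.comp_apply, Finsupp.singleAddHom_apply, AddMonoidHom.zero_apply]
  cases l with
  | nil => simp
  | cons a l =>
    rw [← consHom_single, bd_consHom]
    cases l with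
    | nil => simp
    | cons b l =>
      rw [← consHom_single]
      generalize Finsupp.single l m = w
      rw [merge_consHom, bar_consHom]
      simp only [← consHom_mapRange, map_sub, bd_consHom]
      rw [mapRange_act_act, merge_consHom, merge_merge, bar_consHom, bar_merge, bar_mapRange,
        merge_mapRange, bar_bar, map_sub]
      cases β.mul a b <;> simp [bd_consHom] <;> abel

theorem act_map {N : Type*} [AddCommGroup N] [Module Rᵐᵒᵖ N] (φ : M →ₗ[Rᵐᵒᵖ] N) (a : Q) (m : M) :
    β.act N a (φ m) = φ (β.act M a m) := (map_smul φ _ m).symm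

/-- The map of bar constructions induced by a linear map. -/
noncomputable abbrev push {M N : Type*} [AddCommGroup M] [Module Rᵐᵒᵖ M] [AddCommGroup N]
    [Module Rᵐᵒᵖ N] (φ : M →ₗ[Rᵐᵒᵖ] N) : (List Q →₀ M) →+ (List Q →₀ N) :=
  Finsupp.mapRange.addMonoidHom φ.toAddMonoidHom

theorem bd_push {N : Type*} [AddCommGroup N] [Module Rᵐᵒᵖ N] (φ : M →ₗ[Rᵐᵒᵖ] N)
    (w : List Q →₀ M) : β.bd N (push φ w) = push φ (β.bd M w) := by
  suffices (β.actHead N).comp (push φ) = (push φ).comp (β.actHead M) by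
    have h := DFunLike.congr_fun this w
    simp only [AddMonoidHom.comp_apply] at h
    rw [bd_apply, bd_apply, h, bar_mapRange, map_sub]
  ext l m : 2
  cases l with
  | nil => simp
  | cons b l => simp [actHead_cons, act_map]

/-- The part of internal degree `p` and homological degree `i` of the bar construction of a graded
module. -/
def chain (ℳ : ℤ → AddSubgroup M) (i : ℕ) (p : ℤ) : AddSubgroup (List Q →₀ M) :=
  Finsupp.constrained fun l => (ℳ (p - β.wt l)).cell
    (β.Valid l ∧ l.length = i) ⊓
      ⨅ (a ∈ l.head?), (β.act M (β.one (β.src a)) - AddMonoidHom.id M).ker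

variable {β} {ℳ : ℤ → AddSubgroup M} {i : ℕ} {p : ℤ}

/-- The condition on the head makes the tensor product of the module with the list one over the span
of the identities. Validity of the list does the same between neighbours. The empty list carries no
such condition. -/
theorem mem_chain {f : List Q →₀ M} : f ∈ β.chain ℳ i p ↔
    ∀ l, (f l = 0 ∨ ((β.Valid l ∧ l.length = i) ∧ f l ∈ ℳ (p - β.wt l))) ∧
      ∀ a ∈ l.head?, β.act M (β.one (β.src a)) (f l) = f l := by
  simp [chain, Finsupp.mem_constrained, AddSubgroup.mem_inf, AddSubgroup.mem_cell,
    AddSubgroup.mem_iInf, AddMonoidHom.mem_ker, sub_eq_zero]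

theorem single_mem_chain {l : List Q} {m : M} (h1 : β.Valid l) (h2 : l.length = i)
    (h3 : m ∈ ℳ (p - β.wt l)) (h4 : ∀ a ∈ l.head?, β.act M (β.one (β.src a)) m = m) :
    Finsupp.single l m ∈ β.chain ℳ i p := by
  refine Finsupp.single_mem_constrained ?_
  simp only [AddSubgroup.mem_inf, AddSubgroup.mem_cell,
    AddSubgroup.mem_iInf, AddMonoidHom.mem_ker, AddMonoidHom.sub_apply, AddMonoidHom.id_apply,
    sub_eq_zero]
  exact ⟨Or.inr ⟨⟨h1, h2⟩, h3⟩, h4⟩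

theorem map_chain_mem {N : Type*} [AddCommGroup N] (T : (List Q →₀ M) →+ N) (K : AddSubgroup N)
    (h : ∀ l m, β.Valid l → l.length = i → m ∈ ℳ (p - β.wt l) →
      (∀ a ∈ l.head?, β.act M (β.one (β.src a)) m = m) → T (Finsupp.single l m) ∈ K)
    {f : List Q →₀ M} (hf : f ∈ β.chain ℳ i p) : T f ∈ K := by
  refine Finsupp.map_mem_of_constrained T K (fun l m hm => ?_) hf
  simp only [AddSubgroup.mem_inf, AddSubgroup.mem_cell,
    AddSubgroup.mem_iInf, AddMonoidHom.mem_ker, AddMonoidHom.sub_apply, AddMonoidHom.id_apply,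
    sub_eq_zero] at hm
  obtain ⟨rfl | ⟨⟨h1, h2⟩, h3⟩, h4⟩ := hm
  · simp
  · exact h l m h1 h2 h3 h4

theorem map_chain_eq {N : Type*} [AddCommGroup N] (T T' : (List Q →₀ M) →+ N)
    (h : ∀ l m, β.Valid l → l.length = i → m ∈ ℳ (p - β.wt l) →
      (∀ a ∈ l.head?, β.act M (β.one (β.src a)) m = m) →
      T (Finsupp.single l m) = T' (Finsupp.single l m))
    {f : List Q →₀ M} (hf : f ∈ β.chain ℳ i p) : T f = T' f := by
  have := map_chain_mem (T - T') ⊥ (fun l m h1 h2 h3 h4 => by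
    rw [AddSubgroup.mem_bot, AddMonoidHom.sub_apply, h l m h1 h2 h3 h4, sub_self]) hf
  rwa [AddSubgroup.mem_bot, AddMonoidHom.sub_apply, sub_eq_zero] at this

/-- A family of subgroups compatible with the degrees of the basis vectors. -/
def Compat (β : PathBasis k R O Q) (ℳ : ℤ → AddSubgroup M) : Prop :=
  ∀ (j : ℤ) (a : Q), ∀ m ∈ ℳ j, β.act M a m ∈ ℳ (j + β.len a)

theorem Compat.act_one (h : β.Compat ℳ) {j : ℤ} {m : M} (hm : m ∈ ℳ j) (p : O) :
    β.act M (β.one p) m ∈ ℳ j := by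
  have := h j (β.one p) m hm
  rwa [β.len_one, Nat.cast_zero, add_zero] at this

theorem bd_mem_chain (h : β.Compat ℳ) {f : List Q →₀ M} (hf : f ∈ β.chain ℳ (i + 1) p) :
    β.bd M f ∈ β.chain ℳ i p := by
  refine map_chain_mem (β.bd M) _ (fun l m h1 h2 h3 h4 => ?_) hf
  rw [bd_apply]
  refine sub_mem ?_ ?_
  · cases l with
    | nil => simp at h2
    | cons a l =>
      obtain ⟨g1, g2, g3⟩ := β.valid_cons.1 h1
      rw [actHead_cons]
      refine single_mem_chain g3 (by simpa using h2) ?_ ?_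
      · have := h _ a m h3
        convert this using 2
        simp
        ring
      · intro b hb
        rw [← g2 b hb, act_act_one]
  -- Both the degree and the vertex of the coefficient are put into one subgroup, which
  -- `bar_single_mem` then transports.
  · set S : AddSubgroup M := ℳ (p - β.wt l) ⊓
      ⨅ (a ∈ l.head?), (β.act M (β.one (β.src a)) - AddMonoidHom.id M).ker with hS
    have hm : m ∈ S := by
      simp only [hS, AddSubgroup.mem_inf, AddSubgroup.mem_iInf, AddMonoidHom.mem_ker,
        AddMonoidHom.sub_apply, AddMonoidHom.id_apply, sub_eq_zero]
      exact ⟨h3, h4⟩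
    have := β.bar_single_mem h1 hm
    rw [mem_chain]
    intro l'
    obtain h0 | ⟨⟨g1, g2, g3, g4⟩, hm'⟩ := this l'
    · simp [h0]
    · simp only [hS, AddSubgroup.mem_inf, AddSubgroup.mem_iInf, AddMonoidHom.mem_ker,
        AddMonoidHom.sub_apply, AddMonoidHom.id_apply, sub_eq_zero] at hm'
      refine ⟨Or.inr ⟨⟨g1, by omega⟩, by rw [g3]; exact hm'.1⟩, ?_⟩
      intro a ha
      have : l.head?.map β.src = some (β.src a) := by rw [← g4, Option.mem_def.1 ha]; rfl
      rw [Option.map_eq_some_iff] at this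
      obtain ⟨b, hb, e⟩ := this
      rw [← e]
      exact hm'.2 b hb

/-- The bar construction of `M` is exact at homological degree `i` and internal degree `p`. -/
def ExactAt (β : PathBasis k R O Q) (ℳ : ℤ → AddSubgroup M) (i : ℕ) (p : ℤ) : Prop :=
  ∀ z ∈ β.chain ℳ i p, β.bd M z = 0 → ∃ w ∈ β.chain ℳ (i + 1) p, β.bd M w = z

theorem push_mem_chain {N : Type*} [AddCommGroup N] [Module Rᵐᵒᵖ N] {𝒩 : ℤ → AddSubgroup N}
    (φ : M →ₗ[Rᵐᵒᵖ] N) (hφ : ∀ j, ∀ m ∈ ℳ j, φ m ∈ 𝒩 j) {f : List Q →₀ M}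
    (hf : f ∈ β.chain ℳ i p) : push φ f ∈ β.chain 𝒩 i p := by
  refine map_chain_mem _ _ (fun l m h1 h2 h3 h4 => ?_) hf
  simp only [Finsupp.mapRange.addMonoidHom_apply, Finsupp.mapRange_single]
  refine single_mem_chain h1 h2 (hφ _ _ h3) fun a ha => ?_
  refine (β.act_map φ _ _).trans ?_
  rw [h4 a ha]; rfl

/-- An arbitrary lift of a coefficient need not sit at the vertex of the head. The identity at that
vertex moves it there without changing its degree or its image. Together with `exists_lift_ker` this
makes the bar construction exact in the module. -/
theorem exists_lift {N : Type*} [AddCommGroup N] [Module Rᵐᵒᵖ N] {𝒩 : ℤ → AddSubgroup N}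
    (φ : M →ₗ[Rᵐᵒᵖ] N) (hM : β.Compat ℳ) (hφ : ∀ j, ∀ n ∈ 𝒩 j, ∃ m ∈ ℳ j, φ m = n)
    {g : List Q →₀ N} (hg : g ∈ β.chain 𝒩 i p) : ∃ f ∈ β.chain ℳ i p, push φ f = g := by
  suffices h : g ∈ (β.chain ℳ i p).map (push φ) from h
  refine map_chain_mem (AddMonoidHom.id _) _ (fun l n h1 h2 h3 h4 => ?_) hg
  obtain ⟨m, hm, rfl⟩ := hφ _ n h3
  cases l with
  | nil => exact ⟨Finsupp.single [] m, single_mem_chain h1 h2 hm (by simp), by simp⟩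
  | cons a l =>
    refine ⟨Finsupp.single (a :: l) (β.act M (β.one (β.src a)) m), single_mem_chain h1 h2
      (hM.act_one hm _) ?_, ?_⟩
    · intro b hb
      obtain rfl : a = b := by simpa using hb
      have := β.act_act_one (β.one (β.src a)) m
      rwa [β.tgt_one] at this
    · have := h4 a (by simp)
      simp [← act_map, this]

theorem exists_lift_ker {N : Type*} [AddCommGroup N] [Module Rᵐᵒᵖ N] (φ : M →ₗ[Rᵐᵒᵖ] N)
    {f : List Q →₀ M} (hf : f ∈ β.chain ℳ i p) (h : push φ f = 0) :
    ∃ g ∈ β.chain (fun j => (ℳ j).comap (LinearMap.ker φ).subtype.toAddMonoidHom) i p,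
      push (LinearMap.ker φ).subtype g = f := by
  have hk : ∀ l, f l ∈ LinearMap.ker φ := fun l => by
    simpa using DFunLike.congr_fun h l
  let g : List Q →₀ LinearMap.ker φ :=
    Finsupp.onFinset f.support (fun l => ⟨f l, hk l⟩) (fun l hl => by
      rw [Finsupp.mem_support_iff]; intro h0; exact hl (Subtype.ext h0))
  refine ⟨g, mem_chain.2 fun l => ?_, by ext l; rfl⟩
  have := mem_chain.1 hf l
  refine ⟨this.1.imp (fun h0 => Subtype.ext h0) id, fun a ha => Subtype.ext (this.2 a ha)⟩

theorem push_injective {N : Type*} [AddCommGroup N] [Module Rᵐᵒᵖ N] (φ : M →ₗ[Rᵐᵒᵖ] N)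
    (h : Function.Injective φ) : Function.Injective (push φ : (List Q →₀ M) →+ _) :=
  Finsupp.mapRange_injective _ (map_zero _) h

end Modules

end PathBasis

end

/-! ### Homogeneous projections; acyclicity for free and projective modules -/

section

open MulOpposite

section Gradings

variable {M N : Type*} [AddCommGroup M] [AddCommGroup N] {ℳ : ℤ → AddSubgroup M}
  {𝒩 : ℤ → AddSubgroup N}

/-- The projection onto a homogeneous component. -/
noncomputable def grProj (h : DirectSum.IsInternal ℳ) (j : ℤ) : M →+ M :=
  ((ℳ j).subtype.comp (DFinsupp.evalAddMonoidHom j)).comp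
    (AddEquiv.ofBijective (DirectSum.coeAddMonoidHom ℳ) h).symm.toAddMonoidHom

theorem grProj_mem (h : DirectSum.IsInternal ℳ) (j : ℤ) (m : M) : grProj h j m ∈ ℳ j :=
  Subtype.property _

theorem grProj_coe (h : DirectSum.IsInternal ℳ) (j : ℤ) (x : DirectSum ℤ fun j => ℳ j) :
    grProj h j (DirectSum.coeAddMonoidHom ℳ x) = x j := by
  change ((AddEquiv.ofBijective (DirectSum.coeAddMonoidHom ℳ) h).symm
    (AddEquiv.ofBijective (DirectSum.coeAddMonoidHom ℳ) h x) j : M) = x j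
  rw [AddEquiv.symm_apply_apply]

theorem grProj_same (h : DirectSum.IsInternal ℳ) {j : ℤ} {m : M} (hm : m ∈ ℳ j) :
    grProj h j m = m := by
  have := grProj_coe h j (DirectSum.of (fun j => ℳ j) j ⟨m, hm⟩)
  rwa [DirectSum.coeAddMonoidHom_of, DirectSum.of_eq_same] at this

theorem grProj_ne (h : DirectSum.IsInternal ℳ) {i j : ℤ} (hij : i ≠ j) {m : M} (hm : m ∈ ℳ i) :
    grProj h j m = 0 := by
  have := grProj_coe h j (DirectSum.of (fun j => ℳ j) i ⟨m, hm⟩)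
  rwa [DirectSum.coeAddMonoidHom_of, DirectSum.of_eq_of_ne _ _ _ hij.symm] at this

theorem exists_sum_grProj (h : DirectSum.IsInternal ℳ) (m : M) :
    ∃ s : Finset ℤ, m = ∑ j ∈ s, grProj h j m := by
  classical
  obtain ⟨x, rfl⟩ := h.2 m
  refine ⟨DFinsupp.support x, ?_⟩
  simp only [grProj_coe]
  exact DirectSum.coeAddMonoidHom_eq_dfinsuppSum _ x

theorem graded_hom_ext (h : DirectSum.IsInternal ℳ) {f g : M →+ N}
    (hfg : ∀ j, ∀ m ∈ ℳ j, f m = g m) (m : M) : f m = g m := by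
  obtain ⟨s, hs⟩ := exists_sum_grProj h m
  rw [hs, map_sum, map_sum]
  exact Finset.sum_congr rfl fun j _ => hfg j _ (grProj_mem h j m)

theorem isInternal_of_proj (pr : ℤ → M →+ M)
    (same : ∀ j, ∀ m ∈ ℳ j, pr j m = m) (ne : ∀ i j, i ≠ j → ∀ m ∈ ℳ i, pr j m = 0)
    (gen : ∀ K : AddSubgroup M, (∀ j, ℳ j ≤ K) → K = ⊤) : DirectSum.IsInternal ℳ := by
  classical
  constructor
  · rw [injective_iff_map_eq_zero]
    intro x hx
    have key : ∀ (x : DirectSum ℤ fun j => ℳ j) j, pr j (DirectSum.coeAddMonoidHom ℳ x) = x j := by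
      intro x j
      induction x using DirectSum.induction_on with
      | zero => simp
      | of i y =>
        rw [DirectSum.coeAddMonoidHom_of]
        by_cases hij : i = j
        · subst hij
          rw [DirectSum.of_eq_same, same i _ y.2]
        · rw [DirectSum.of_eq_of_ne _ _ _ (Ne.symm hij), ne i j hij _ y.2]; rfl
      | add x y hx hy => rw [map_add, map_add, hx, hy]; rfl
    refine DFinsupp.ext fun j => Subtype.ext ?_
    rw [← key, hx, map_zero]; rfl
  · rw [← AddMonoidHom.range_eq_top]
    refine gen _ fun j m hm => ⟨DirectSum.of (fun j => ℳ j) j ⟨m, hm⟩, ?_⟩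
    exact DirectSum.coeAddMonoidHom_of _ _ _

theorem map_grProj (h : DirectSum.IsInternal ℳ) (h' : DirectSum.IsInternal 𝒩) (φ : M →+ N)
    (hφ : ∀ j, ∀ m ∈ ℳ j, φ m ∈ 𝒩 j) (j : ℤ) (m : M) : φ (grProj h j m) = grProj h' j (φ m) := by
  refine graded_hom_ext h (f := φ.comp (grProj h j)) (g := (grProj h' j).comp φ) (fun i m hm => ?_) m
  simp only [AddMonoidHom.comp_apply]
  by_cases hij : i = j
  · subst hij; rw [grProj_same h hm, grProj_same h' (hφ _ _ hm)]
  · rw [grProj_ne h hij hm, grProj_ne h' hij (hφ _ _ hm), map_zero]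

/-- A degree-preserving map commutes with the homogeneous projections, so its kernel contains the
components of each of its elements. -/
theorem isInternal_comap_ker (h : DirectSum.IsInternal ℳ) (h' : DirectSum.IsInternal 𝒩)
    {S : Type*} [Ring S] [Module S M] [Module S N] (φ : M →ₗ[S] N)
    (hφ : ∀ j, ∀ m ∈ ℳ j, φ m ∈ 𝒩 j) :
    DirectSum.IsInternal fun j => (ℳ j).comap (LinearMap.ker φ).subtype.toAddMonoidHom := by
  refine isInternal_of_proj
    (fun j => ((grProj h j).comp (LinearMap.ker φ).subtype.toAddMonoidHom).codRestrict
      (LinearMap.ker φ).toAddSubgroup fun m => ?_)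
    (fun j m hm => Subtype.ext (grProj_same h hm))
    (fun i j hij m hm => Subtype.ext (grProj_ne h hij hm)) fun K hK => ?_
  · change φ (grProj h j m) = 0
    exact (map_grProj h h' φ.toAddMonoidHom hφ j m).trans
      ((congrArg _ (LinearMap.mem_ker.1 m.2)).trans (map_zero _))
  · rw [eq_top_iff]
    intro m _
    obtain ⟨s, hs⟩ := exists_sum_grProj h (m : M)
    have hk : ∀ j, grProj h j m ∈ LinearMap.ker φ := fun j =>
      (map_grProj h h' φ.toAddMonoidHom hφ j m).trans
        ((congrArg _ (LinearMap.mem_ker.1 m.2)).trans (map_zero _))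
    have : m = ∑ j ∈ s, (⟨grProj h j m, hk j⟩ : LinearMap.ker φ) := by
      refine Subtype.ext ?_
      rw [AddSubmonoidClass.coe_finsetSum]
      exact hs
    rw [this]
    exact sum_mem fun j _ => hK j (grProj_mem h j _)

end Gradings

namespace PathBasis

variable {k : Type u} [Field k] {R : Type w} [Ring R] {O Q : Type v} [Fintype O]
  {β : PathBasis k R O Q} {M : Type*} [AddCommGroup M] [Module Rᵐᵒᵖ M] {ℳ : ℤ → AddSubgroup M}

theorem grProj_act (h : DirectSum.IsInternal ℳ) (hM : β.Compat ℳ) (j : ℤ) (a : Q) (m : M) :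
    grProj h (j + β.len a) (β.act M a m) = β.act M a (grProj h j m) := by
  refine graded_hom_ext h (f := (grProj h (j + β.len a)).comp (β.act M a))
    (g := (β.act M a).comp (grProj h j)) (fun i m hm => ?_) m
  simp only [AddMonoidHom.comp_apply]
  by_cases hij : i = j
  · subst hij; rw [grProj_same h hm, grProj_same h (hM _ _ _ hm)]
  · rw [grProj_ne h hij hm, grProj_ne h (by omega) (hM _ a _ hm), map_zero]

variable (β) in
/-- The projection of the bar construction onto a homogeneous component. -/
noncomputable def chainProj (h : DirectSum.IsInternal ℳ) (p : ℤ) : (List Q →₀ M) →+ (List Q →₀ M) :=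
  Finsupp.liftAddHom fun l => (Finsupp.singleAddHom l).comp (grProj h (p - β.wt l))

theorem chainProj_single (h : DirectSum.IsInternal ℳ) (p : ℤ) (l : List Q) (m : M) :
    β.chainProj h p (Finsupp.single l m) = Finsupp.single l (grProj h (p - β.wt l) m) := by
  simp [chainProj]

theorem chainProj_mem (h : DirectSum.IsInternal ℳ) (hM : β.Compat ℳ) {i : ℕ} {p q : ℤ}
    {f : List Q →₀ M} (hf : f ∈ β.chain (fun _ => ⊤) i q) :
    β.chainProj h p f ∈ β.chain ℳ i p := by
  refine map_chain_mem _ _ (fun l m h1 h2 _ h4 => ?_) hf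
  rw [chainProj_single]
  refine single_mem_chain h1 h2 (grProj_mem _ _ _) fun a ha => ?_
  have := grProj_act h hM (p - β.wt l) (β.one (β.src a)) m
  rw [β.len_one, Nat.cast_zero, add_zero, h4 a ha] at this
  exact this.symm

theorem chainProj_same (h : DirectSum.IsInternal ℳ) {i : ℕ} {p : ℤ}
    {f : List Q →₀ M} (hf : f ∈ β.chain ℳ i p) : β.chainProj h p f = f :=
  map_chain_eq _ (AddMonoidHom.id _) (fun l m _ _ h3 _ => by
    rw [chainProj_single, grProj_same h h3]; rfl) hf

theorem chainProj_bd (h : DirectSum.IsInternal ℳ) (hM : β.Compat ℳ) {i : ℕ} (p : ℤ) {q : ℤ}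
    {f : List Q →₀ M} (hf : f ∈ β.chain (fun _ => ⊤) i q) :
    β.chainProj h p (β.bd M f) = β.bd M (β.chainProj h p f) := by
  refine map_chain_eq ((β.chainProj h p).comp (β.bd M)) ((β.bd M).comp (β.chainProj h p))
    (fun l m h1 _ _ _ => ?_) hf
  simp only [AddMonoidHom.comp_apply, chainProj_single, bd_apply, map_sub]
  congr 1
  · cases l with
    | nil => simp
    | cons a l =>
      rw [actHead_cons, actHead_cons, chainProj_single, ← grProj_act h hM]
      congr 3
      simp; ring
  · have := β.bar_mapRange (grProj h (p - β.wt l)) (Finsupp.single l m)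
    rw [Finsupp.mapRange.addMonoidHom_apply, Finsupp.mapRange_single] at this
    rw [this]
    refine Finsupp.map_eq_of_constrained _ _ ?_ (β.bar_single_mem h1 (AddSubgroup.mem_top m))
    rintro l' m' (rfl | ⟨⟨-, -, e, -⟩, -⟩)
    · simp
    · rw [chainProj_single, e]; simp

/-- Exactness of the whole bar construction at positive degrees gives exactness of its homogeneous
parts. -/
theorem exactAt_of_top (h : DirectSum.IsInternal ℳ) (hM : β.Compat ℳ) {i : ℕ} {p : ℤ}
    (he : β.ExactAt (fun _ => (⊤ : AddSubgroup M)) i p) : β.ExactAt ℳ i p := by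
  intro z hz hbz
  have hle : β.chain ℳ i p ≤ β.chain (fun _ => (⊤ : AddSubgroup M)) i p := by
    intro f hf
    rw [mem_chain] at hf ⊢
    intro l
    exact ⟨(hf l).1.imp id fun h => ⟨h.1, trivial⟩, (hf l).2⟩
  obtain ⟨w, hw, rfl⟩ := he z (hle hz) hbz
  refine ⟨_, chainProj_mem h hM hw, ?_⟩
  rw [← chainProj_bd h hM p hw, chainProj_same h hz]

end PathBasis

/-- The free right `R`-module on `X`. -/
def FreeMod (X : Type*) (R : Type*) [Ring R] := X →₀ R

namespace FreeMod

variable {X R : Type*} [Ring R]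

noncomputable instance : AddCommGroup (FreeMod X R) := inferInstanceAs (AddCommGroup (X →₀ R))

noncomputable instance : Module Rᵐᵒᵖ (FreeMod X R) := inferInstanceAs (Module Rᵐᵒᵖ (X →₀ R))

/-- The multiples of a basis vector. -/
noncomputable def single (x : X) : R →+ FreeMod X R := Finsupp.singleAddHom x

/-- Additive maps out of a free module. -/
noncomputable def lift {N : Type*} [AddCommGroup N] (φ : X → R →+ N) : FreeMod X R →+ N :=
  Finsupp.liftAddHom φ

theorem lift_single {N : Type*} [AddCommGroup N] (φ : X → R →+ N) (x : X) (r : R) :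
    lift φ (single x r) = φ x r := by
  unfold lift single
  erw [Finsupp.liftAddHom_apply_single]

theorem smul_single (x : X) (r s : R) : op s • single x r = single x (r * s) :=
  Finsupp.smul_single (op s) x r

theorem induction {p : FreeMod X R → Prop} (f : FreeMod X R) (zero : p 0)
    (add : ∀ f g, p f → p g → p (f + g)) (single : ∀ x r, p (single x r)) : p f :=
  Finsupp.induction_linear f zero add single

variable (R) in
/-- The linear map to a right module with given values on the basis. -/
noncomputable def cover {M : Type*} [AddCommGroup M] [Module Rᵐᵒᵖ M] (b : X → M) :
    FreeMod X R →ₗ[Rᵐᵒᵖ] M where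
  __ := lift fun x => AddMonoidHom.mk' (fun r : R => op r • b x) fun r s => by
    rw [op_add, add_smul]
  map_smul' r f := by
    change lift _ (r • f) = r • lift _ f
    induction f using FreeMod.induction with
    | zero => simp
    | add f g hf hg => rw [smul_add, map_add, map_add, hf, hg, smul_add]
    | single x s =>
      rw [← op_unop r, smul_single, lift_single, lift_single]
      change op (s * r.unop) • b x = op r.unop • op s • b x
      rw [op_mul, mul_smul]

theorem cover_single {M : Type*} [AddCommGroup M] [Module Rᵐᵒᵖ M] (b : X → M) (x : X) (r : R) :
    cover R b (single x r) = op r • b x := lift_single _ _ _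

end FreeMod

namespace PathBasis

variable {k : Type u} [Field k] {R : Type w} [Ring R] {O Q : Type v} [Fintype O]
  {β : PathBasis k R O Q} {M : Type*} [AddCommGroup M] [Module Rᵐᵒᵖ M] {ℳ : ℤ → AddSubgroup M}

/-- A multiple of a path times a basis vector of a free module. -/
noncomputable def freeMon (β : PathBasis k R O Q) {X : Type*} (x : X) (a : Q) : k →+ FreeMod X R :=
  (FreeMod.single x).comp (β.mon a)

theorem mem_of_mon {N : Type*} [AddCommGroup N] {X : Type*} (T : FreeMod X R →+ N)
    (K : AddSubgroup N) (h : ∀ x a c, T (β.freeMon x a c) ∈ K) (f : FreeMod X R) : T f ∈ K := by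
  induction f using FreeMod.induction with
  | zero => simp
  | add f g hf hg => rw [map_add]; exact add_mem hf hg
  | single x r =>
    rw [← β.sum_coef r, Finsupp.liftAddHom_apply, Finsupp.sum,
      map_sum, map_sum]
    exact sum_mem fun a _ => h x a _

theorem act_mon {X : Type*} (x : X) (a b : Q) (c : k) :
    β.act (FreeMod X R) b (β.freeMon x a c) = (β.mul a b).elim 0 fun g => β.freeMon x g c := by
  rw [act_apply, freeMon, AddMonoidHom.comp_apply, FreeMod.smul_single, β.mon_mul]
  cases β.mul a b <;> simp [freeMon]

section Free

variable (β) (X : Type*)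

open Classical in
/-- The contracting homotopy of the bar construction of a free module. -/
noncomputable def freeHomotopy : (List Q →₀ FreeMod X R) →+ (List Q →₀ FreeMod X R) :=
  Finsupp.liftAddHom fun l => FreeMod.lift fun x =>
    (Finsupp.liftAddHom fun a => if β.len a = 0 then 0 else
      (Finsupp.singleAddHom (a :: l)).comp (β.freeMon x (β.one (β.src a)))).comp β.coef

variable {X}

-- The homotopy moves the path from the coefficient to the front of the list and leaves an identity
-- behind. Identities are sent to zero, since valid lists contain no identities.
open Classical in
theorem freeHomotopy_single (l : List Q) (x : X) (a : Q) (c : k) :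
    β.freeHomotopy X (Finsupp.single l (β.freeMon x a c)) =
      if β.len a = 0 then 0 else Finsupp.single (a :: l) (β.freeMon x (β.one (β.src a)) c) := by
  rw [freeHomotopy, Finsupp.liftAddHom_apply_single, freeMon, AddMonoidHom.comp_apply,
    FreeMod.lift_single, AddMonoidHom.comp_apply, β.coef_mon, Finsupp.liftAddHom_apply_single]
  split_ifs <;> simp

open Classical in
theorem freeHomotopy_mapRange (x : X) (a : Q) (w : List Q →₀ k) :
    β.freeHomotopy X (Finsupp.mapRange.addMonoidHom (β.freeMon x a) w) =
      if β.len a = 0 then 0 else consHom _ a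
        (Finsupp.mapRange.addMonoidHom (β.freeMon x (β.one (β.src a))) w) := by
  induction w using Finsupp.induction_linear with
  | zero => simp
  | add f g hf hg => rw [map_add, map_add, hf, hg, map_add, map_add]; split_ifs <;> simp
  | single l c =>
    simp only [Finsupp.mapRange.addMonoidHom_apply, Finsupp.mapRange_single, freeHomotopy_single]
    split_ifs <;> simp

/-- If a is an identity, the first term vanishes and the action of the head followed by the homotopy
restores the list. Otherwise the action of the new head a restores it, and all other terms cancel in
pairs. The argument needs a head b, so nothing is claimed in homological degree zero. -/
theorem freeHomotopy_spec {b : Q} {l : List Q} (hb : β.len b ≠ 0) (x : X) (a : Q) (c : k)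
    (hab : β.tgt a = β.src b) :
    β.bd _ (β.freeHomotopy X (Finsupp.single (b :: l) (β.freeMon x a c))) +
      β.freeHomotopy X (β.bd _ (Finsupp.single (b :: l) (β.freeMon x a c))) =
      Finsupp.single (b :: l) (β.freeMon x a c) := by
  have hz : (Finsupp.single (b :: l) (β.freeMon x a c) : List Q →₀ FreeMod X R) =
      Finsupp.mapRange.addMonoidHom (β.freeMon x a)
        (Finsupp.single (b :: l) c) := by simp
  have hbar := β.bar_mapRange (β.freeMon x a) (Finsupp.single (b :: l) c)
  rw [← hz] at hbar
  rw [bd_apply (β := β) (w := Finsupp.single (b :: l) _), actHead_cons, act_mon, hbar, map_sub,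
    freeHomotopy_mapRange, freeHomotopy_single]
  by_cases ha : β.len a = 0
  · have e : a = β.one (β.src b) := by
      have := β.eq_one a ha
      rw [this, β.tgt_one] at hab
      rw [this, hab]
    rw [if_pos ha, if_pos ha, map_zero, e, β.one_mul]
    simp only [Option.elim_some, freeHomotopy_single]
    rw [if_neg hb]
    simp
  · rw [if_neg ha, if_neg ha, ← consHom_single, bd_consHom, merge_cons]
    simp only [Finsupp.mapRange.addMonoidHom_apply, Finsupp.mapRange_single, act_mon, β.one_mul]
    have h2 := β.bar_mapRange (β.freeMon x (β.one (β.src a)))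
      (Finsupp.single (b :: l) c)
    simp only [Finsupp.mapRange.addMonoidHom_apply, Finsupp.mapRange_single] at h2
    rw [← h2]
    cases h : β.mul a b with
    | none => simp
    | some g =>
      obtain ⟨-, e2, -, e4⟩ := β.mul_some _ _ _ h
      simp only [Option.elim_some, freeHomotopy_single]
      rw [if_neg (by omega), e2]
      simp

theorem free_exactAt (i : ℕ) (p : ℤ) :
    β.ExactAt (fun _ => (⊤ : AddSubgroup (FreeMod X R))) (i + 1) p := by
  -- A coefficient attached to the source of b equals its own product with the identity there.
  -- Expanding it before multiplying leaves only multiples of paths that end at the source of b.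
  have hred : ∀ (l : List Q) (b : Q)
      (T : (List Q →₀ FreeMod X R) →+ (List Q →₀ FreeMod X R))
      (K : AddSubgroup (List Q →₀ FreeMod X R)),
      (∀ x a c, β.tgt a = β.src b → T (Finsupp.single (b :: l) (β.freeMon x a c)) ∈ K) →
      ∀ m, β.act (FreeMod X R) (β.one (β.src b)) m = m → T (Finsupp.single (b :: l) m) ∈ K := by
    intro l b T K hT m hm
    rw [← hm]
    refine mem_of_mon (β := β) ((T.comp (Finsupp.singleAddHom (b :: l))).comp
      (β.act (FreeMod X R) (β.one (β.src b)))) K (fun x a c => ?_) m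
    simp only [AddMonoidHom.comp_apply, act_mon]
    cases h : β.mul a (β.one (β.src b)) with
    | none => simp
    | some g =>
      obtain ⟨e1, e2, e3, e4⟩ := β.mul_some _ _ _ h
      exact hT _ _ _ (by rw [e3, β.tgt_one])
  intro z hz hbz
  refine ⟨β.freeHomotopy X z, ?_, ?_⟩
  · refine map_chain_mem _ _ (fun l m h1 h2 _ h4 => ?_) hz
    cases l with
    | nil => simp at h2
    | cons b l =>
      refine hred l b (β.freeHomotopy X) _ (fun x a c hab => ?_) m (h4 b (by simp))
      rw [freeHomotopy_single]
      split_ifs with ha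
      · exact zero_mem _
      · refine single_mem_chain (β.valid_cons.2 ⟨ha, by simpa using hab, h1⟩) (by simp [← h2])
          trivial ?_
        intro a' ha'
        obtain rfl : a = a' := by simpa using ha'
        have := β.one_mul (β.one (β.src a))
        rw [β.src_one] at this
        rw [act_mon, this]; rfl
  · have : (((β.bd _).comp (β.freeHomotopy X)) + ((β.freeHomotopy X).comp (β.bd _)) -
        AddMonoidHom.id (List Q →₀ FreeMod X R) : (List Q →₀ FreeMod X R) →+ _) z ∈
          (⊥ : AddSubgroup (List Q →₀ FreeMod X R)) := by
      refine map_chain_mem _ _ (fun l m h1 h2 _ h4 => ?_) hz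
      cases l with
      | nil => simp at h2
      | cons b l =>
        refine hred l b _ _ (fun x a c hab => ?_) m (h4 b (by simp))
        simp only [AddSubgroup.mem_bot, AddMonoidHom.sub_apply, AddMonoidHom.add_apply,
          AddMonoidHom.comp_apply, AddMonoidHom.id_apply]
        rw [freeHomotopy_spec β (β.valid_cons.1 h1).1 x a c hab, sub_self]
    simpa [hbz, sub_eq_zero] using this

end Free

/-- A projective module is a retract of a free one, and the bar construction is functorial. -/
theorem projective_exactAt [Module.Projective Rᵐᵒᵖ M] (i : ℕ) (p : ℤ) :
    β.ExactAt (fun _ => (⊤ : AddSubgroup M)) (i + 1) p := by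
  obtain ⟨σ, hσ⟩ := Module.projective_lifting_property (FreeMod.cover R (id : M → M)) LinearMap.id
    (fun m => ⟨FreeMod.single m 1, by rw [FreeMod.cover_single]; simp⟩)
  have hσ' : ∀ w : List Q →₀ M, push (FreeMod.cover R (id : M → M)) (push σ w) = w := by
    intro w
    ext l
    exact LinearMap.congr_fun hσ (w l)
  intro z hz hbz
  obtain ⟨w, hw, e⟩ := free_exactAt β (X := M) i p (push σ z)
    (push_mem_chain (𝒩 := fun _ => ⊤) σ (fun _ _ _ => trivial) hz) (by rw [bd_push, hbz, map_zero])
  refine ⟨push (FreeMod.cover R id) w, push_mem_chain (𝒩 := fun _ => ⊤) _ (fun _ _ _ => trivial) hw, ?_⟩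
  rw [bd_push, e, hσ']

theorem projective_graded_exactAt [Module.Projective Rᵐᵒᵖ M] (h : DirectSum.IsInternal ℳ)
    (hM : β.Compat ℳ) (i : ℕ) (p : ℤ) : β.ExactAt ℳ (i + 1) p :=
  exactAt_of_top h hM (projective_exactAt i p)

end PathBasis

end

/-! ### From a linear resolution to exactness of the bar construction -/

section

open MulOpposite

namespace PathBasis

variable {k : Type u} [Field k] {R : Type w} [Ring R] {O Q : Type v} [Fintype O]
  {β : PathBasis k R O Q} {M : Type*} [AddCommGroup M] [Module Rᵐᵒᵖ M] {ℳ : ℤ → AddSubgroup M}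

variable (β) in
/-- The combinations of the basis vectors of a given length. -/
def deg (d : ℕ) : AddSubgroup R where
  carrier := {r | ∀ a, β.coef r a ≠ 0 → β.len a = d}
  zero_mem' := by simp
  add_mem' := by
    intro r s hr hs a ha
    by_cases h : β.coef r a = 0
    · refine hs a fun h' => ha ?_
      rw [map_add, Finsupp.add_apply, h, h', add_zero]
    · exact hr a h
  neg_mem' := by
    intro r hr a ha
    exact hr a fun h => ha (by rw [map_neg, Finsupp.neg_apply, h, neg_zero])

theorem mon_mem_deg (a : Q) (c : k) : β.mon a c ∈ β.deg (β.len a) := by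
  classical
  intro b hb
  rw [β.coef_mon, Finsupp.single_apply] at hb
  split_ifs at hb with h
  · rw [h]
  · exact absurd rfl hb

theorem map_deg_mem {N : Type*} [AddCommGroup N] (T : R →+ N) (K : AddSubgroup N) {d : ℕ}
    (h : ∀ a c, β.len a = d → T (β.mon a c) ∈ K) {r : R} (hr : r ∈ β.deg d) : T r ∈ K := by
  rw [← β.sum_coef r, Finsupp.liftAddHom_apply, Finsupp.sum, map_sum]
  exact sum_mem fun a ha => h a _ (hr a (Finsupp.mem_support_iff.1 ha))

theorem map_mem_of_mon {N : Type*} [AddCommGroup N] (β : PathBasis k R O Q) (T : R →+ N)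
    (K : AddSubgroup N) (h : ∀ a c, T (β.mon a c) ∈ K) (r : R) : T r ∈ K := by
  rw [← β.sum_coef r, Finsupp.liftAddHom_apply, Finsupp.sum, map_sum]
  exact sum_mem fun a _ => h a _

theorem compat_of_graded (h : IsGradedRightModule β.deg ℳ) : β.Compat ℳ :=
  fun j a m hm => h.smul_mem j _ m hm _ (mon_mem_deg a 1)

theorem chain_zero {p : ℤ} {z : List Q →₀ M} (hz : z ∈ β.chain ℳ 0 p) :
    ∃ m ∈ ℳ p, z = Finsupp.single [] m := by
  refine ⟨z [], ?_, ?_⟩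
  · obtain h | ⟨-, h⟩ := (mem_chain.1 hz []).1
    · rw [h]; exact zero_mem _
    · simpa using h
  · ext l
    cases l with
    | nil => simp
    | cons a l =>
      obtain h | ⟨h, -⟩ := (mem_chain.1 hz (a :: l)).1
      · rw [h, Finsupp.single_eq_of_ne (by simp)]
      · simp at h

theorem one_mul_one (p : O) : β.mul (β.one p) (β.one p) = some (β.one p) := by
  simpa [β.src_one] using β.one_mul (β.one p)

theorem mon_one_mul_mon (a : Q) (c : k) :
    β.mon (β.one (β.src a)) c * β.mon a 1 = β.mon a c := by
  rw [mon_mul_mon, β.one_mul, Option.elim_some, _root_.mul_one]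

/-- In homological degree zero the homology is the module modulo its multiples by paths of positive
length, that is, its generators. These lie in degree n, so nothing is left in degrees p > n. -/
theorem exists_bd_of_span (h : IsGradedRightModule β.deg ℳ) {n : ℕ}
    (hs : Submodule.span Rᵐᵒᵖ (ℳ n : Set M) = ⊤) {p : ℤ} (hp : (n : ℤ) < p) :
    β.ExactAt ℳ 0 p := by
  intro z hz hbz
  clear hbz
  obtain ⟨m, hm, rfl⟩ := chain_zero hz
  -- The elements whose degree p component is a boundary. This is only a subgroup, so the span
  -- induction is run for all multiples of m at once.
  let K : AddSubgroup M := ((β.chain ℳ 1 p).map (β.bd M)).comap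
    ((Finsupp.singleAddHom []).comp (grProj h.isInternal p))
  suffices hK : ∀ r : Rᵐᵒᵖ, r • m ∈ K by
    have := hK 1
    rw [one_smul] at this
    change Finsupp.single [] (grProj h.isInternal p m) ∈ (β.chain ℳ 1 p).map (β.bd M) at this
    rwa [grProj_same _ hm] at this
  have hm' : m ∈ Submodule.span Rᵐᵒᵖ (ℳ n : Set M) := by rw [hs]; trivial
  clear hz hm
  induction hm' using Submodule.span_induction with
  | zero => intro r; rw [smul_zero]; exact zero_mem _
  | add x y _ _ hx hy => intro r; rw [smul_add]; exact add_mem (hx r) (hy r)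
  | smul s x _ hx => intro r; rw [smul_smul]; exact hx _
  | mem x hx =>
    intro r
    refine β.map_mem_of_mon (AddMonoidHom.mk' (fun r => op r • x) fun r s => by
      rw [op_add, add_smul]) K (fun a c => ?_) r.unop
    change Finsupp.single [] (grProj h.isInternal p (op (β.mon a c) • x)) ∈
      (β.chain ℳ 1 p).map (β.bd M)
    have hmem := h.smul_mem _ _ x hx _ (mon_mem_deg a c)
    by_cases e : (n : ℤ) + β.len a = p
    · rw [grProj_same _ (e ▸ hmem)]
      -- The scalar c stays on the coefficient, as a multiple of the identity at the source of a.
      -- This puts the coefficient at the right vertex, and the action of a then gives x times the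
      -- c-multiple of a.
      refine ⟨Finsupp.single [a] (op (β.mon (β.one (β.src a)) c) • x),
        single_mem_chain (β.valid_cons.2 ⟨by omega, by simp, β.valid_nil⟩) rfl ?_ ?_, ?_⟩
      · have := h.smul_mem _ _ x hx _ (mon_mem_deg (β := β) (β.one (β.src a)) c)
        convert this using 2
        simp [β.len_one, ← e]
      · intro b hb
        obtain rfl : a = b := by simpa using hb
        rw [act_apply, smul_smul, ← op_mul, mon_mul_mon, one_mul_one]
        simp
      · rw [bd_apply, actHead_cons, act_apply, smul_smul, ← op_mul, mon_one_mul_mon, bar_cons]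
        simp
    · rw [grProj_ne _ e hmem, Finsupp.single_zero]
      exact zero_mem _

/-- Dimension shifting. Homology in degree i + 1 over the image of P b is compared with homology in
degree i over the kernel, which is the image of P (b + 1); the bound i + b < p is unchanged by this
trade. In degree i = 0 it is generation in degree b that gives the vanishing. -/
theorem bar_exact_of_resolution {P : ℕ → Type x} [∀ i, AddCommGroup (P i)]
    [∀ i, Module Rᵐᵒᵖ (P i)] (𝒬 : ∀ i, ℤ → AddSubgroup (P i)) (δ : ∀ i, P (i + 1) →ₗ[Rᵐᵒᵖ] P i)
    (hgr : ∀ i, IsGradedRightModule β.deg (𝒬 i)) (hproj : ∀ i, Module.Projective Rᵐᵒᵖ (P i))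
    (hδ : ∀ i j, ∀ x ∈ 𝒬 (i + 1) j, δ i x ∈ 𝒬 i j)
    (hex : ∀ i, Function.Exact (δ (i + 1)) (δ i))
    (hgen : ∀ i : ℕ, Submodule.span Rᵐᵒᵖ (𝒬 i (i : ℤ) : Set (P i)) = ⊤) (i : ℕ) :
    ∀ (b : ℕ) {N : Type x} [AddCommGroup N] [Module Rᵐᵒᵖ N] (𝒩 : ℤ → AddSubgroup N)
      (π : P b →ₗ[Rᵐᵒᵖ] N), Function.Exact (δ b) π →
      (∀ j, ∀ x ∈ 𝒬 b j, π x ∈ 𝒩 j) → (∀ j, ∀ n ∈ 𝒩 j, ∃ x ∈ 𝒬 b j, π x = n) →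
      ∀ p : ℤ, (i : ℤ) + b < p → β.ExactAt 𝒩 i p := by
  induction i with
  | zero =>
    intro b N _ _ 𝒩 π hπ hdeg hlift p hp z hz hbz
    obtain ⟨x, hx, rfl⟩ := exists_lift π (compat_of_graded (hgr b)) hlift hz
    obtain ⟨n, -, rfl⟩ := chain_zero hx
    obtain ⟨w, hw, e⟩ := exists_bd_of_span (hgr b) (hgen b) (by simpa using hp) _ hx (bd_nil _ _)
    exact ⟨push π w, push_mem_chain π hdeg hw, by rw [bd_push, e]⟩
  | succ i ih =>
    intro b N _ _ 𝒩 π hπ hdeg hlift p hp z hz hbz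
    have hc := compat_of_graded (hgr b)
    obtain ⟨z', hz', rfl⟩ := exists_lift π hc hlift hz
    rw [bd_push] at hbz
    -- The connecting homomorphism: the boundary of a lift of the cycle has coefficients in the
    -- kernel of π.
    obtain ⟨y, hy, hye⟩ := exists_lift_ker π (bd_mem_chain hc hz') hbz
    have hran : ∀ x, δ b x ∈ LinearMap.ker π := fun x => (hπ _).2 ⟨x, rfl⟩
    have hex' : Function.Exact (δ (b + 1)) ((δ b).codRestrict (LinearMap.ker π) hran) := fun x =>
      Iff.trans ⟨fun h => congrArg Subtype.val h, fun h => Subtype.ext h⟩ (hex b x)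
    have hlift' : ∀ j, ∀ n ∈ (𝒬 b j).comap (LinearMap.ker π).subtype.toAddMonoidHom,
        ∃ x ∈ 𝒬 (b + 1) j, (δ b).codRestrict (LinearMap.ker π) hran x = n := by
      intro j n hn
      obtain ⟨x, hx⟩ := (hπ _).1 n.2
      have hn' : (n : P b) ∈ 𝒬 b j := hn
      refine ⟨grProj (hgr (b + 1)).isInternal j x, grProj_mem _ _ _, Subtype.ext ?_⟩
      refine (map_grProj (hgr (b + 1)).isInternal (hgr b).isInternal (δ b).toAddMonoidHom
        (hδ b) j x).trans ?_
      change grProj _ j (δ b x) = n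
      rw [hx]
      exact grProj_same _ hn'
    have hby : β.bd (LinearMap.ker π) y = 0 := push_injective (LinearMap.ker π).subtype
      Subtype.val_injective (by rw [← bd_push, hye, bd_bd, map_zero])
    obtain ⟨w, hw, hwe⟩ := ih (b + 1) _ _ hex' (fun j x hx => hδ b j x hx) hlift'
      p (by push_cast at hp ⊢; omega) y hy hby
    have hw' : push (LinearMap.ker π).subtype w ∈ β.chain (𝒬 b) (i + 1) p :=
      push_mem_chain _ (fun _ _ h => h) hw
    -- Subtracting w from the lift leaves a cycle over the projective module P b, hence a boundary;
    -- π kills what was subtracted.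
    obtain ⟨t, ht, hte⟩ := projective_graded_exactAt (hgr b).isInternal hc i p
      (z' - push (LinearMap.ker π).subtype w) (sub_mem hz' hw') (by
        rw [map_sub, bd_push, hwe, hye, sub_self])
    refine ⟨push π t, push_mem_chain π hdeg ht, ?_⟩
    rw [bd_push, hte, map_sub, sub_eq_self]
    ext l
    exact (w l).2

end PathBasis

end

/-! ### From exactness of the bar construction to a minimal linear resolution -/

section

open MulOpposite

namespace PathBasis

variable {k : Type u} [Field k] {R : Type w} [Ring R] {O Q : Type v} [Fintype O]
  {β : PathBasis k R O Q} {M : Type*} [AddCommGroup M] [Module Rᵐᵒᵖ M] {ℳ : ℤ → AddSubgroup M}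

theorem mul_one_ne {p q : O} (h : p ≠ q) : β.mul (β.one p) (β.one q) = none := by
  cases e : β.mul (β.one p) (β.one q) with
  | none => rfl
  | some c =>
    have := (β.mul_some _ _ _ e).1
    rw [β.tgt_one, β.src_one] at this
    exact absurd this h

theorem mon_one_mul_sum (p : O) (c d : k) :
    β.mon (β.one p) c * ∑ q, β.mon (β.one q) d = β.mon (β.one p) (c * d) := by
  rw [Finset.mul_sum, Finset.sum_eq_single p]
  · rw [mon_mul_mon, one_mul_one, Option.elim_some]
  · intro q _ hq
    rw [mon_mul_mon, mul_one_ne hq.symm, Option.elim_none]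
  · simp

variable (β) in
/-- The scalars act on right modules. -/
noncomputable def scalar : k →+* Rᵐᵒᵖ where
  toFun c := op (∑ p, β.mon (β.one p) c)
  map_one' := by rw [← β.one_eq, op_one]
  map_zero' := by simp
  map_add' c d := by simp [Finset.sum_add_distrib]
  map_mul' c d := by
    rw [← op_mul, Finset.sum_mul]
    congr 1
    refine Finset.sum_congr rfl fun p _ => ?_
    rw [mon_one_mul_sum, mul_comm]

theorem scalar_smul {p : O} {m : M} (h : β.act M (β.one p) m = m) (c : k) :
    β.scalar c • m = op (β.mon (β.one p) c) • m := by
  conv_lhs => rw [← h, act_apply, smul_smul]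
  rw [scalar, RingHom.coe_mk, MonoidHom.coe_mk, OneHom.coe_mk, ← op_mul, mon_one_mul_sum,
    _root_.one_mul]

theorem FreeMod_projective {X R : Type*} [Ring R] : Module.Projective Rᵐᵒᵖ (FreeMod X R) := by
  refine Module.Projective.of_lifting_property'' fun f hf => ?_
  choose g hg using fun x : X => hf (FreeMod.single x 1)
  refine ⟨FreeMod.cover R g, LinearMap.ext fun m => ?_⟩
  induction m using FreeMod.induction with
  | zero => simp
  | add a b ha hb => rw [map_add, ha, hb, map_add]
  | single x r =>
    rw [LinearMap.comp_apply, FreeMod.cover_single, map_smul, hg, FreeMod.smul_single,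
      _root_.one_mul, LinearMap.id_apply]

section FreeGrading

variable (β) (X : Type*) (n : ℕ)

open Classical in
/-- The projection of a free module with generators of degree `n` onto its component of
degree `j`. -/
noncomputable def freeProj (j : ℤ) : FreeMod X R →+ FreeMod X R :=
  FreeMod.lift fun x =>
    (Finsupp.liftAddHom fun a => if (n : ℤ) + β.len a = j then β.freeMon x a else 0).comp β.coef

/-- The grading of a free module with generators of degree `n`. -/
noncomputable def freeDeg (j : ℤ) : AddSubgroup (FreeMod X R) :=
  (β.freeProj X n j - AddMonoidHom.id _).ker

variable {X n}

theorem mem_freeDeg {j : ℤ} {f : FreeMod X R} :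
    f ∈ β.freeDeg X n j ↔ β.freeProj X n j f = f := by
  rw [freeDeg, AddMonoidHom.mem_ker, AddMonoidHom.sub_apply, AddMonoidHom.id_apply, sub_eq_zero]

open Classical in
theorem freeProj_mon (j : ℤ) (x : X) (a : Q) (c : k) : β.freeProj X n j (β.freeMon x a c) =
    if (n : ℤ) + β.len a = j then β.freeMon x a c else 0 := by
  rw [freeProj, freeMon, AddMonoidHom.comp_apply, FreeMod.lift_single, AddMonoidHom.comp_apply,
    β.coef_mon, Finsupp.liftAddHom_apply_single]
  split_ifs <;> rfl

theorem freeMon_mem (x : X) (a : Q) (c : k) :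
    β.freeMon x a c ∈ β.freeDeg X n (n + β.len a) := by
  rw [mem_freeDeg, freeProj_mon, if_pos rfl]

theorem map_freeDeg_mem {N : Type*} [AddCommGroup N] (T : FreeMod X R →+ N) (K : AddSubgroup N)
    {j : ℤ} (h : ∀ x a c, (n : ℤ) + β.len a = j → T (β.freeMon x a c) ∈ K) {f : FreeMod X R}
    (hf : f ∈ β.freeDeg X n j) : T f ∈ K := by
  rw [← (mem_freeDeg β).1 hf]
  refine mem_of_mon (β := β) (T.comp (β.freeProj X n j)) K (fun x a c => ?_) f
  rw [AddMonoidHom.comp_apply, freeProj_mon]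
  split_ifs with e
  · exact h x a c e
  · rw [map_zero]; exact zero_mem _

theorem freeDeg_isInternal : DirectSum.IsInternal (β.freeDeg X n) := by
  refine isInternal_of_proj (β.freeProj X n) (fun j m hm => (mem_freeDeg β).1 hm)
    (fun i j hij m hm => ?_) fun K hK => ?_
  · refine (AddSubgroup.mem_bot).1 (map_freeDeg_mem β (β.freeProj X n j) ⊥ (fun x a c e => ?_) hm)
    rw [freeProj_mon, if_neg (by omega)]
    exact zero_mem _
  · rw [eq_top_iff]
    intro f _
    exact mem_of_mon (β := β) (AddMonoidHom.id _) K (fun x a c => hK _ (freeMon_mem β x a c)) f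

theorem freeDeg_smul (j : ℤ) (d : ℕ) : ∀ m ∈ β.freeDeg X n j, ∀ r ∈ β.deg d,
    op r • m ∈ β.freeDeg X n (j + d) := by
  intro m hm r hr
  refine map_freeDeg_mem β (DistribSMul.toAddMonoidHom _ (op r)) _ (fun x a c e => ?_) hm
  refine map_deg_mem (β := β) (AddMonoidHom.mk' (fun r => op r • β.freeMon x a c) fun r s => by
      rw [op_add, add_smul]) _ (fun b c' e' => ?_) hr
  change op (β.mon b c') • FreeMod.single x (β.mon a c) ∈ _
  rw [FreeMod.smul_single, mon_mul_mon]
  cases h : β.mul a b with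
  | none => rw [Option.elim_none, map_zero]; exact zero_mem _
  | some g =>
    have := (β.mul_some _ _ _ h).2.2.2
    have h2 := freeMon_mem β (n := n) x g (c * c')
    rw [this, Nat.cast_add, ← add_assoc, e, e'] at h2
    exact h2

end FreeGrading

section Peirce

variable (β) {X : Type*} (pt : X → O)

/-- Left multiplication of the coordinates by chosen vertex idempotents. -/
noncomputable def idem : FreeMod X R →ₗ[Rᵐᵒᵖ] FreeMod X R :=
  FreeMod.cover R fun x => β.freeMon x (β.one (pt x)) 1

theorem idem_single (x : X) (r : R) : β.idem pt (FreeMod.single x r) =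
    FreeMod.single x (β.mon (β.one (pt x)) 1 * r) := by
  rw [idem, FreeMod.cover_single]
  exact FreeMod.smul_single _ _ _

theorem idem_mon (x : X) (a : Q) (c : k) : β.idem pt (β.freeMon x a c) =
    (β.mul (β.one (pt x)) a).elim 0 fun g => β.freeMon x g c := by
  refine (idem_single β pt x _).trans ?_
  rw [mon_mul_mon]
  cases β.mul (β.one (pt x)) a <;> simp [freeMon]

theorem idem_idem (f : FreeMod X R) : β.idem pt (β.idem pt f) = β.idem pt f := by
  induction f using FreeMod.induction with
  | zero => simp
  | add a b ha hb => rw [map_add, map_add, ha, hb]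
  | single x r =>
    rw [idem_single, idem_single, ← mul_assoc, mon_mul_mon, one_mul_one, Option.elim_some,
      _root_.one_mul]

theorem idem_deg {n : ℕ} (j : ℤ) {f : FreeMod X R} (hf : f ∈ β.freeDeg X n j) :
    β.idem pt f ∈ β.freeDeg X n j := by
  refine map_freeDeg_mem β (β.idem pt).toAddMonoidHom _ (fun x a c e => ?_) hf
  change β.idem pt _ ∈ _
  rw [idem_mon]
  cases h : β.mul (β.one (pt x)) a with
  | none => exact zero_mem _
  | some g =>
    have h1 := (β.mul_some _ _ _ h).2.2.2
    rw [β.len_one, zero_add] at h1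
    rw [← e, ← h1]
    exact freeMon_mem β x g c

/-- The direct sum of the right ideals generated by chosen vertex idempotents. -/
noncomputable abbrev Peirce : Submodule Rᵐᵒᵖ (FreeMod X R) := LinearMap.ker (LinearMap.id - β.idem pt)

theorem mem_peirce {f : FreeMod X R} : f ∈ β.Peirce pt ↔ β.idem pt f = f := by
  rw [LinearMap.mem_ker, LinearMap.sub_apply, LinearMap.id_apply, sub_eq_zero, eq_comm]

/-- The projection of a free module onto a direct sum of right ideals. -/
noncomputable def toPeirce : FreeMod X R →ₗ[Rᵐᵒᵖ] β.Peirce pt :=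
  (β.idem pt).codRestrict _ fun f => (mem_peirce β pt).2 (idem_idem β pt f)

theorem toPeirce_coe (f : β.Peirce pt) : β.toPeirce pt f = f :=
  Subtype.ext ((mem_peirce β pt).1 f.2)

theorem peirce_projective : Module.Projective Rᵐᵒᵖ (β.Peirce pt) := by
  have := FreeMod_projective (X := X) (R := R)
  exact Module.Projective.of_split (β.Peirce pt).subtype (β.toPeirce pt)
    (LinearMap.ext (toPeirce_coe β pt))

/-- The grading of a direct sum of right ideals with generators of degree `n`. -/
noncomputable def peirceDeg (n : ℕ) (j : ℤ) : AddSubgroup (β.Peirce pt) :=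
  (β.freeDeg X n j).comap (β.Peirce pt).subtype.toAddMonoidHom

theorem peirce_graded (n : ℕ) : IsGradedRightModule β.deg (β.peirceDeg pt n) :=
  ⟨isInternal_comap_ker (freeDeg_isInternal β) (freeDeg_isInternal β) _
    fun j _ hf => sub_mem hf (idem_deg β pt j hf),
    fun j d _ hm r hr => freeDeg_smul β j d _ hm r hr⟩

theorem peirce_span (n : ℕ) :
    Submodule.span Rᵐᵒᵖ (β.peirceDeg pt n (n : ℤ) : Set (β.Peirce pt)) = ⊤ := by
  rw [eq_top_iff]
  intro f _
  rw [← toPeirce_coe β pt f]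
  generalize (f : FreeMod X R) = g
  induction g using FreeMod.induction with
  | zero => rw [map_zero]; exact zero_mem _
  | add a b ha hb => rw [map_add]; exact add_mem ha hb
  | single x r =>
    have : FreeMod.single x r = op r • FreeMod.single x 1 := by
      rw [FreeMod.smul_single, _root_.one_mul]
    rw [this, map_smul]
    refine Submodule.smul_mem _ _ (Submodule.subset_span ?_)
    change β.idem pt (FreeMod.single x 1) ∈ β.freeDeg X n n
    rw [idem_single, _root_.mul_one]
    have := freeMon_mem β (n := n) x (β.one (pt x)) 1
    rwa [β.len_one, Nat.cast_zero, add_zero] at this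

/-- The lowest degree part of a direct sum of right ideals. -/
noncomputable def lowest : (X →₀ k) →+ FreeMod X R :=
  Finsupp.liftAddHom fun x => β.freeMon x (β.one (pt x))

/-- Generators sit in degree n, so in degrees at most n only identities can occur, and the identity
that survives at x is the one at `pt x`. -/
theorem idem_mem_lowest {n : ℕ} {j : ℤ} (hj : j < ((n + 1 : ℕ) : ℤ)) {f : FreeMod X R}
    (hf : f ∈ β.freeDeg X n j) : β.idem pt f ∈ (β.lowest pt).range := by
  refine map_freeDeg_mem β (β.idem pt).toAddMonoidHom _ (fun x a c e => ?_) hf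
  change β.idem pt _ ∈ _
  rw [idem_mon]
  cases h : β.mul (β.one (pt x)) a with
  | none => exact zero_mem _
  | some g =>
    obtain ⟨h1, -, -, -⟩ := β.mul_some _ _ _ h
    have h2 := β.eq_one a (by push_cast at hj; omega)
    rw [β.tgt_one] at h1
    rw [← h1] at h2
    rw [h2, one_mul_one] at h
    obtain rfl := Option.some.inj h
    exact ⟨Finsupp.single x c, Finsupp.liftAddHom_apply_single _ _ _⟩

variable {pt} {b : X → M} (hb : ∀ x, β.act M (β.one (pt x)) (b x) = b x)
include hb

theorem cover_idem (f : FreeMod X R) :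
    FreeMod.cover R b (β.idem pt f) = FreeMod.cover R b f := by
  induction f using FreeMod.induction with
  | zero => simp
  | add f g hf hg => rw [map_add, map_add, map_add, hf, hg]
  | single x r =>
    rw [idem_single, FreeMod.cover_single, FreeMod.cover_single, op_mul, mul_smul]
    exact congrArg _ (hb x)

theorem cover_lowest (c : X →₀ k) : FreeMod.cover R b (β.lowest pt c) =
    c.sum fun x c => β.scalar c • b x := by
  induction c using Finsupp.induction_linear with
  | zero => simp
  | add f g hf hg =>
    rw [map_add, map_add, hf, hg, Finsupp.sum_add_index' (by simp) (by simp [add_smul])]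
  | single x c =>
    rw [Finsupp.sum_single_index (by simp), scalar_smul (hb x), lowest,
      Finsupp.liftAddHom_apply_single]
    exact FreeMod.cover_single _ _ _

end Peirce

theorem cover_deg {X : Type*} {b : X → M} {n : ℕ} (hgr : IsGradedRightModule β.deg ℳ)
    (hb : ∀ x, b x ∈ ℳ n) (j : ℤ) {f : FreeMod X R} (hf : f ∈ β.freeDeg X n j) :
    FreeMod.cover R b f ∈ ℳ j := by
  refine map_freeDeg_mem β (FreeMod.cover R b).toAddMonoidHom _ (fun x a c e => ?_) hf
  change FreeMod.cover R b (FreeMod.single x _) ∈ _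
  rw [FreeMod.cover_single, ← e]
  exact hgr.smul_mem _ _ _ (hb x) _ (mon_mem_deg a c)

/-- Graded modules starting in degree `n` with linear minimal resolution, phrased through the bar
construction. -/
structure LinMod (β : PathBasis k R O Q) (n : ℕ) where
  N : Type w
  [grp : AddCommGroup N]
  [mod : Module Rᵐᵒᵖ N]
  𝒩 : ℤ → AddSubgroup N
  gr : IsGradedRightModule β.deg 𝒩
  low : ∀ j < (n : ℤ), 𝒩 j = ⊥
  exact : ∀ (i : ℕ) (p : ℤ), (i : ℤ) + n < p → β.ExactAt 𝒩 i p

attribute [instance] LinMod.grp LinMod.mod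

/-- A projective cover of a module in `LinMod`. -/
structure LinCover {n : ℕ} (L : LinMod β n) where
  P : Type w
  [grp : AddCommGroup P]
  [mod : Module Rᵐᵒᵖ P]
  𝒬 : ℤ → AddSubgroup P
  gr : IsGradedRightModule β.deg 𝒬
  proj : Module.Projective Rᵐᵒᵖ P
  π : P →ₗ[Rᵐᵒᵖ] L.N
  map_deg : ∀ j, ∀ x ∈ 𝒬 j, π x ∈ L.𝒩 j
  surj : Function.Surjective π
  gen : Submodule.span Rᵐᵒᵖ (𝒬 (n : ℤ) : Set P) = ⊤
  low : ∀ j < ((n + 1 : ℕ) : ℤ), ∀ x ∈ 𝒬 j, π x = 0 → x = 0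

attribute [instance] LinCover.grp LinCover.mod

/-- A graded Nakayama argument, by induction on the degree above n. -/
theorem LinMod.span_eq_top {n : ℕ} (L : LinMod β n) (K : Submodule Rᵐᵒᵖ L.N)
    (hK : (L.𝒩 n : Set L.N) ⊆ K) : K = ⊤ := by
  have key : ∀ t : ℕ, L.𝒩 (n + t) ≤ K.toAddSubgroup := by
    intro t
    induction t using Nat.strong_induction_on with
    | _ t ih =>
    obtain rfl | ht := Nat.eq_zero_or_pos t
    · rw [Nat.cast_zero, add_zero]; exact hK
    intro m hm
    -- Exactness in homological degree zero writes m as a sum of elements of smaller degree times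
    -- paths of positive length. Degrees that fall below n contribute nothing.
    obtain ⟨w, hw, e⟩ := L.exact 0 (n + t) (by simp; omega) (Finsupp.single [] m)
      (single_mem_chain β.valid_nil rfl (by simpa using hm) (by simp)) (bd_nil _ _)
    have : ((Finsupp.applyAddHom []).comp (β.bd L.N)) w ∈ K.toAddSubgroup := by
      refine map_chain_mem _ _ (fun l m' h1 h2 h3 h4 => ?_) hw
      obtain ⟨a, rfl⟩ := List.length_eq_one_iff.1 h2
      rw [AddMonoidHom.comp_apply, bd_apply, actHead_cons, bar_cons]
      simp only [merge_nil, bar_nil, map_zero, sub_zero, Finsupp.applyAddHom_apply,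
        Finsupp.single_eq_same]
      refine K.smul_mem _ ?_
      have ha := (β.valid_cons.1 h1).1
      rw [wt_cons, wt_nil, add_zero] at h3
      by_cases hle : β.len a ≤ t
      · refine ih (t - β.len a) (by omega) ?_
        convert h3 using 2
        omega
      · rw [L.low _ (by omega)] at h3
        rw [(AddSubgroup.mem_bot).1 h3]
        exact zero_mem _
    rw [AddMonoidHom.comp_apply, e] at this
    simpa using this
  have : K.toAddSubgroup = ⊤ := by
    rw [eq_top_iff]
    intro m _
    obtain ⟨s, hs⟩ := exists_sum_grProj L.gr.isInternal m
    rw [hs]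
    refine sum_mem fun j _ => ?_
    have hj := grProj_mem L.gr.isInternal j m
    by_cases h : (n : ℤ) ≤ j
    · refine key (j - n).toNat ?_
      convert hj using 2
      omega
    · rw [L.low j (by omega)] at hj
      rw [(AddSubgroup.mem_bot).1 hj]
      exact zero_mem _
  rw [eq_top_iff]
  intro m _
  have hm : m ∈ K.toAddSubgroup := by rw [this]; trivial
  exact hm

/-- The lowest component is spanned by its vectors at single vertices, because the identities sum to
1. A basis chosen among these generates by `LinMod.span_eq_top`; its linear independence over k
makes the cover minimal. -/
theorem LinMod.exists_generators {n : ℕ} (L : LinMod β n) : ∃ (X : Set L.N) (pt : X → O),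
    (∀ x : X, (x : L.N) ∈ L.𝒩 n) ∧ (∀ x : X, β.act L.N (β.one (pt x)) x = x) ∧
    (LinearMap.range (FreeMod.cover R fun x : X => (x : L.N)) = ⊤) ∧
    ∀ c : X →₀ k, (c.sum fun x c => β.scalar c • (x : L.N)) = 0 → c = 0 := by
  let _ : Module k L.N := Module.compHom L.N β.scalar
  obtain ⟨X, hXH, hspan, hli⟩ := exists_linearIndependent k
    {m : L.N | m ∈ L.𝒩 n ∧ ∃ p, β.act L.N (β.one p) m = m}
  choose pt hpt using fun x : X => (hXH x.2).2
  refine ⟨X, pt, fun x => (hXH x.2).1, hpt, ?_, fun c hc => linearIndependent_iff.1 hli c hc⟩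
  refine L.span_eq_top _ fun m hm => ?_
  have h1 : m ∈ Submodule.span k {m : L.N | m ∈ L.𝒩 n ∧ ∃ p, β.act L.N (β.one p) m = m} := by
    rw [← β.sum_act_one m]
    refine sum_mem fun p _ => Submodule.subset_span ⟨?_, p, ?_⟩
    · exact (compat_of_graded L.gr).act_one hm p
    · rw [act_act, one_mul_one]; rfl
  rw [← hspan] at h1
  change m ∈ LinearMap.range _
  clear hm
  induction h1 using Submodule.span_induction with
  | zero => exact zero_mem _
  | add x y _ _ hx hy => exact add_mem hx hy
  | smul c x _ hx => exact Submodule.smul_mem _ (β.scalar c) hx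
  | mem x hx => exact ⟨FreeMod.single ⟨x, hx⟩ 1, by rw [FreeMod.cover_single]; simp⟩

/-- A generator at a vertex contributes only the right ideal of the identity at that vertex, not a
full copy of R. The lowest component of the cover then consists of k-combinations of generators, and
by independence none of them maps to zero. -/
theorem LinMod.exists_cover {n : ℕ} (L : LinMod β n) : Nonempty (LinCover L) := by
  obtain ⟨X, pt, hX, hpt, hsurj, hli⟩ := L.exists_generators
  refine ⟨{ P := β.Peirce pt
            𝒬 := β.peirceDeg pt n
            gr := peirce_graded β pt n
            proj := peirce_projective β pt
            π := (FreeMod.cover R fun x : X => (x : L.N)).comp (β.Peirce pt).subtype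
            map_deg := fun j f hf => cover_deg L.gr hX j hf
            surj := ?_
            gen := peirce_span β pt n
            low := ?_ }⟩
  · intro m
    obtain ⟨f, rfl⟩ := LinearMap.range_eq_top.1 hsurj m
    exact ⟨β.toPeirce pt f, cover_idem β hpt f⟩
  · intro j hj f hf h0
    have hfe := (mem_peirce β pt).1 f.2
    obtain ⟨c, hc⟩ := idem_mem_lowest β pt hj hf
    replace hc := hc.trans hfe
    have h1 := cover_lowest β hpt c
    rw [hc] at h1
    have hc0 : c = 0 := hli c (h1.symm.trans h0)
    exact Subtype.ext (by rw [← hc, hc0, map_zero]; rfl)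

variable {n : ℕ} {L : LinMod β n}

/-- The kernel of a cover. -/
noncomputable def LinCover.next (C : LinCover L) : LinMod β (n + 1) where
  N := LinearMap.ker C.π
  𝒩 := fun j => (C.𝒬 j).comap (LinearMap.ker C.π).subtype.toAddMonoidHom
  gr := ⟨isInternal_comap_ker C.gr.isInternal L.gr.isInternal C.π C.map_deg,
    fun j d m hm r hr => C.gr.smul_mem j d m hm r hr⟩
  low := by
    intro j hj
    rw [eq_bot_iff]
    intro x hx
    exact (AddSubgroup.mem_bot).2 (Subtype.ext (C.low j hj x hx x.2))
  exact := by
    intro i p hp z hz hbz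
    have := C.proj
    have hc := compat_of_graded C.gr
    have hz' : push (LinearMap.ker C.π).subtype z ∈ β.chain C.𝒬 i p :=
      push_mem_chain _ (fun _ _ h => h) hz
    -- For i = 0 the cover is not acyclic, but it is generated in degree n, which is below p.
    have hex : β.ExactAt C.𝒬 i p := by
      cases i with
      | zero => exact exists_bd_of_span C.gr C.gen (by push_cast at hp; omega)
      | succ i => exact projective_graded_exactAt C.gr.isInternal hc i p
    obtain ⟨t, ht, hte⟩ := hex _ hz' (by rw [bd_push, hbz, map_zero])
    have hlift : ∀ j, ∀ m ∈ L.𝒩 j, ∃ x ∈ C.𝒬 j, C.π x = m := by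
      intro j m hm
      obtain ⟨x, rfl⟩ := C.surj m
      refine ⟨grProj C.gr.isInternal j x, grProj_mem _ _ _, ?_⟩
      exact (map_grProj C.gr.isInternal L.gr.isInternal C.π.toAddMonoidHom C.map_deg j x).trans
        (grProj_same _ hm)
    have hpush : push C.π (push (LinearMap.ker C.π).subtype z) = 0 := by
      ext l
      exact (z l).2
    -- The image of t is a cycle one homological degree higher, where the bound for L still applies.
    -- Correcting t by the boundary of a lift of w moves it into the kernel.
    obtain ⟨w, hw, hwe⟩ := L.exact (i + 1) p (by push_cast at hp ⊢; omega) (push C.π t)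
      (push_mem_chain _ C.map_deg ht) (by rw [bd_push, hte, hpush])
    obtain ⟨w', hw', rfl⟩ := exists_lift C.π hc hlift hw
    obtain ⟨g, hg, hge⟩ := exists_lift_ker C.π (f := t - β.bd C.P w')
      (sub_mem ht (bd_mem_chain hc hw')) (by rw [map_sub, ← bd_push, hwe, sub_self])
    refine ⟨g, hg, push_injective (LinearMap.ker C.π).subtype Subtype.val_injective ?_⟩
    rw [← bd_push, hge, map_sub, hte, bd_bd, sub_zero]

/-- A chosen cover. -/
noncomputable def LinMod.cover {n : ℕ} (L : LinMod β n) : LinCover L := L.exists_cover.some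

/-- The iterated syzygies. -/
noncomputable def LinMod.syzygy (L : LinMod β 0) : ∀ n, LinMod β n
  | 0 => L
  | n + 1 => (L.syzygy n).cover.next

/-- For a module concentrated in degree zero, being Koszul means that the bar construction is exact
off the diagonal. -/
theorem isKoszulModule_iff {M : Type w} [AddCommGroup M] [Module Rᵐᵒᵖ M] {ℳ : ℤ → AddSubgroup M}
    (hne : ∀ j, j ≠ 0 → ℳ j = ⊥) (hgr : IsGradedRightModule β.deg ℳ) :
    IsKoszulModule β.deg ℳ ↔ ∀ (i : ℕ) (p : ℤ), (i : ℤ) < p → β.ExactAt ℳ i p := by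
  constructor
  · rintro ⟨P, _, _, 𝒬, δ, ε, hg, hproj, hδ, hε, hsurj, hex0, hex, hgen⟩ i p hp
    refine bar_exact_of_resolution 𝒬 δ hg hproj hδ hex hgen i 0 ℳ ε hex0 hε ?_ p (by simpa using hp)
    intro j m hm
    obtain ⟨x, rfl⟩ := hsurj m
    refine ⟨grProj (hg 0).isInternal j x, grProj_mem _ _ _, ?_⟩
    exact (map_grProj (hg 0).isInternal hgr.isInternal ε.toAddMonoidHom hε j x).trans
      (grProj_same _ hm)
  · intro h
    let L : LinMod β 0 :=
      { N := M
        𝒩 := ℳ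
        gr := hgr
        low := fun j hj => hne j (by simp at hj; omega)
        exact := fun i p hp => h i p (by simpa using hp) }
    let C : ∀ n, LinCover (L.syzygy n) := fun n => (L.syzygy n).cover
    let δ : ∀ n, (C (n + 1)).P →ₗ[Rᵐᵒᵖ] (C n).P := fun n =>
      (LinearMap.ker (C n).π).subtype.comp (C (n + 1)).π
    have hδ : ∀ n x, δ n x = ((C (n + 1)).π x : LinearMap.ker (C n).π).1 := fun n x => rfl
    have hran : ∀ n (y : (C n).P), (C n).π y = 0 ↔ y ∈ Set.range (δ n) := by
      intro n y
      constructor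
      · intro hy
        obtain ⟨x, hx⟩ := (C (n + 1)).surj (⟨y, hy⟩ : LinearMap.ker (C n).π)
        exact ⟨x, congrArg Subtype.val hx⟩
      · rintro ⟨x, rfl⟩
        exact ((C (n + 1)).π x : LinearMap.ker (C n).π).2
    refine ⟨fun n => (C n).P, fun n => inferInstance, fun n => inferInstance, fun n => (C n).𝒬, δ,
      (C 0).π, fun n => (C n).gr, fun n => (C n).proj, fun n j x hx => (C (n + 1)).map_deg j x hx,
      (C 0).map_deg, (C 0).surj, hran 0, fun n y => ?_, fun n => (C n).gen⟩
    rw [← hran (n + 1) y]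
    exact ⟨fun h => Subtype.ext h, fun h => congrArg Subtype.val h⟩

end PathBasis

end

/-! ### Coefficients that are one-dimensional at each vertex -/

section

open MulOpposite

namespace PathBasis

variable {k : Type u} [Field k] {R : Type w} [Ring R] {O Q : Type v} [Fintype O]
  {β : PathBasis k R O Q} {M : Type*} [AddCommGroup M] [Module Rᵐᵒᵖ M] {ℳ : ℤ → AddSubgroup M}

variable (β) in
/-- Combinations of composable lists with given number of members and total length. -/
def listChain (i p : ℕ) : AddSubgroup (List Q →₀ k) :=
  Finsupp.constrained fun l => (⊤ : AddSubgroup k).cell (β.Valid l ∧ l.length = i ∧ β.wt l = p)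

variable (β) in
/-- Exactness of the bar construction on composable lists. -/
def ListExactAt (i p : ℕ) : Prop :=
  ∀ z ∈ β.listChain i p, β.bar k z = 0 → ∃ w ∈ β.listChain (i + 1) p, β.bar k w = z

/-- A module concentrated in degree zero which is one-dimensional at each vertex. -/
structure VertexModule (β : PathBasis k R O Q) (ℳ : ℤ → AddSubgroup M) where
  κ : O → k →+ M
  inj : ∀ p, Function.Injective (κ p)
  act_one : ∀ p c, β.act M (β.one p) (κ p c) = κ p c
  exists_eq : ∀ p m, β.act M (β.one p) m = m → ∃ c, κ p c = m
  act_pos : ∀ a m, β.len a ≠ 0 → β.act M a m = 0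
  zero_eq : ℳ 0 = ⊤
  ne_eq : ∀ j, j ≠ 0 → ℳ j = ⊥

namespace VertexModule

variable (V : VertexModule β ℳ)

/-- The coefficientwise inclusion of the combinations of lists into the bar construction. -/
noncomputable def incl : (List Q →₀ k) →+ (List Q →₀ M) :=
  Finsupp.liftAddHom fun l => match l with
    | [] => 0
    | a :: l => (Finsupp.singleAddHom (a :: l)).comp (V.κ (β.src a))

theorem incl_cons (a : Q) (l : List Q) (c : k) : V.incl (Finsupp.single (a :: l) c) =
    Finsupp.single (a :: l) (V.κ (β.src a) c) := by
  simp [incl]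

theorem incl_apply_cons (f : List Q →₀ k) (a : Q) (l : List Q) :
    V.incl f (a :: l) = V.κ (β.src a) (f (a :: l)) := by
  classical
  induction f using Finsupp.induction_linear with
  | zero => simp
  | add f g hf hg => rw [map_add, Finsupp.add_apply, hf, hg, Finsupp.add_apply, map_add]
  | single l' c =>
    cases l' with
    | nil => rw [Finsupp.single_eq_of_ne (by simp)]; simp [incl]
    | cons b l' =>
      rw [incl_cons, Finsupp.single_apply, Finsupp.single_apply]
      split_ifs with h
      · obtain ⟨rfl, rfl⟩ := List.cons_eq_cons.1 h; rfl
      · rw [map_zero]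

theorem incl_injOn {i p : ℕ} {f : List Q →₀ k} (hf : f ∈ β.listChain (i + 1) p)
    (h : V.incl f = 0) : f = 0 := by
  ext l
  cases l with
  | nil =>
    obtain h | ⟨⟨-, h, -⟩, -⟩ := hf []
    · exact h
    · simp at h
  | cons a l =>
    have := V.incl_apply_cons f a l
    rw [h, Finsupp.zero_apply] at this
    exact (injective_iff_map_eq_zero _).1 (V.inj _) _ this.symm

theorem incl_mem {i p : ℕ} {f : List Q →₀ k} (hf : f ∈ β.listChain (i + 1) p) :
    V.incl f ∈ β.chain ℳ (i + 1) p := by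
  refine Finsupp.map_mem_of_constrained V.incl _ ?_ hf
  rintro l c (rfl | ⟨⟨h1, h2, h3⟩, -⟩)
  · simp
  cases l with
  | nil => simp at h2
  | cons a l =>
    rw [incl_cons]
    refine single_mem_chain h1 h2 ?_ ?_
    · rw [h3, sub_self, V.zero_eq]; trivial
    · intro b hb
      obtain rfl : a = b := by simpa using hb
      exact V.act_one _ _

theorem exists_incl {i p : ℕ} {z : List Q →₀ M} (hz : z ∈ β.chain ℳ (i + 1) p) :
    ∃ f ∈ β.listChain (i + 1) p, V.incl f = z := by
  change z ∈ (β.listChain (i + 1) p).map V.incl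
  refine map_chain_mem (AddMonoidHom.id _) _ (fun l m h1 h2 h3 h4 => ?_) hz
  cases l with
  | nil => simp at h2
  | cons a l =>
    by_cases hp : β.wt (a :: l) = p
    · obtain ⟨c, rfl⟩ := V.exists_eq (β.src a) m (h4 a rfl)
      exact ⟨_, Finsupp.single_mem_constrained (Or.inr ⟨⟨h1, h2, hp⟩, trivial⟩), V.incl_cons a l c⟩
    · rw [V.ne_eq _ (by omega), AddSubgroup.mem_bot] at h3
      rw [h3, AddMonoidHom.id_apply, Finsupp.single_zero]
      exact zero_mem _

/-- Paths of positive length act by zero, so only the merging part of the differential remains. -/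
theorem bd_incl {i p : ℕ} {f : List Q →₀ k} (hf : f ∈ β.listChain (i + 1) p) :
    β.bd M (V.incl f) = - V.incl (β.bar k f) := by
  refine Finsupp.map_eq_of_constrained ((β.bd M).comp V.incl) (-(V.incl.comp (β.bar k))) ?_ hf
  rintro l c (rfl | ⟨⟨h1, h2, h3⟩, -⟩)
  · simp
  cases l with
  | nil => simp at h2
  | cons a l =>
    rw [AddMonoidHom.comp_apply, incl_cons, bd_apply, actHead_cons,
      V.act_pos _ _ (β.valid_cons.1 h1).1, Finsupp.single_zero, zero_sub, AddMonoidHom.neg_apply,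
      AddMonoidHom.comp_apply]
    have h := β.bar_mapRange (V.κ (β.src a)) (Finsupp.single (a :: l) c)
    simp only [Finsupp.mapRange.addMonoidHom_apply, Finsupp.mapRange_single] at h
    rw [h]
    congr 1
    refine Finsupp.map_eq_of_constrained (Finsupp.mapRange.addMonoidHom (V.κ (β.src a)))
      V.incl ?_ (β.bar_single_mem h1 (AddSubgroup.mem_top c))
    rintro l' c' (rfl | ⟨⟨-, -, -, h4⟩, -⟩)
    · simp
    · cases l' with
      | nil => simp at h4
      | cons b l' =>
        have : β.src b = β.src a := by simpa using h4
        rw [incl_cons, this]; simp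

theorem bar_mem_listChain {i p : ℕ} {f : List Q →₀ k} (hf : f ∈ β.listChain (i + 1) p) :
    β.bar k f ∈ β.listChain i p := by
  refine Finsupp.map_mem_of_constrained (β.bar k) _ ?_ hf
  rintro l c (rfl | ⟨⟨h1, h2, h3⟩, -⟩)
  · simp
  intro l'
  obtain h | ⟨⟨g1, g2, g3, -⟩, -⟩ := β.bar_single_mem h1 (AddSubgroup.mem_top c) l'
  · exact Or.inl h
  · exact Or.inr ⟨⟨g1, by omega, by omega⟩, trivial⟩

-- On nonempty lists a coefficient at the vertex of the head is the same as a scalar. On the empty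
-- list the chains of internal degree p > 0 vanish, so homological degree zero imposes nothing.
include V in
theorem exactAt_iff : (∀ (i : ℕ) (p : ℤ), (i : ℤ) < p → β.ExactAt ℳ i p) ↔
    ∀ i p : ℕ, i + 1 < p → β.ListExactAt (i + 1) p := by
  constructor
  · intro h i p hp z hz hbz
    obtain ⟨w, hw, hwz⟩ := h (i + 1) p (by exact_mod_cast hp) (V.incl z) (V.incl_mem hz)
      (by rw [V.bd_incl hz, hbz, map_zero, neg_zero])
    obtain ⟨f, hf, rfl⟩ := V.exists_incl hw
    refine ⟨-f, neg_mem hf, ?_⟩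
    rw [V.bd_incl hf, ← sub_eq_zero, ← map_neg, ← map_neg, ← map_sub] at hwz
    rw [← sub_eq_zero]
    exact V.incl_injOn (sub_mem (bar_mem_listChain (neg_mem hf)) hz) hwz
  · intro h i p hp z hz hbz
    cases i with
    | zero =>
      obtain ⟨m, hm, rfl⟩ := chain_zero hz
      rw [V.ne_eq p (by simp at hp; omega), AddSubgroup.mem_bot] at hm
      exact ⟨0, zero_mem _, by rw [hm, Finsupp.single_zero, map_zero]⟩
    | succ i =>
      lift p to ℕ using by omega
      obtain ⟨f, hf, rfl⟩ := V.exists_incl hz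
      rw [V.bd_incl hf, neg_eq_zero] at hbz
      -- `incl` kills the empty list, so for i = 0 injectivity is of no use. There `bar` lands on
      -- lists with no entries and weight p, which do not exist as p > 0.
      have h0 : β.bar k f = 0 := by
        cases i with
        | zero =>
          have : β.bar k f ∈ β.listChain 0 p := bar_mem_listChain hf
          ext l
          obtain h | ⟨⟨-, g2, g3⟩, -⟩ := this l
          · exact h
          · rw [List.length_eq_zero_iff.1 g2, wt_nil] at g3
            omega
        | succ i => exact V.incl_injOn (bar_mem_listChain hf) hbz
      obtain ⟨w, hw, rfl⟩ := h i p (by omega) f hf h0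
      exact ⟨-V.incl w, neg_mem (V.incl_mem hw), by rw [map_neg, V.bd_incl hw, neg_neg]⟩

end VertexModule

end PathBasis

end

/-! ### Composition of interval classes and their length -/

namespace ReducedIncidence

variable {P : Type v} [PartialOrder P] {r : Setoid (NonemptyInterval P)} [hr : Axioms r]

/-- The class of the lower end point. -/
def source : Quotient r → Quotient (pointSetoid r) :=
  Quotient.lift (fun J => Quotient.mk _ J.fst) fun J J' h =>
    source_eq (h := J.fst_le_snd) (h' := J'.fst_le_snd) (Quotient.sound h)

/-- The class of the upper end point. -/
def target : Quotient r → Quotient (pointSetoid r) :=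
  Quotient.lift (fun J => Quotient.mk _ J.snd) fun J J' h =>
    target_eq (h := J.fst_le_snd) (h' := J'.fst_le_snd) (Quotient.sound h)

omit hr in
theorem exists_rep (a : Quotient r) : ∃ (x y : P) (h : x ≤ y), a = Quotient.mk r (cl h) := by
  induction a using Quotient.inductionOn with | h J =>
  exact ⟨J.fst, J.snd, J.fst_le_snd, rfl⟩

omit hr in
theorem pointClass_mk (x : P) : pointClass r (Quotient.mk _ x) = Quotient.mk r (cl (le_refl x)) :=
  rfl

theorem source_pointClass (p : Quotient (pointSetoid r)) : source (pointClass r p) = p := by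
  induction p using Quotient.inductionOn with | h x => rfl

theorem target_pointClass (p : Quotient (pointSetoid r)) : target (pointClass r p) = p := by
  induction p using Quotient.inductionOn with | h x => rfl

/-- Here the concatenation axiom enters: classes with matching end points have representatives that
can be glued. Composability is thus a condition on the end points alone. -/
theorem exists_composes_iff {a b : Quotient r} : (∃ c, Composes r a b c) ↔ target a = source b := by
  constructor
  · rintro ⟨c, x, y, z, hxy, hyz, rfl, rfl, rfl⟩
    rfl
  · intro h
    obtain ⟨x, y, hxy, rfl⟩ := exists_rep a
    obtain ⟨y', z, hyz, rfl⟩ := exists_rep b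
    obtain ⟨x', y'', z', h1, h2, e1, e2⟩ := hr.concatenative x y y' z hxy hyz (Quotient.exact h)
    exact ⟨_, x', y'', z', h1, h2, Quotient.sound e1, Quotient.sound e2, rfl⟩

theorem Composes.target_eq {a b c : Quotient r} (h : Composes r a b c) : target a = source b :=
  exists_composes_iff.1 ⟨c, h⟩

theorem Composes.source {a b c : Quotient r} (h : Composes r a b c) : source c = source a := by
  obtain ⟨x, y, z, hxy, hyz, rfl, rfl, rfl⟩ := h
  rfl

theorem Composes.target {a b c : Quotient r} (h : Composes r a b c) : target c = target b := by
  obtain ⟨x, y, z, hxy, hyz, rfl, rfl, rfl⟩ := h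
  rfl

theorem composes_one_left (a : Quotient r) : Composes r (pointClass r (source a)) a a := by
  obtain ⟨x, y, h, rfl⟩ := exists_rep a
  exact (composes_pointClass_left h _ _).2 ⟨rfl, rfl⟩

theorem composes_one_right (a : Quotient r) : Composes r a (pointClass r (target a)) a := by
  obtain ⟨x, y, h, rfl⟩ := exists_rep a
  exact (composes_pointClass_right h _ _).2 ⟨rfl, rfl⟩

omit hr in
theorem composes_mk {x y z : P} (hxy : x ≤ y) (hyz : y ≤ z) : Composes r (Quotient.mk r (cl hxy))
    (Quotient.mk r (cl hyz)) (Quotient.mk r (cl (hxy.trans hyz))) :=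
  ⟨x, y, z, hxy, hyz, rfl, rfl, rfl⟩

/-- A factorization of the class of `[x,z]` comes from a unique point of `[x,z]`. -/
theorem Composes.existsUnique {a b : Quotient r} {x z : P} {hxz : x ≤ z}
    (h : Composes r a b (Quotient.mk r (cl hxz))) :
    ∃ (y : P) (h₁ : x ≤ y) (h₂ : y ≤ z), Quotient.mk r (cl h₁) = a ∧ Quotient.mk r (cl h₂) = b := by
  obtain ⟨x', y', z', h1, h2, rfl, rfl, e⟩ := h
  exact exists_split e h1 h2

/-- Otherwise the identity of [x,z] and the map that differs from it only by sending y to y' would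
be two self-maps compatible with the classes, against the uniqueness in the invariance axiom. -/
theorem eq_of_mk_eq {x y y' z : P} {h₁ : x ≤ y} {h₂ : y ≤ z} {h₁' : x ≤ y'} {h₂' : y' ≤ z}
    (e₁ : Quotient.mk r (cl h₁) = Quotient.mk r (cl h₁'))
    (e₂ : Quotient.mk r (cl h₂) = Quotient.mk r (cl h₂')) : y = y' := by
  classical
  set J : NonemptyInterval P := cl (h₁.trans h₂)
  obtain ⟨ι, -, huniq⟩ := hr.invariant J J (r.refl _)
  let u : Set.Icc J.fst J.snd := ⟨y, h₁, h₂⟩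
  let u' : Set.Icc J.fst J.snd := ⟨y', h₁', h₂'⟩
  have hid := huniq id rfl
  have hsw := huniq (Function.update id u u') (by
    ext1 z
    by_cases hz : z = u
    · subst hz
      simp only [Function.comp_apply, Function.update_self]
      exact Prod.ext e₁.symm e₂.symm
    · simp only [Function.comp_apply, Function.update_of_ne hz, id])
  have := congrFun (hid.trans hsw.symm) u
  rw [Function.update_self] at this
  exact congrArg Subtype.val this

/-- `c` is a composite of a class with `n` non-identities before it. -/
def Long (r : Setoid (NonemptyInterval P)) : ℕ → Quotient r → Prop
  | 0, _ => True
  | n + 1, c => ∃ a b, a ∉ Set.range (pointClass r) ∧ Composes r a b c ∧ Long r n b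

theorem mk_mem_range_iff {x y : P} {h : x ≤ y} :
    Quotient.mk r (cl h) ∈ Set.range (pointClass r) ↔ x = y := by
  constructor
  · rintro ⟨p, hp⟩
    induction p using Quotient.inductionOn with | h u =>
    exact eq_of_mk_eq_pure (u := u) hp.symm
  · rintro rfl
    exact ⟨Quotient.mk _ x, rfl⟩

omit hr in
theorem Long.mono {n : ℕ} : ∀ {c : Quotient r}, Long r (n + 1) c → Long r n c := by
  induction n with
  | zero => intros; trivial
  | succ n ih =>
    rintro c ⟨a, b, ha, hc, hb⟩
    exact ⟨a, b, ha, hc, ih hb⟩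

/-- Splitting off a non-identity moves the lower end point strictly up, which removes at least one
element from the finite interval. -/
theorem Long.card_lt [LocallyFiniteOrder P] {n : ℕ} : ∀ {x y : P} {h : x ≤ y},
    Long r n (Quotient.mk r (cl h)) → n < (Finset.Icc x y).card := by
  induction n with
  | zero =>
    intro x y h _
    exact Finset.card_pos.2 ⟨x, Finset.left_mem_Icc.2 h⟩
  | succ n ih =>
    rintro x y h ⟨a, b, ha, hc, hb⟩
    obtain ⟨z, h1, h2, rfl, rfl⟩ := hc.existsUnique
    rw [mk_mem_range_iff] at ha
    have := ih hb
    have h3 : Finset.Icc z y ⊂ Finset.Icc x y := by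
      refine Finset.ssubset_iff_of_subset (Finset.Icc_subset_Icc_left h1) |>.2
        ⟨x, Finset.left_mem_Icc.2 h, fun hx => ha (le_antisymm h1 (Finset.mem_Icc.1 hx).1)⟩
    have := Finset.card_lt_card h3
    omega

theorem Long.composes {m n : ℕ} : ∀ {a b c : Quotient r}, Long r m a → Long r n b →
    Composes r a b c → Long r (m + n) c := by
  induction m with
  | zero =>
    intro a b c _ hb hc
    rw [zero_add]
    cases n with
    | zero => trivial
    | succ n =>
      -- With no factors to take from a, it is absorbed into the first factor d of b; the composite
      -- of a and d is not an identity, because d is not.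
      obtain ⟨d, e, hd, hde, he⟩ := hb
      obtain ⟨f, hf, hfe⟩ := hde.assoc' hc
      refine ⟨f, e, ?_, hfe, he⟩
      rintro ⟨p, rfl⟩
      obtain ⟨x, y, z, hxy, hyz, rfl, rfl, h⟩ := hf
      have hxz := mk_mem_range_iff.1 ⟨p, h.symm⟩
      have : y = z := le_antisymm hyz (hxz ▸ hxy)
      exact hd (mk_mem_range_iff.2 this)
  | succ m ih =>
    rintro a b c ⟨d, e, hd, hde, he⟩ hb hc
    obtain ⟨f, hf, hfe⟩ := hde.assoc hc
    rw [Nat.add_right_comm]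
    exact ⟨d, f, hd, hfe, ih he hb hf⟩

/-- The maximal number of non-identities in a factorization. -/
noncomputable def length (a : Quotient r) : ℕ := sSup {n | Long r n a}

open Classical in
/-- The composite of two classes, if it exists. -/
noncomputable def comp? (a b : Quotient r) : Option (Quotient r) :=
  if h : ∃ c, Composes r a b c then some h.choose else none

theorem comp?_eq_some {a b c : Quotient r} : comp? a b = some c ↔ Composes r a b c := by
  unfold comp?
  constructor
  · intro h
    split_ifs at h with h'
    exact Option.some.inj h ▸ h'.choose_spec
  · intro h
    have h' : ∃ c, Composes r a b c := ⟨c, h⟩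
    rw [dif_pos h', h'.choose_spec.unique h]

variable [LocallyFiniteOrder P]

/-- The set of possible numbers of factors contains 0 and is bounded, so its supremum is attained
and the default value of `sSup` plays no role. -/
theorem long_iff {n : ℕ} {a : Quotient r} : Long r n a ↔ n ≤ length a := by
  have hb : BddAbove {n | Long r n a} := by
    obtain ⟨x, y, h, rfl⟩ := exists_rep a
    exact ⟨_, fun n hn => (Long.card_lt hn).le⟩
  constructor
  · intro h
    exact le_csSup hb h
  · intro h
    have : Long r (length a) a := Nat.sSup_mem (s := {n | Long r n a}) ⟨0, trivial⟩ hb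
    induction h using Nat.decreasingInduction with
    | of_succ m hm ih => exact ih.mono
    | self => exact this

theorem length_pointClass (p : Quotient (pointSetoid r)) : length (pointClass r p) = 0 := by
  by_contra h
  have h1 : Long r 1 (pointClass r p) := long_iff.2 (by omega)
  induction p using Quotient.inductionOn with | h x =>
  rw [pointClass_mk] at h1
  have := h1.card_lt
  simp at this

theorem eq_pointClass_of_length {a : Quotient r} (h : length a = 0) :
    a = pointClass r (source a) := by
  by_contra hne
  have : Long r 1 a := by
    refine ⟨a, _, ?_, composes_one_right a, trivial⟩
    rintro ⟨p, rfl⟩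
    rw [source_pointClass] at hne
    exact hne rfl
  rw [long_iff] at this
  omega

theorem length_ne_zero_iff {x y : P} {h : x ≤ y} : length (Quotient.mk r (cl h)) ≠ 0 ↔ x < y := by
  constructor
  · intro h1
    refine lt_of_le_of_ne h ?_
    rintro rfl
    exact h1 (length_pointClass (Quotient.mk _ x))
  · intro hlt h0
    have := eq_pointClass_of_length h0
    exact hlt.ne (mk_mem_range_iff.1 ⟨_, this.symm⟩)

theorem Composes.length_le {a b c : Quotient r} (h : Composes r a b c) :
    length a + length b ≤ length c :=
  long_iff.1 (Long.composes (long_iff.2 le_rfl) (long_iff.2 le_rfl) h)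

open Classical in
/-- The composite of two classes, if it exists and lengths add up. -/
noncomputable def mul? (a b : Quotient r) : Option (Quotient r) :=
  (comp? a b).filter fun c => length c = length a + length b

theorem mul?_eq_some {a b c : Quotient r} :
    mul? a b = some c ↔ Composes r a b c ∧ length c = length a + length b := by
  rw [mul?, Option.filter_eq_some_iff, comp?_eq_some, decide_eq_true_iff]

/-- Superadditivity of the length forces equality at each stage as soon as the length of the total
composite is the sum of the three lengths, whichever way the brackets are set. -/
theorem mul?_assoc (a b c : Quotient r) : (mul? a b).bind (fun x => mul? x c) =
    (mul? b c).bind (fun x => mul? a x) := by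
  ext e
  simp only [Option.bind_eq_some_iff, mul?_eq_some]
  constructor
  · rintro ⟨d, ⟨h1, h2⟩, h3, h4⟩
    obtain ⟨f, h5, h6⟩ := h1.assoc h3
    have := h5.length_le
    have := h6.length_le
    exact ⟨f, ⟨h5, by omega⟩, h6, by omega⟩
  · rintro ⟨d, ⟨h1, h2⟩, h3, h4⟩
    obtain ⟨f, h5, h6⟩ := h1.assoc' h3
    have := h5.length_le
    have := h6.length_le
    exact ⟨f, ⟨h5, by omega⟩, h6, by omega⟩

end ReducedIncidence

/-! ### Powers of the ideal and the path basis of the associated graded ring -/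

namespace ReducedIncidenceAlgebra

open ReducedIncidence

variable (k : Type u) [Field k] {P : Type v} [PartialOrder P] [LocallyFiniteOrder P]
  (r : Setoid (NonemptyInterval P)) [hr : Axioms r]

/-- The coordinates of an element of the reduced incidence algebra. -/
noncomputable def coeffs : ReducedIncidenceAlgebra k r ≃ₗ[k] (Quotient r →₀ k) := LinearEquiv.refl k _

omit [LocallyFiniteOrder P] in
theorem coeffs_ξ (a : Quotient r) : coeffs k r (ξ k r a) = Finsupp.single a 1 := rfl

variable {k r}

omit [LocallyFiniteOrder P] in
theorem eq_sum (f : ReducedIncidenceAlgebra k r) :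
    f = ∑ a ∈ (coeffs k r f).support, coeffs k r f a • ξ k r a := by
  apply (coeffs k r).injective
  simp only [map_sum, map_smul, coeffs_ξ, Finsupp.smul_single, smul_eq_mul, mul_one]
  exact (Finsupp.sum_single _).symm

variable (k r) in
/-- The elements supported on classes of length at least `d`. -/
noncomputable def longSpan (d : ℕ) : Submodule k (ReducedIncidenceAlgebra k r) :=
  (Finsupp.supported k k {a | d ≤ length a}).comap (coeffs k r).toLinearMap

theorem mem_longSpan {d : ℕ} {f : ReducedIncidenceAlgebra k r} :
    f ∈ longSpan k r d ↔ ∀ a, coeffs k r f a ≠ 0 → d ≤ length a := by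
  change coeffs k r f ∈ Finsupp.supported k k {a | d ≤ length a} ↔ _
  simp [Finsupp.mem_supported, Set.subset_def]

theorem ξ_mem_longSpan {d : ℕ} {a : Quotient r} (h : d ≤ length a) : ξ k r a ∈ longSpan k r d := by
  classical
  rw [mem_longSpan]
  intro b hb
  rw [coeffs_ξ, Finsupp.single_apply] at hb
  split_ifs at hb with e
  · exact e ▸ h
  · exact absurd rfl hb

theorem smul_coeff_mem {d : ℕ} {f : ReducedIncidenceAlgebra k r} (hf : f ∈ longSpan k r d)
    (a : Quotient r) : coeffs k r f a • ξ k r a ∈ longSpan k r d := by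
  by_cases h : coeffs k r f a = 0
  · rw [h, zero_smul]; exact zero_mem _
  · exact Submodule.smul_mem _ _ (ξ_mem_longSpan (mem_longSpan.1 hf a h))

theorem mem_of_longSpan {d : ℕ} {N : Type*} [AddCommGroup N]
    (T : ReducedIncidenceAlgebra k r →+ N) (K : AddSubgroup N)
    (h : ∀ (a : Quotient r) (c : k), d ≤ length a → T (c • ξ k r a) ∈ K)
    {f : ReducedIncidenceAlgebra k r}
    (hf : f ∈ longSpan k r d) : T f ∈ K := by
  rw [eq_sum f, map_sum]
  exact sum_mem fun a ha => h a _ (mem_longSpan.1 hf a (Finsupp.mem_support_iff.1 ha))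

variable (k r) in
theorem mem_properIdeal_iff {f : ReducedIncidenceAlgebra k r} :
    f ∈ properIdeal k r ↔ f ∈ longSpan k r 1 := by
  change f ∈ properSpan k r ↔ _
  constructor
  · intro h
    refine (Submodule.span_le (p := longSpan k r 1)).2 ?_ h
    rintro _ ⟨x, y, hxy, rfl⟩
    exact ξ_mem_longSpan (Nat.one_le_iff_ne_zero.2 (length_ne_zero_iff.2 hxy))
  · intro h
    refine mem_of_longSpan (AddMonoidHom.id _) (properSpan k r).toAddSubgroup (fun a c ha => ?_) h
    obtain ⟨x, y, hxy, rfl⟩ := exists_rep a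
    refine Submodule.smul_mem _ c (Submodule.subset_span ⟨x, y, ?_, rfl⟩)
    exact length_ne_zero_iff.1 (Nat.one_le_iff_ne_zero.1 ha)

theorem ξ_mul_ξ_comp (a b : Quotient r) :
    ξ k r a * ξ k r b = (comp? a b).elim 0 fun c => ξ k r c := by
  rw [ξ_mul_ξ]
  cases h : comp? a b with
  | some c => rw [basisMul_of_composes k r (comp?_eq_some.1 h)]; rfl
  | none =>
    rw [basisMul_of_not]; · rfl
    rintro ⟨c, hc⟩
    rw [comp?_eq_some.2 hc] at h
    exact absurd h (by simp)

theorem smul_ξ_mul_smul_ξ (a b : Quotient r) (c d : k) :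
    (c • ξ k r a) * (d • ξ k r b) = (comp? a b).elim 0 fun e => (c * d) • ξ k r e := by
  rw [smul_mul_smul_comm, ξ_mul_ξ_comp]
  cases comp? a b <;> simp

theorem mul_mem_longSpan {d e : ℕ} {f g : ReducedIncidenceAlgebra k r} (hf : f ∈ longSpan k r d)
    (hg : g ∈ longSpan k r e) : f * g ∈ longSpan k r (d + e) := by
  refine mem_of_longSpan (AddMonoidHom.mulRight g) (longSpan k r (d + e)).toAddSubgroup
    (fun a c ha => ?_) hf
  refine mem_of_longSpan (AddMonoidHom.mulLeft (c • ξ k r a)) (longSpan k r (d + e)).toAddSubgroup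
    (fun b c' hb => ?_) hg
  change (c • ξ k r a) * (c' • ξ k r b) ∈ longSpan k r (d + e)
  rw [smul_ξ_mul_smul_ξ]
  cases h : comp? a b with
  | none => exact zero_mem _
  | some x =>
    have := (comp?_eq_some.1 h).length_le
    exact Submodule.smul_mem _ _ (ξ_mem_longSpan (by omega))

-- Products of long classes are long by superadditivity. Conversely a class of length at least d + 1
-- splits as a non-identity followed by a class of length at least d, which exhibits its basis
-- vector as a product.
variable (k r) in
theorem mem_pow_iff (d : ℕ) {f : ReducedIncidenceAlgebra k r} :
    f ∈ properIdeal k r ^ d ↔ f ∈ longSpan k r d := by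
  induction d generalizing f with
  | zero =>
    rw [Submodule.pow_zero, Ideal.one_eq_top, mem_longSpan]
    simp
  | succ d ih =>
    rw [add_comm, Ideal.IsTwoSided.pow_add, Submodule.pow_one]
    constructor
    · intro h
      refine Submodule.mul_induction_on h (fun x hx y hy => ?_) fun x y hx hy => add_mem hx hy
      rw [mem_properIdeal_iff] at hx
      exact mul_mem_longSpan hx (ih.1 hy)
    · intro h
      refine mem_of_longSpan (AddMonoidHom.id _)
        (properIdeal k r * properIdeal k r ^ d).toAddSubgroup (fun a c ha => ?_) h
      rw [add_comm, ← long_iff] at ha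
      obtain ⟨b, e, hb, hbe, he⟩ := ha
      have : c • ξ k r a = ξ k r b * c • ξ k r e := by
        have := smul_ξ_mul_smul_ξ b e (1 : k) c
        rw [one_smul, one_mul, comp?_eq_some.2 hbe] at this
        exact this.symm
      change c • ξ k r a ∈ properIdeal k r * properIdeal k r ^ d
      rw [this]
      refine Ideal.mul_mem_mul ?_ ?_
      · rw [mem_properIdeal_iff]
        refine ξ_mem_longSpan (Nat.one_le_iff_ne_zero.2 fun h0 => hb ?_)
        exact ⟨_, (eq_pointClass_of_length h0).symm⟩
      · rw [ih]
        exact Submodule.smul_mem _ _ (ξ_mem_longSpan (long_iff.1 he))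

variable (k r)

theorem mem_adicFiltration_iff (d : ℕ) {f : ReducedIncidenceAlgebra k r} :
    f ∈ adicFiltration (properIdeal k r) d ↔ f ∈ longSpan k r d := mem_pow_iff k r d

/-- The multiples of `ξ a` in the associated graded ring. -/
noncomputable def grMon (a : Quotient r) : k →+ GrRing (properIdeal k r) :=
  (AssocGr.mk (adicFiltration (properIdeal k r)) (length a)).comp
    (AddMonoidHom.mk' (fun c => ⟨c • ξ k r a, (mem_adicFiltration_iff k r _).2
      (Submodule.smul_mem _ c (ξ_mem_longSpan le_rfl))⟩) fun c d => Subtype.ext (add_smul c d _))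

theorem grMon_eq {a : Quotient r} {d : ℕ} (h : length a = d) (c : k)
    (hm : c • ξ k r a ∈ adicFiltration (properIdeal k r) d) :
    grMon k r a c = AssocGr.mk (adicFiltration (properIdeal k r)) d ⟨c • ξ k r a, hm⟩ := by
  subst h; rfl

/-- The coordinates of an element of the associated graded ring. -/
noncomputable def grCoeff : GrRing (properIdeal k r) →+ (Quotient r →₀ k) :=
  AssocGr.lift _ (fun d => ((Finsupp.filterAddHom fun a => length a = d).comp
      (coeffs k r).toLinearMap.toAddMonoidHom).comp (adicFiltration (properIdeal k r) d).subtype)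
    fun d x hx hx' => by
      rw [mem_adicFiltration_iff, mem_longSpan] at hx'
      ext a
      change Finsupp.filter (fun a => length a = d) (coeffs k r x) a = 0
      rw [Finsupp.filter_apply]
      split_ifs with h
      · by_contra hne
        have := hx' a hne
        omega
      · rfl

theorem grCoeff_mk (d : ℕ) (x : ReducedIncidenceAlgebra k r)
    (hx : x ∈ adicFiltration (properIdeal k r) d) :
    grCoeff k r (AssocGr.mk _ d ⟨x, hx⟩) =
      Finsupp.filter (fun a => length a = d) (coeffs k r x) :=
  AssocGr.lift_mk _ _ _ _ _

theorem mk_eq_sum (d : ℕ) (x : ReducedIncidenceAlgebra k r)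
    (hx : x ∈ adicFiltration (properIdeal k r) d) :
    AssocGr.mk _ d ⟨x, hx⟩ = ∑ a ∈ (coeffs k r x).support with length a = d,
      grMon k r a (coeffs k r x a) := by
  have hm : ∀ a, coeffs k r x a • ξ k r a ∈ adicFiltration (properIdeal k r) d := fun a =>
    (mem_adicFiltration_iff k r d).2 (smul_coeff_mem ((mem_adicFiltration_iff k r d).1 hx) a)
  have e : (⟨x, hx⟩ : adicFiltration (properIdeal k r) d) =
      ∑ a ∈ (coeffs k r x).support, ⟨coeffs k r x a • ξ k r a, hm a⟩ := by
    refine Subtype.ext ?_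
    rw [AddSubmonoidClass.coe_finsetSum]
    exact eq_sum x
  rw [e, map_sum, Finset.sum_filter]
  refine Finset.sum_congr rfl fun a ha => ?_
  split_ifs with h
  · exact (grMon_eq k r h _ _).symm
  · refine AssocGr.mk_eq_zero _ ((mem_adicFiltration_iff k r _).2 (Submodule.smul_mem _ _
      (ξ_mem_longSpan ?_)))
    have := mem_longSpan.1 ((mem_adicFiltration_iff k r d).1 hx) a (Finsupp.mem_support_iff.1 ha)
    omega

/-- If the composite exists but is longer than the sum of the lengths, it lies in the next power of
the ideal, so its class in the expected degree is zero. This is why `mul?` discards it. -/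
theorem grMon_mul (a b : Quotient r) (c d : k) : grMon k r a c * grMon k r b d =
    (mul? a b).elim 0 fun g => grMon k r g (c * d) := by
  have h := AssocGr.pairing_mk _ _ _ AddMonoidHom.mul (adicFiltration_mul (properIdeal k r))
    (length a) (length b) (c • ξ k r a) ((mem_adicFiltration_iff k r _).2
      (Submodule.smul_mem _ c (ξ_mem_longSpan le_rfl))) (d • ξ k r b)
      ((mem_adicFiltration_iff k r _).2 (Submodule.smul_mem _ d (ξ_mem_longSpan le_rfl)))
  refine h.trans ?_
  have e : (AddMonoidHom.mul (c • ξ k r a)) (d • ξ k r b) =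
    (comp? a b).elim 0 fun e => (c * d) • ξ k r e := smul_ξ_mul_smul_ξ a b c d
  cases hab : comp? a b with
  | none =>
    rw [hab] at e
    have : mul? a b = none := by rw [mul?, hab]; rfl
    rw [this]
    refine AssocGr.mk_eq_zero _ ?_
    rw [e]
    exact zero_mem _
  | some g =>
    rw [hab] at e
    have hc := comp?_eq_some.1 hab
    by_cases hl : length g = length a + length b
    · rw [mul?_eq_some.2 ⟨hc, hl⟩, Option.elim_some]
      have hm : (c * d) • ξ k r g ∈ adicFiltration (properIdeal k r) (length a + length b) :=
        (mem_adicFiltration_iff k r _).2 (Submodule.smul_mem _ _ (ξ_mem_longSpan hl.ge))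
      rw [grMon_eq k r hl _ hm]
      exact AssocGr.mk_congr rfl e _ _
    · have : mul? a b = none := by
        cases h' : mul? a b with
        | none => rfl
        | some g' =>
          obtain ⟨h1, h2⟩ := mul?_eq_some.1 h'
          rw [h1.unique hc] at h2
          exact absurd h2 hl
      rw [this]
      refine AssocGr.mk_eq_zero _ ?_
      rw [e, mem_adicFiltration_iff]
      have := hc.length_le
      exact Submodule.smul_mem _ _ (ξ_mem_longSpan (by omega))

attribute [local instance] pointFintype in
theorem grOne_eq : (1 : GrRing (properIdeal k r)) =
    ∑ p, grMon k r (pointClass r p) 1 := by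
  have hm : ∀ p, (1 : k) • ξ k r (pointClass r p) ∈ adicFiltration (properIdeal k r) 0 := fun p =>
    (mem_adicFiltration_iff k r _).2 (Submodule.smul_mem _ _ (ξ_mem_longSpan (Nat.zero_le _)))
  have h1 : (1 : ReducedIncidenceAlgebra k r) ∈ adicFiltration (properIdeal k r) 0 :=
    (mem_adicFiltration_iff k r _).2 (mem_longSpan.2 fun _ _ => Nat.zero_le _)
  have e : (⟨1, h1⟩ : adicFiltration (properIdeal k r) 0) =
      ∑ p, ⟨(1 : k) • ξ k r (pointClass r p), hm p⟩ := by
    refine Subtype.ext ?_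
    rw [AddSubmonoidClass.coe_finsetSum]
    simp only [one_smul]
    rfl
  change AssocGr.mk _ 0 ⟨1, h1⟩ = _
  rw [e, map_sum]
  exact Finset.sum_congr rfl fun p _ => (grMon_eq k r (length_pointClass p) _ _).symm

attribute [local instance] pointFintype in
/-- The basis of the associated graded ring of the reduced incidence algebra. -/
noncomputable def grBasis : PathBasis k (GrRing (properIdeal k r)) (Quotient (pointSetoid r))
    (Quotient r) where
  src := source
  tgt := target
  one := pointClass r
  len := length
  mul := mul?
  src_one := source_pointClass
  tgt_one := target_pointClass
  len_one := length_pointClass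
  eq_one _ := eq_pointClass_of_length
  mul_some a b c h := by
    obtain ⟨h1, h2⟩ := mul?_eq_some.1 h
    exact ⟨h1.target_eq, h1.source, h1.target, h2⟩
  assoc := mul?_assoc
  one_mul a := mul?_eq_some.2 ⟨composes_one_left a, by rw [length_pointClass, zero_add]⟩
  mul_one a := mul?_eq_some.2 ⟨composes_one_right a, by rw [length_pointClass, add_zero]⟩
  mon := grMon k r
  coef := grCoeff k r
  coef_mon a c := by
    refine (grCoeff_mk k r _ _ _).trans ?_
    have : coeffs k r (c • ξ k r a) = Finsupp.single a c := by
      rw [map_smul, coeffs_ξ, Finsupp.smul_single, smul_eq_mul, mul_one]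
    rw [this, Finsupp.filter_single_of_pos]
    rfl
  sum_coef x := by
    induction x using AssocGr.induction with
    | zero => simp
    | hadd x y hx hy => rw [map_add, map_add, hx, hy]
    | hmk d x hx =>
      rw [grCoeff_mk, mk_eq_sum, Finsupp.liftAddHom_apply, Finsupp.sum, Finsupp.support_filter]
      refine Finset.sum_congr rfl fun a ha => ?_
      rw [Finsupp.filter_apply_pos (fun a => length a = d) _ (Finset.mem_filter.1 ha).2]
  mon_mul := grMon_mul k r
  one_eq := grOne_eq k r

attribute [local instance] pointFintype in
theorem component_eq_deg :
    AssocGr.component (adicFiltration (properIdeal k r)) = (grBasis k r).deg := by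
  ext d x
  constructor
  · rintro ⟨⟨x, hx⟩, rfl⟩ a ha
    change grCoeff k r _ a ≠ 0 at ha
    rw [grCoeff_mk, Finsupp.filter_apply] at ha
    by_contra h
    change ¬ length a = d at h
    rw [if_neg h] at ha
    exact ha rfl
  · intro hx
    refine PathBasis.map_deg_mem (β := grBasis k r) (AddMonoidHom.id _) _ (fun a c ha => ?_) hx
    change grMon k r a c ∈ _
    subst ha
    exact ⟨_, rfl⟩

end ReducedIncidenceAlgebra

/-! ### The semisimple part, the module A/I, and Koszulness through lists -/

section

open MulOpposite

theorem AssocGr.mk_eq_zero_iff {M : Type u} [AddCommGroup M] {F : ℕ → AddSubgroup M} {d : ℕ} {x : M}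
    (hx : x ∈ F d) : AssocGr.mk F d ⟨x, hx⟩ = 0 ↔ x ∈ F (d + 1) := by
  refine ⟨fun h => ?_, AssocGr.mk_eq_zero hx⟩
  have h1 : DirectSum.of (fun d => F d ⧸ (F (d + 1)).addSubgroupOf (F d)) d
      (QuotientAddGroup.mk' _ ⟨x, hx⟩) = 0 := h
  have h2 := (injective_iff_map_eq_zero _).1 (DirectSum.of_injective d) _ h1
  exact (QuotientAddGroup.eq_zero_iff (⟨x, hx⟩ : F d)).1 h2

theorem isInternal_of_concentrated {M : Type*} [AddCommGroup M] {ℳ : ℤ → AddSubgroup M}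
    (h0 : ℳ 0 = ⊤) (hne : ∀ j, j ≠ 0 → ℳ j = ⊥) : DirectSum.IsInternal ℳ := by
  refine isInternal_of_proj (fun j => if j = 0 then AddMonoidHom.id M else 0) ?_ ?_ ?_
  · intro j m hm
    split_ifs with h
    · rfl
    · rw [hne j h, AddSubgroup.mem_bot] at hm
      rw [hm, map_zero]
  · intro i j hij m hm
    split_ifs with h
    · rw [hne i (by omega), AddSubgroup.mem_bot] at hm
      rw [hm, map_zero]
    · rfl
  · intro K hK
    rw [eq_top_iff, ← h0]
    exact hK 0

theorem PathBasis.VertexModule.graded {k : Type u} [Field k] {R : Type w} [Ring R] {O Q : Type v}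
    [Fintype O] {β : PathBasis k R O Q} {M : Type*} [AddCommGroup M] [Module Rᵐᵒᵖ M]
    {ℳ : ℤ → AddSubgroup M} (V : VertexModule β ℳ) : IsGradedRightModule β.deg ℳ := by
  refine ⟨isInternal_of_concentrated V.zero_eq V.ne_eq, fun j d m hm r hr => ?_⟩
  by_cases hj : j = 0
  · subst hj
    obtain rfl | hd := Nat.eq_zero_or_pos d
    · rw [Nat.cast_zero, add_zero, V.zero_eq]; trivial
    · refine PathBasis.map_deg_mem (β := β)
        (AddMonoidHom.mk' (fun r => op r • m) fun r s => by rw [op_add, add_smul]) _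
        (fun a c ha => ?_) hr
      change op (β.mon a c) • m ∈ _
      rw [← mon_one_mul_mon, op_mul, mul_smul]
      have := V.act_pos a (op (β.mon (β.one (β.src a)) c) • m) (by omega)
      rw [act_apply] at this
      rw [this]
      exact zero_mem _
  · rw [V.ne_eq j hj, AddSubgroup.mem_bot] at hm
    rw [hm, smul_zero]
    exact zero_mem _

namespace ReducedIncidenceAlgebra

open ReducedIncidence

variable (k : Type u) [Field k] {P : Type v} [PartialOrder P] [LocallyFiniteOrder P]
  (r : Setoid (NonemptyInterval P)) [hr : Axioms r]

attribute [local instance] pointFintype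

section Semisimple

omit [LocallyFiniteOrder P] in
theorem ξ_pointClass_mul (p q : Quotient (pointSetoid r)) [Decidable (p = q)] :
    ξ k r (pointClass r p) * ξ k r (pointClass r q) =
      if p = q then ξ k r (pointClass r p) else 0 := by
  rw [ξ_mul_ξ]
  split_ifs with h
  · subst h
    refine basisMul_of_composes k r ?_
    simpa [source_pointClass] using composes_one_left (pointClass r p)
  · refine basisMul_of_not k r fun ⟨c, hc⟩ => h ?_
    have := hc.target_eq
    rwa [target_pointClass, source_pointClass] at this

/-- The functions on the vertices, as elements of the algebra. -/
noncomputable def vertexHom : (Quotient (pointSetoid r) → k) →+* degreeZero k r :=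
  RingHom.codRestrict
    { toFun := fun φ => ∑ p, φ p • ξ k r (pointClass r p)
      map_one' := by simp only [Pi.one_apply, one_smul]; rfl
      map_zero' := by simp
      map_add' := fun φ ψ => by simp [add_smul, Finset.sum_add_distrib]
      map_mul' := fun φ ψ => by
        classical
        rw [Finset.sum_mul_sum]
        refine Finset.sum_congr rfl fun p _ => ?_
        rw [Finset.sum_eq_single p]
        · rw [smul_mul_smul_comm, ξ_pointClass_mul, if_pos rfl]; rfl
        · intro q _ hq
          rw [smul_mul_smul_comm, ξ_pointClass_mul, if_neg hq.symm, smul_zero]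
        · simp }
    (degreeZero k r) fun φ => by
      refine (degreeZeroSpan k r).sum_mem fun p _ => (degreeZeroSpan k r).smul_mem _ ?_
      induction p using Quotient.inductionOn with | h x =>
      exact Submodule.subset_span ⟨x, rfl⟩

theorem vertexHom_surjective : Function.Surjective (vertexHom k r) := by
  rintro ⟨f, hf⟩
  suffices h : ∃ φ : Quotient (pointSetoid r) → k, ∑ p, φ p • ξ k r (pointClass r p) = f by
    obtain ⟨φ, h⟩ := h
    exact ⟨φ, Subtype.ext h⟩
  change f ∈ degreeZeroSpan k r at hf
  unfold degreeZeroSpan at hf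
  induction hf using Submodule.span_induction with
  | zero => exact ⟨0, by simp⟩
  | add x y _ _ hx hy =>
    obtain ⟨φ, rfl⟩ := hx
    obtain ⟨ψ, rfl⟩ := hy
    exact ⟨φ + ψ, by simp [add_smul, Finset.sum_add_distrib]⟩
  | smul c x _ hx =>
    obtain ⟨φ, rfl⟩ := hx
    exact ⟨c • φ, by simp [Finset.smul_sum, smul_smul]⟩
  | mem x hx =>
    classical
    obtain ⟨x, rfl⟩ := hx
    refine ⟨Pi.single (Quotient.mk _ x) 1, ?_⟩
    rw [Finset.sum_eq_single (Quotient.mk _ x)]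
    · rw [Pi.single_eq_same, one_smul]; rfl
    · intro q _ hq
      rw [Pi.single_eq_of_ne hq, zero_smul]
    · simp

/-- The ring is a quotient of a finite product of copies of k; finiteness of the set of vertex
classes is used here. -/
theorem degreeZero_isSemisimpleRing : IsSemisimpleRing (degreeZero k r) :=
  RingHom.isSemisimpleRing_of_surjective (vertexHom k r) (vertexHom_surjective k r)

theorem isCompl_degreeZero :
    IsCompl (degreeZero k r).toAddSubgroup (properIdeal k r).toAddSubgroup := by
  constructor
  · rw [disjoint_iff, eq_bot_iff]
    rintro f ⟨h0, h1⟩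
    have h1' : f ∈ longSpan k r 1 := (mem_properIdeal_iff k r).1 h1
    have h0' : f ∈ (Finsupp.supported k k {a | length a = 0}).comap (coeffs k r).toLinearMap := by
      refine (Submodule.span_le (p := (Finsupp.supported k k {a | length a = 0}).comap
        (coeffs k r).toLinearMap)).2 ?_ (show f ∈ degreeZeroSpan k r from h0)
      rintro _ ⟨x, rfl⟩
      exact Finsupp.single_mem_supported k _ (length_pointClass (Quotient.mk _ x))
    rw [AddSubgroup.mem_bot]
    apply (coeffs k r).injective
    rw [map_zero]
    ext a
    by_contra hne
    have := mem_longSpan.1 h1' a hne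
    have h2 : length a = 0 := h0' (Finsupp.mem_support_iff.2 hne)
    omega
  · rw [codisjoint_iff, eq_top_iff]
    intro f _
    have hf : f ∈ longSpan k r 0 := mem_longSpan.2 fun _ _ => Nat.zero_le _
    refine mem_of_longSpan (AddMonoidHom.id _) _ (fun a c _ => ?_) hf
    by_cases h : length a = 0
    · refine AddSubgroup.mem_sup_left (show c • ξ k r a ∈ degreeZeroSpan k r from ?_)
      refine Submodule.smul_mem _ _ ?_
      rw [eq_pointClass_of_length h]
      induction source a using Quotient.inductionOn with | h x =>
      exact Submodule.subset_span ⟨x, rfl⟩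
    · refine AddSubgroup.mem_sup_right (show c • ξ k r a ∈ properIdeal k r from ?_)
      rw [mem_properIdeal_iff]
      exact Submodule.smul_mem _ _ (ξ_mem_longSpan (by omega))

end Semisimple

section Residue

attribute [local instance] quotientRightModule

/-- The filtration of the right module `A / I`. -/
noncomputable abbrev resFiltration (d : ℕ) :
    AddSubgroup (ReducedIncidenceAlgebra k r ⧸ properIdeal k r) :=
  adicModuleFiltration (properIdeal k r) (ReducedIncidenceAlgebra k r ⧸ properIdeal k r) d

/-- The residue class of an element. -/
noncomputable abbrev res :
    ReducedIncidenceAlgebra k r →+* ReducedIncidenceAlgebra k r ⧸ properIdeal k r :=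
  Ideal.Quotient.mk (properIdeal k r)

theorem op_smul_res (f g : ReducedIncidenceAlgebra k r) : op f • res k r g = res k r (g * f) := rfl

theorem resFiltration_zero : resFiltration k r 0 = ⊤ := by
  rw [eq_top_iff]
  intro x _
  refine AddSubgroup.subset_closure ⟨x, 1, ?_, ?_⟩
  · rw [Submodule.pow_zero, Ideal.one_eq_top]; trivial
  · rw [op_one, one_smul]

theorem resFiltration_ne {d : ℕ} (hd : d ≠ 0) : resFiltration k r d = ⊥ := by
  rw [eq_bot_iff, resFiltration, adicModuleFiltration, AddSubgroup.closure_le]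
  rintro _ ⟨m, a, ha, rfl⟩
  obtain ⟨g, rfl⟩ := Ideal.Quotient.mk_surjective m
  have ha' : a ∈ properIdeal k r := Ideal.pow_le_self hd ha
  refine (Ideal.Quotient.eq_zero_iff_mem).2 ?_
  exact (properIdeal k r).mul_mem_left g ha'

theorem res_mem (f : ReducedIncidenceAlgebra k r) : res k r f ∈ resFiltration k r 0 := by
  rw [resFiltration_zero]; trivial

theorem mk_res_ne {d : ℕ} (hd : d ≠ 0) {m} (hm : m ∈ resFiltration k r d) :
    AssocGr.mk (resFiltration k r) d ⟨m, hm⟩ = 0 := by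
  refine AssocGr.mk_eq_zero hm ?_
  have : m = 0 := by
    have := hm
    rwa [resFiltration_ne k r hd, AddSubgroup.mem_bot] at this
  rw [this]
  exact zero_mem _

/-- The multiples of the class of a vertex in the associated graded module of `A / I`. -/
noncomputable def vertexClass (p : Quotient (pointSetoid r)) :
    k →+ GrModule (properIdeal k r) (ReducedIncidenceAlgebra k r ⧸ properIdeal k r) :=
  (AssocGr.mk (resFiltration k r) 0).comp
    (AddMonoidHom.mk' (fun c => ⟨res k r (c • ξ k r (pointClass r p)), res_mem k r _⟩)
      fun c d => Subtype.ext ((congrArg (res k r) (add_smul c d _)).trans (map_add _ _ _)))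

theorem op_grMon_smul_mk (a : Quotient r) (d : ℕ)
    (m : ReducedIncidenceAlgebra k r ⧸ properIdeal k r) (hm : m ∈ resFiltration k r d)
    (hm' : op ((1 : k) • ξ k r a) • m ∈ resFiltration k r (d + length a)) :
    (grBasis k r).act _ a (AssocGr.mk (resFiltration k r) d ⟨m, hm⟩) =
      AssocGr.mk (resFiltration k r) (d + length a) ⟨op ((1 : k) • ξ k r a) • m, hm'⟩ :=
  AssocGr.pairing_mk _ _ _ _ (adicModuleFiltration_smul (properIdeal k r) _) _ _ _ _ _ _

theorem act_mk (a : Quotient r) (d : ℕ)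
    (m : ReducedIncidenceAlgebra k r ⧸ properIdeal k r) (hm : m ∈ resFiltration k r d) :
    ∃ hm' : op ((1 : k) • ξ k r a) • m ∈ resFiltration k r (d + length a),
    (grBasis k r).act _ a (AssocGr.mk (resFiltration k r) d ⟨m, hm⟩) =
      AssocGr.mk (resFiltration k r) (d + length a) ⟨op ((1 : k) • ξ k r a) • m, hm'⟩ := by
  have hm' : op ((1 : k) • ξ k r a) • m ∈ resFiltration k r (d + length a) :=
    adicModuleFiltration_smul (properIdeal k r) _ d (length a) m hm _
      ((mem_adicFiltration_iff k r _).2 (Submodule.smul_mem _ _ (ξ_mem_longSpan le_rfl)))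
  exact ⟨hm', op_grMon_smul_mk k r a d m hm hm'⟩

theorem act_pointClass_res (p : Quotient (pointSetoid r)) (f : ReducedIncidenceAlgebra k r) :
    (grBasis k r).act _ (pointClass r p) (AssocGr.mk (resFiltration k r) 0 ⟨res k r f, res_mem k r f⟩)
      = AssocGr.mk (resFiltration k r) 0
        ⟨res k r (f * (1 : k) • ξ k r (pointClass r p)), res_mem k r _⟩ := by
  obtain ⟨hm', e⟩ := act_mk k r (pointClass r p) 0 _ (res_mem k r f)
  rw [e]
  exact AssocGr.mk_congr (by rw [length_pointClass]) (op_smul_res k r _ _) _ _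

/-- The associated graded module of `A / I` is one-dimensional at each vertex. -/
noncomputable def residueVertexModule : PathBasis.VertexModule (grBasis k r)
    (AssocGr.intComponent (resFiltration k r)) where
  κ := vertexClass k r
  inj p := by
    rw [injective_iff_map_eq_zero]
    intro c hc
    -- The next filtration step of A/I is zero, so the representative lies in I, where no class of
    -- length zero can occur.
    have h1 := (AssocGr.mk_eq_zero_iff (res_mem k r _)).1 hc
    rw [resFiltration_ne k r (by omega), AddSubgroup.mem_bot, Ideal.Quotient.eq_zero_iff_mem,
      mem_properIdeal_iff, mem_longSpan] at h1
    by_contra hne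
    have := h1 (pointClass r p) (by
      rw [map_smul, coeffs_ξ, Finsupp.smul_single, smul_eq_mul, mul_one, Finsupp.single_eq_same]
      exact hne)
    rw [length_pointClass] at this
    omega
  act_one p c := by
    classical
    refine (act_pointClass_res k r p _).trans ?_
    refine AssocGr.mk_congr rfl ?_ _ _
    rw [smul_mul_smul_comm, ξ_pointClass_mul, if_pos rfl, mul_one]
  exists_eq p m hm := by
    change m ∈ (vertexClass k r p).range
    rw [← hm]
    clear hm
    induction m using AssocGr.induction with
    | zero => rw [map_zero]; exact zero_mem _
    | hadd x y hx hy => rw [map_add]; exact add_mem hx hy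
    | hmk d x hx =>
      obtain rfl | hd := Nat.eq_zero_or_pos d
      · obtain ⟨f, rfl⟩ := Ideal.Quotient.mk_surjective x
        have hf : f ∈ longSpan k r 0 := mem_longSpan.2 fun _ _ => Nat.zero_le _
        let T : ReducedIncidenceAlgebra k r →+ _ := ((grBasis k r).act _ (pointClass r p)).comp
          ((AssocGr.mk (resFiltration k r) 0).comp
            ((res k r).toAddMonoidHom.codRestrict (resFiltration k r 0) (res_mem k r)))
        refine mem_of_longSpan T (vertexClass k r p).range (fun a c _ => ?_) hf
        change (grBasis k r).act _ (pointClass r p) (AssocGr.mk (resFiltration k r) 0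
          ⟨res k r (c • ξ k r a), res_mem k r _⟩) ∈ _
        rw [act_pointClass_res]
        by_cases ha : length a = 0
        · classical
          rw [eq_pointClass_of_length ha]
          by_cases hp : source a = p
          · refine ⟨c, ?_⟩
            refine AssocGr.mk_congr rfl ?_ _ _
            rw [hp, smul_mul_smul_comm, ξ_pointClass_mul, if_pos rfl, mul_one]
          · rw [AssocGr.mk_eq_zero]
            · exact zero_mem _
            · rw [smul_mul_smul_comm, ξ_pointClass_mul, if_neg hp, smul_zero, map_zero]
              exact zero_mem _
        · rw [AssocGr.mk_eq_zero]
          · exact zero_mem _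
          · have : c • ξ k r a * (1 : k) • ξ k r (pointClass r p) ∈ properIdeal k r := by
              refine mul_mem_properSpan_right k r _ _ ?_
              change _ ∈ properIdeal k r
              rw [mem_properIdeal_iff]
              exact Submodule.smul_mem _ _ (ξ_mem_longSpan (by omega))
            rw [Ideal.Quotient.eq_zero_iff_mem.2 this]
            exact zero_mem _
      · rw [mk_res_ne k r hd.ne', map_zero]; exact zero_mem _
  act_pos a m ha := by
    induction m using AssocGr.induction with
    | zero => rw [map_zero]
    | hadd x y hx hy => rw [map_add, hx, hy, add_zero]
    | hmk d x hx =>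
      obtain ⟨hm', e⟩ := act_mk k r a d x hx
      refine e.trans (mk_res_ne k r ?_ hm')
      change length a ≠ 0 at ha
      omega
  zero_eq := by
    rw [eq_top_iff]
    intro m _
    change m ∈ (AssocGr.mk (resFiltration k r) 0).range
    induction m using AssocGr.induction with
    | zero => exact zero_mem _
    | hadd x y hx hy => exact add_mem (hx trivial) (hy trivial)
    | hmk d x hx =>
      obtain rfl | hd := Nat.eq_zero_or_pos d
      · exact ⟨_, rfl⟩
      · rw [mk_res_ne k r hd.ne']; exact zero_mem _
  ne_eq j hj := by
    obtain d | d := j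
    · rw [eq_bot_iff]
      rintro _ ⟨⟨x, hx⟩, rfl⟩
      rw [AddSubgroup.mem_bot]
      exact mk_res_ne k r (by rintro rfl; exact hj rfl) hx
    · rfl

/-- Semisimplicity and complementarity hold for every such algebra, so only the Koszulness of the
graded module of A/I is a condition. -/
theorem isNongradedKoszulRing_iff :
    IsNongradedKoszulRing (degreeZero k r) (properIdeal k r) ↔
      ∀ i p : ℕ, i + 1 < p → (grBasis k r).ListExactAt (i + 1) p := by
  rw [IsNongradedKoszulRing, IsNongradedKoszulModule]
  refine (and_iff_right (degreeZero_isSemisimpleRing k r)).trans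
    ((and_iff_right (isCompl_degreeZero k r)).trans ?_)
  rw [component_eq_deg]
  exact (PathBasis.isKoszulModule_iff (residueVertexModule k r).ne_eq
    (residueVertexModule k r).graded).trans (residueVertexModule k r).exactAt_iff

end Residue

end ReducedIncidenceAlgebra

end

/-! ### Complexes with a basis: truncation, transport, splitting, contracting homotopies -/

namespace Finsupp

variable {k : Type u} [Field k] {ι κ : Type*}

/-- The part of a finitely supported function on a set. -/
noncomputable def keep (k : Type u) [Field k] (A : Set ι) : (ι →₀ k) →ₗ[k] (ι →₀ k) := by
  classical exact (supported k k A).subtype ∘ₗ restrictDom k k A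

theorem keep_apply_of_mem (A : Set ι) (f : ι →₀ k) {i : ι} (h : i ∈ A) : keep k A f i = f i := by
  simp [keep, restrictDom_apply, h]

theorem keep_apply_of_notMem (A : Set ι) (f : ι →₀ k) {i : ι} (h : i ∉ A) : keep k A f i = 0 := by
  simp [keep, restrictDom_apply, h]

theorem keep_mem {S : Set ι} (A : Set ι) {f : ι →₀ k} (hf : f ∈ supported k k S) :
    keep k A f ∈ supported k k (S ∩ A) := by
  rw [mem_supported'] at hf ⊢
  intro i hi
  by_cases h : i ∈ A
  · rw [keep_apply_of_mem A f h]
    exact hf i fun h' => hi ⟨h', h⟩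
  · exact keep_apply_of_notMem A f h

theorem keep_of_mem {A : Set ι} {f : ι →₀ k} (hf : f ∈ supported k k A) : keep k A f = f := by
  rw [mem_supported'] at hf
  ext i
  by_cases h : i ∈ A
  · exact keep_apply_of_mem A f h
  · rw [keep_apply_of_notMem A f h, hf i h]

theorem keep_of_mem_compl {A : Set ι} {f : ι →₀ k} (hf : f ∈ supported k k Aᶜ) :
    keep k A f = 0 := by
  rw [mem_supported'] at hf
  ext i
  by_cases h : i ∈ A
  · rw [keep_apply_of_mem A f h, hf i (by simpa using h), zero_apply]
  · exact keep_apply_of_notMem A f h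

theorem mem_compl_of_keep {A : Set ι} {f : ι →₀ k} (hf : keep k A f = 0) :
    f ∈ supported k k Aᶜ := by
  rw [mem_supported']
  intro i hi
  rw [← keep_apply_of_mem A f (by simpa using hi), hf, zero_apply]

theorem keep_mapDomain (φ : ι → κ) (A : Set κ) (f : ι →₀ k) :
    keep k A (lmapDomain k k φ f) = lmapDomain k k φ (keep k (φ ⁻¹' A) f) := by
  suffices keep k A ∘ₗ lmapDomain k k φ = lmapDomain k k φ ∘ₗ keep k (φ ⁻¹' A) from
    LinearMap.congr_fun this f
  refine lhom_ext fun i a => ?_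
  rw [LinearMap.comp_apply, LinearMap.comp_apply, lmapDomain_apply, mapDomain_single]
  by_cases h : φ i ∈ A
  · rw [keep_of_mem (single_mem_supported k a h),
      keep_of_mem (single_mem_supported k a (s := φ ⁻¹' A) h), lmapDomain_apply, mapDomain_single]
  · rw [keep_of_mem_compl (single_mem_supported k a h),
      keep_of_mem_compl (single_mem_supported k a (s := (φ ⁻¹' A)ᶜ) h), map_zero]

theorem lmapDomain_lmapDomain {μ : Type*} (g : κ → μ) (f : ι → κ) (v : ι →₀ k) :
    lmapDomain k k g (lmapDomain k k f v) = lmapDomain k k (fun i => g (f i)) v :=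
  mapDomain_comp.symm

theorem lmapDomain_single (g : ι → κ) (i : ι) (a : k) :
    lmapDomain k k g (single i a) = single (g i) a :=
  mapDomain_single

theorem map_mem_of_supported {V : Type*} [AddCommGroup V] [Module k V] {A : Set ι}
    {W : Submodule k V} {T : (ι →₀ k) →ₗ[k] V}
    (h : ∀ i ∈ A, T (single i 1) ∈ W) {f : ι →₀ k} (hf : f ∈ supported k k A) : T f ∈ W := by
  rw [supported_eq_span_single] at hf
  have : Submodule.span k ((fun i => single i (1 : k)) '' A) ≤ W.comap T := by
    rw [Submodule.span_le]
    rintro _ ⟨i, hi, rfl⟩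
    exact h i hi
  exact this hf

theorem map_eq_of_supported {V : Type*} [AddCommMonoid V] [Module k V] {A : Set ι}
    {T T' : (ι →₀ k) →ₗ[k] V} (h : ∀ i ∈ A, T (single i 1) = T' (single i 1)) {f : ι →₀ k}
    (hf : f ∈ supported k k A) : T f = T' f := by
  rw [supported_eq_span_single] at hf
  refine LinearMap.eqOn_span (f := T) (g := T') ?_ hf
  rintro _ ⟨i, hi, rfl⟩
  exact h i hi

theorem map_keep_of_supported {d : (ι →₀ k) →ₗ[k] (κ →₀ k)} {S B : Set ι} {A : Set κ}
    (h : ∀ i ∈ S, i ∈ B → d (single i 1) ∈ supported k k A)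
    (h' : ∀ i ∈ S, i ∉ B → d (single i 1) ∈ supported k k Aᶜ) {f : ι →₀ k}
    (hf : f ∈ supported k k S) : d (keep k B f) = keep k A (d f) := by
  refine map_eq_of_supported (T := d ∘ₗ keep k B) (T' := keep k A ∘ₗ d) (fun i hi => ?_) hf
  rw [LinearMap.comp_apply, LinearMap.comp_apply]
  by_cases hB : i ∈ B
  · rw [keep_of_mem (single_mem_supported k _ hB), keep_of_mem (h i hi hB)]
  · rw [keep_of_mem_compl (single_mem_supported k _ hB), keep_of_mem_compl (h' i hi hB), map_zero]

/-- Every cycle of `d` supported on `A` is the boundary of a chain supported on `B`. -/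
def ExactOn (d : (ι →₀ k) →ₗ[k] (ι →₀ k)) (A B : Set ι) : Prop :=
  ∀ f ∈ supported k k A, d f = 0 → ∃ g ∈ supported k k B, d g = f

theorem ExactOn.congr {d d' : (ι →₀ k) →ₗ[k] (ι →₀ k)} {A B : Set ι}
    (h : ∀ i ∈ A ∪ B, d (single i 1) = d' (single i 1)) (H : ExactOn d A B) : ExactOn d' A B := by
  intro f hf hdf
  obtain ⟨g, hg, rfl⟩ := H f hf ((map_eq_of_supported (fun i hi => h i (Or.inl hi)) hf).trans hdf)
  exact ⟨g, hg, (map_eq_of_supported (fun i hi => h i (Or.inr hi)) hg).symm⟩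

section Transport

variable {d : (ι →₀ k) →ₗ[k] (ι →₀ k)} {d' : (κ →₀ k) →ₗ[k] (κ →₀ k)} {S A B : Set ι} {φ : ι → κ}

theorem eq_of_lmapDomain_eq (hφ : Set.InjOn φ S) {f g : ι →₀ k} (hf : f ∈ supported k k S)
    (hg : g ∈ supported k k S) (h : lmapDomain k k φ f = lmapDomain k k φ g) : f = g :=
  mapDomain_injOn S hφ hf hg h

theorem exists_lmapDomain_eq {f : κ →₀ k} (hf : f ∈ supported k k (φ '' A)) :
    ∃ g ∈ supported k k A, lmapDomain k k φ g = f := by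
  rw [← lmapDomain_supported] at hf
  exact hf

/-- Exactness transports along an injective chain map. -/
theorem exactOn_image_iff (hφ : Set.InjOn φ S) (hA : A ⊆ S) (hB : B ⊆ S)
    (hd : ∀ i ∈ S, d (single i 1) ∈ supported k k S)
    (hc : ∀ i ∈ S, lmapDomain k k φ (d (single i 1)) = d' (single (φ i) 1)) :
    ExactOn d' (φ '' A) (φ '' B) ↔ ExactOn d A B := by
  have hcomm : ∀ f ∈ supported k k S, lmapDomain k k φ (d f) = d' (lmapDomain k k φ f) :=
    fun f hf => map_eq_of_supported (T := lmapDomain k k φ ∘ₗ d) (T' := d' ∘ₗ lmapDomain k k φ)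
      (fun i hi => by
        rw [LinearMap.comp_apply, LinearMap.comp_apply, hc i hi, lmapDomain_apply,
          mapDomain_single]) hf
  have hsupp : ∀ f ∈ supported k k S, d f ∈ supported k k S :=
    fun f hf => map_mem_of_supported hd hf
  have mA := supported_mono (M := k) (R := k) hA
  have mB := supported_mono (M := k) (R := k) hB
  constructor
  · intro H f hf hdf
    have h1 : lmapDomain k k φ f ∈ supported k k (φ '' A) := by
      rw [← lmapDomain_supported]; exact Submodule.mem_map_of_mem hf
    obtain ⟨g', hg', h⟩ := H _ h1 (by rw [← hcomm f (mA hf), hdf, map_zero])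
    obtain ⟨g, hg, rfl⟩ := exists_lmapDomain_eq hg'
    refine ⟨g, hg, eq_of_lmapDomain_eq hφ (hsupp _ (mB hg)) (mA hf) ?_⟩
    rw [hcomm g (mB hg), h]
  · intro H f' hf' hdf'
    obtain ⟨f, hf, rfl⟩ := exists_lmapDomain_eq hf'
    obtain ⟨g, hg, h⟩ := H f hf (eq_of_lmapDomain_eq hφ (hsupp _ (mA hf)) (zero_mem _)
      (by rw [hcomm f (mA hf), hdf', map_zero]))
    refine ⟨lmapDomain k k φ g, ?_, by rw [← hcomm g (mB hg), h]⟩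
    rw [← lmapDomain_supported]
    exact Submodule.mem_map_of_mem hg

end Transport

section Fibers

variable {d : (ι →₀ k) →ₗ[k] (ι →₀ k)} {A B : Set ι} (c : ι → κ)

theorem exactOn_fiber {c : ι → κ}
    (hc : ∀ i ∈ B, d (single i 1) ∈ supported k k {j | c j = c i}) (H : ExactOn d A B) (a : κ) :
    ExactOn d (A ∩ {i | c i = a}) (B ∩ {i | c i = a}) := by
  intro f hf hdf
  obtain ⟨g, hg, rfl⟩ := H f (supported_mono Set.inter_subset_left hf) hdf
  refine ⟨keep k {i | c i = a} g, keep_mem _ hg, ?_⟩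
  rw [map_keep_of_supported (A := {i | c i = a}) (S := B) _ _ hg, keep_of_mem]
  · exact supported_mono Set.inter_subset_right hf
  · intro i hi hia
    exact supported_mono (fun j (hj : c j = c i) => hj.trans hia) (hc i hi)
  · intro i hi hia
    exact supported_mono (t := {i | c i = a}ᶜ)
      (fun j (hj : c j = c i) hja => hia (hj.symm.trans hja)) (hc i hi)

theorem sum_keep_fiber (f : ι →₀ k) [DecidableEq κ] :
    ∑ a ∈ f.support.image c, keep k {i | c i = a} f = f := by
  ext i
  rw [finsetSum_apply]
  by_cases hi : f i = 0
  · rw [hi]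
    refine Finset.sum_eq_zero fun a _ => ?_
    by_cases h : c i = a
    · rw [keep_apply_of_mem {i | c i = a} _ h, hi]
    · exact keep_apply_of_notMem {i | c i = a} _ h
  · rw [Finset.sum_eq_single (c i), keep_apply_of_mem {j | c j = c i} _ rfl]
    · exact fun b _ hb => keep_apply_of_notMem {i | c i = b} _ fun h => hb h.symm
    · exact fun h => absurd (Finset.mem_image_of_mem c (mem_support_iff.2 hi)) h

/-- A function of the basis that the differential preserves splits the complex into a direct sum. A
cycle has finite support, so finitely many fibres are involved. -/
theorem exactOn_of_fibers {c : ι → κ}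
    (hc : ∀ i ∈ A, d (single i 1) ∈ supported k k {j | c j = c i})
    (H : ∀ a, ExactOn d (A ∩ {i | c i = a}) (B ∩ {i | c i = a})) : ExactOn d A B := by
  classical
  intro f hf hdf
  have h1 : ∀ a, d (keep k {i | c i = a} f) = 0 := by
    intro a
    rw [map_keep_of_supported (A := {i | c i = a}) (S := A) _ _ hf, hdf, map_zero]
    · intro i hi hia
      exact supported_mono (fun j (hj : c j = c i) => hj.trans hia) (hc i hi)
    · intro i hi hia
      exact supported_mono (t := {i | c i = a}ᶜ)
        (fun j (hj : c j = c i) hja => hia (hj.symm.trans hja)) (hc i hi)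
  choose g hg hdg using fun a => H a _ (keep_mem _ hf) (h1 a)
  refine ⟨∑ a ∈ f.support.image c, g a, Submodule.sum_mem _ fun a _ =>
    supported_mono Set.inter_subset_left (hg a), ?_⟩
  rw [map_sum]
  exact (Finset.sum_congr rfl fun a _ => hdg a).trans (sum_keep_fiber c f)

end Fibers

section Weighted

variable {d : (ι →₀ k) →ₗ[k] (ι →₀ k)} {S : Set ι} {len wt : ι → ℕ}

/-- The indices in `S` of given length and weight. -/
def stratum (S : Set ι) (len wt : ι → ℕ) (n p : ℕ) : Set ι := {i | i ∈ S ∧ len i = n ∧ wt i = p}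

/-- On `S`, the map `d` is a differential lowering the length by one and preserving the weight. -/
structure IsWeighted (d : (ι →₀ k) →ₗ[k] (ι →₀ k)) (S : Set ι) (len wt : ι → ℕ) : Prop where
  mem : ∀ i ∈ S, d (single i 1) ∈ supported k k {j | j ∈ S ∧ len j + 1 = len i ∧ wt j = wt i}
  sq : ∀ i ∈ S, d (d (single i 1)) = 0

/-- The homology of `d` on `S` is concentrated in the strata where the length is at least the
weight. -/
def LinExact (d : (ι →₀ k) →ₗ[k] (ι →₀ k)) (S : Set ι) (len wt : ι → ℕ) : Prop :=
  ∀ n p, n < p → ExactOn d (stratum S len wt n p) (stratum S len wt (n + 1) p)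

/-- The alternating sign given by a length function. -/
noncomputable def lenSign (k : Type u) [Field k] (len : ι → ℕ) : (ι →₀ k) →ₗ[k] (ι →₀ k) :=
  linearCombination k fun i => single i ((-1) ^ (len i + 1))

theorem lenSign_single (len : ι → ℕ) (i : ι) :
    lenSign k len (single i 1) = (-1 : k) ^ (len i + 1) • single i 1 := by
  rw [lenSign, linearCombination_single, one_smul, smul_single, smul_eq_mul, mul_one]

theorem lenSign_sq : lenSign k len ∘ₗ lenSign k len = LinearMap.id := by
  refine lhom_ext' fun i => LinearMap.ext_ring ?_
  simp only [LinearMap.comp_apply, lsingle_apply, lenSign_single, map_smul, smul_smul,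
    LinearMap.id_apply]
  rw [← mul_pow]
  simp

theorem IsWeighted.comp_keep_mem (hd : IsWeighted d S len wt) (i : ι) :
    (d ∘ₗ keep k S) (single i 1) ∈
      supported k k {j | i ∈ S ∧ j ∈ S ∧ len j + 1 = len i ∧ wt j = wt i} := by
  rw [LinearMap.comp_apply]
  by_cases hi : i ∈ S
  · rw [keep_of_mem (single_mem_supported k _ hi)]
    exact supported_mono
      (t := {j | i ∈ S ∧ j ∈ S ∧ len j + 1 = len i ∧ wt j = wt i})
      (fun j hj => ⟨hi, hj⟩) (hd.mem i hi)
  · rw [keep_of_mem_compl (single_mem_supported k _ hi), map_zero]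
    exact zero_mem _

theorem lenSign_comp_of_parity {T : (ι →₀ k) →ₗ[k] (ι →₀ k)}
    (h : ∀ i, T (single i 1) ∈ supported k k {j | len j + 1 = len i ∨ len j = len i + 1}) :
    lenSign k len ∘ₗ T = -(T ∘ₗ lenSign k len) := by
  refine lhom_ext' fun i => LinearMap.ext_ring ?_
  simp only [LinearMap.comp_apply, lsingle_apply, LinearMap.neg_apply, lenSign_single, map_smul]
  have : ∀ f ∈ supported k k {j | len j + 1 = len i ∨ len j = len i + 1},
      lenSign k len f = (-(-1 : k) ^ (len i + 1)) • f := by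
    refine fun f hf => map_eq_of_supported
      (T' := (-(-1 : k) ^ (len i + 1)) • LinearMap.id) (fun j hj => ?_) hf
    rw [lenSign_single]
    change _ = (-(-1 : k) ^ (len i + 1)) • (single j 1 : ι →₀ k)
    rcases hj with hj | hj
    · rw [← hj, pow_succ _ (len j + 1), mul_neg_one, neg_neg]
    · rw [hj, pow_succ _ (len i + 1), mul_neg_one]
  rw [this _ (h i), neg_smul]

/-- Over a field the map onto the range has a section, and the section extends to the whole space.
-/
theorem exists_quasiInverse {V : Type*} [AddCommGroup V] [Module k V] (d : V →ₗ[k] V) :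
    ∃ s : V →ₗ[k] V, d ∘ₗ s ∘ₗ d = d := by
  obtain ⟨s, hs⟩ := d.rangeRestrict.exists_rightInverse_of_surjective d.range_rangeRestrict
  obtain ⟨t, ht⟩ := LinearMap.exists_extend s
  refine ⟨t, LinearMap.ext fun v => ?_⟩
  have h1 : t (d v) = s (d.rangeRestrict v) := LinearMap.congr_fun ht (d.rangeRestrict v)
  have h2 := congrArg Subtype.val (LinearMap.congr_fun hs (d.rangeRestrict v))
  rw [LinearMap.comp_apply, LinearMap.comp_apply, h1]
  exact h2

/-- The relation d s d = d is homogeneous, so it persists when s is replaced by its component that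
raises the length by one and keeps the weight. -/
theorem IsWeighted.exists_homogeneous_quasiInverse (hd : IsWeighted d S len wt) :
    ∃ s : (ι →₀ k) →ₗ[k] (ι →₀ k),
      (∀ i, s (single i 1) ∈ supported k k (stratum S len wt (len i + 1) (wt i))) ∧
      ∀ v, d (keep k S (s (d (keep k S v)))) = d (keep k S v) := by
  obtain ⟨t, ht⟩ := exists_quasiInverse (d ∘ₗ keep k S)
  refine ⟨linearCombination k fun i =>
    keep k (stratum S len wt (len i + 1) (wt i)) (t (single i 1)), fun i => ?_, ?_⟩
  · rw [linearCombination_single, one_smul]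
    exact supported_mono Set.inter_subset_right
      (keep_mem (S := Set.univ) _ (by rw [supported_univ]; trivial))
  · set s := linearCombination k fun i =>
      keep k (stratum S len wt (len i + 1) (wt i)) (t (single i 1)) with hs
    set e := d ∘ₗ keep k S with he
    suffices e ∘ₗ s ∘ₗ e = e from LinearMap.congr_fun this
    refine lhom_ext' fun i => LinearMap.ext_ring ?_
    simp only [LinearMap.comp_apply, lsingle_apply]
    have hmem := hd.comp_keep_mem i
    have h1 : s (e (single i 1)) =
        keep k (stratum S len wt (len i) (wt i)) (t (e (single i 1))) := by
      refine map_eq_of_supported (T' := keep k (stratum S len wt (len i) (wt i)) ∘ₗ t) ?_ hmem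
      rintro j ⟨-, -, h2, h3⟩
      rw [hs, linearCombination_single, one_smul, h2, h3]
      rfl
    by_cases hi : i ∈ S
    · rw [h1, map_keep_of_supported (A := {j | j ∈ S ∧ len j + 1 = len i ∧ wt j = wt i})
        (S := Set.univ) _ _ (by rw [supported_univ]; trivial)]
      · have h2 : e (t (e (single i 1))) = e (single i 1) := LinearMap.congr_fun ht _
        rw [h2, keep_of_mem]
        exact supported_mono (fun j hj => hj.2) hmem
      · rintro j - ⟨hj, h2, h3⟩
        refine supported_mono ?_ (hd.comp_keep_mem j)
        rintro l ⟨-, h4, h5, h6⟩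
        exact ⟨h4, by omega, by omega⟩
      · intro j _ hj
        refine supported_mono ?_ (hd.comp_keep_mem j)
        rintro l ⟨h1, h4, h5, h6⟩ ⟨-, h7, h8⟩
        exact hj ⟨h1, by omega, by omega⟩
    · have h0 : e (single i 1) = 0 := by
        rw [he, LinearMap.comp_apply, keep_of_mem_compl (single_mem_supported k _ hi), map_zero]
      rw [h0, map_zero, map_zero]

/-- With e the differential extended by zero off S and e s e = e, the homotopy is s − s s e. On a
basis vector u below the diagonal, u − s e u is a cycle, hence some e g, and so it is fixed by e s.
This says e s u − e s s e u + s e u = u, which is the homotopy identity as e² = 0. -/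
theorem IsWeighted.exists_homotopy (hd : IsWeighted d S len wt) (hE : LinExact d S len wt) :
    ∃ h : (ι →₀ k) →ₗ[k] (ι →₀ k), lenSign k len ∘ₗ h = -(h ∘ₗ lenSign k len) ∧
      ∀ i ∈ S, len i < wt i →
        (d ∘ₗ keep k S) (h (single i 1)) + h ((d ∘ₗ keep k S) (single i 1)) = single i 1 := by
  obtain ⟨s, hs, hds⟩ := hd.exists_homogeneous_quasiInverse
  set e := d ∘ₗ keep k S with he
  have hse : lenSign k len ∘ₗ s = -(s ∘ₗ lenSign k len) :=
    lenSign_comp_of_parity fun i => supported_mono (fun j hj => Or.inr hj.2.1) (hs i)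
  have hee : lenSign k len ∘ₗ e = -(e ∘ₗ lenSign k len) :=
    lenSign_comp_of_parity fun i =>
      supported_mono (fun j hj => Or.inl hj.2.2.1) (hd.comp_keep_mem i)
  have hese : ∀ v, e (s (e v)) = e v := hds
  have hsq : ∀ v, e (e v) = 0 := by
    intro v
    suffices e ∘ₗ e = 0 from LinearMap.congr_fun this v
    refine lhom_ext' fun i => LinearMap.ext_ring ?_
    simp only [LinearMap.comp_apply, lsingle_apply, LinearMap.zero_apply]
    by_cases hi : i ∈ S
    · have h1 := hd.comp_keep_mem i
      rw [he, LinearMap.comp_apply, keep_of_mem (supported_mono (fun j hj => hj.2.1) h1),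
        LinearMap.comp_apply, keep_of_mem (single_mem_supported k _ hi), hd.sq i hi]
    · rw [he, LinearMap.comp_apply d _ (single i 1),
        keep_of_mem_compl (single_mem_supported k _ hi), map_zero, map_zero]
  refine ⟨s - s ∘ₗ s ∘ₗ e, ?_, fun i hi hlt => ?_⟩
  · have a1 : ∀ v, lenSign k len (s v) = -s (lenSign k len v) := LinearMap.congr_fun hse
    have a2 : ∀ v, lenSign k len (e v) = -e (lenSign k len v) := LinearMap.congr_fun hee
    ext1 v
    refine LinearMap.ext_ring ?_
    simp only [LinearMap.comp_apply, LinearMap.sub_apply, LinearMap.neg_apply, map_sub, a1, a2,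
      map_neg, neg_neg]
    abel
  · set u : ι →₀ k := single i 1 with hu
    have hseu : s (e u) ∈ supported k k (stratum S len wt (len i) (wt i)) := by
      refine map_mem_of_supported (fun j hj => ?_) (hd.comp_keep_mem i)
      have := hs j
      rwa [hj.2.2.1, hj.2.2.2] at this
    have hui : u ∈ supported k k (stratum S len wt (len i) (wt i)) :=
      single_mem_supported k _ ⟨hi, rfl, rfl⟩
    have hv := sub_mem hui hseu
    have hS : stratum S len wt (len i) (wt i) ⊆ S := fun j hj => hj.1
    have hev : e (u - s (e u)) = 0 := by rw [map_sub, hese, sub_self]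
    obtain ⟨g, hg, hdg⟩ := hE _ _ hlt _ hv (by
      rwa [he, LinearMap.comp_apply, keep_of_mem (supported_mono hS hv)] at hev)
    have heg : e g = u - s (e u) := by
      rw [he, LinearMap.comp_apply, keep_of_mem (supported_mono (fun j hj => hj.1) hg), hdg]
    have h2 : e (s (u - s (e u))) = u - s (e u) := by rw [← heg, hese]
    rw [map_sub, map_sub] at h2
    simp only [LinearMap.sub_apply, LinearMap.comp_apply, map_sub, hsq, map_zero, sub_zero]
    rw [h2]
    abel

end Weighted

end Finsupp

/-! ### Tensor products and filtrations of based complexes -/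

namespace Finsupp

variable {k : Type u} [Field k] {ι κ : Type*}

section Product

open TensorProduct

/-- Write π and π' for the defects of the two homotopies. The first summand of H deforms 1 ⊗ 1 to π
⊗ 1, and the second deforms π ⊗ 1 to π ⊗ π'. The sign ε anticommutes with e and h, which cancels the
mixed terms. -/
theorem _root_.TensorProduct.homotopy_map {V W : Type*} [AddCommGroup V] [Module k V]
    [AddCommGroup W] [Module k W] {e h ε : V →ₗ[k] V} {e' h' : W →ₗ[k] W}
    (hεε : ∀ v, ε (ε v) = v) (hεe : ∀ v, ε (e v) = -e (ε v)) (hεh : ∀ v, ε (h v) = -h (ε v))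
    (hee : ∀ v, e (e v) = 0) {D H : V ⊗[k] W →ₗ[k] V ⊗[k] W}
    (hD : D = TensorProduct.map e LinearMap.id + TensorProduct.map ε e')
    (hH : H = TensorProduct.map h LinearMap.id +
      TensorProduct.map ((LinearMap.id - e ∘ₗ h - h ∘ₗ e) ∘ₗ ε) h') (z : V ⊗[k] W) :
    D (H z) + H (D z) + TensorProduct.map (LinearMap.id - e ∘ₗ h - h ∘ₗ e)
        (LinearMap.id - e' ∘ₗ h' - h' ∘ₗ e') z = z := by
  subst hD hH
  induction z using TensorProduct.induction_on with
  | zero => simp only [map_zero, add_zero]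
  | add x y hx hy =>
    conv_rhs => rw [← hx, ← hy]
    simp only [map_add]
    abel
  | tmul a b =>
    simp only [LinearMap.add_apply, LinearMap.comp_apply, TensorProduct.map_tmul,
      LinearMap.sub_apply, LinearMap.id_apply, map_add, map_sub, hεε, hεe, hεh, hee, map_zero,
      map_neg, TensorProduct.tmul_sub, TensorProduct.sub_tmul,
      TensorProduct.neg_tmul, sub_zero, neg_neg, TensorProduct.zero_tmul]
    abel

variable {S : Set ι} {T : Set κ} {len wt : ι → ℕ} {len' wt' : κ → ℕ}

/-- The differential `d ⊗ 1 + ε ⊗ d'` on a product, where `ε` is the sign given by the length. -/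
noncomputable def prodDiff (d : (ι →₀ k) →ₗ[k] (ι →₀ k)) (d' : (κ →₀ k) →ₗ[k] (κ →₀ k))
    (len : ι → ℕ) : (ι × κ →₀ k) →ₗ[k] (ι × κ →₀ k) :=
  (finsuppTensorFinsupp' k ι κ).toLinearMap ∘ₗ
    (TensorProduct.map d LinearMap.id + TensorProduct.map (lenSign k len) d') ∘ₗ
      (finsuppTensorFinsupp' k ι κ).symm.toLinearMap

theorem finsuppTensorFinsupp'_tmul_single (f : ι →₀ k) (j : κ) :
    finsuppTensorFinsupp' k ι κ (f ⊗ₜ single j 1) = lmapDomain k k (fun i => (i, j)) f := by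
  refine LinearMap.congr_fun (f := (finsuppTensorFinsupp' k ι κ).toLinearMap ∘ₗ
    (TensorProduct.mk k _ _).flip (single j 1)) ?_ f
  refine lhom_ext' fun i => LinearMap.ext_ring ?_
  simp [finsuppTensorFinsupp'_single_tmul_single]

theorem finsuppTensorFinsupp'_single_tmul (i : ι) (f : κ →₀ k) :
    finsuppTensorFinsupp' k ι κ (single i 1 ⊗ₜ f) = lmapDomain k k (fun j => (i, j)) f := by
  refine LinearMap.congr_fun (f := (finsuppTensorFinsupp' k ι κ).toLinearMap ∘ₗ
    TensorProduct.mk k _ _ (single i 1)) ?_ f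
  refine lhom_ext' fun i => LinearMap.ext_ring ?_
  simp [finsuppTensorFinsupp'_single_tmul_single]

theorem prodDiff_single (d : (ι →₀ k) →ₗ[k] (ι →₀ k)) (d' : (κ →₀ k) →ₗ[k] (κ →₀ k))
    (len : ι → ℕ) (i : ι) (j : κ) : prodDiff d d' len (single (i, j) 1) =
      lmapDomain k k (fun i => (i, j)) (d (single i 1)) +
        (-1 : k) ^ (len i + 1) • lmapDomain k k (fun j => (i, j)) (d' (single j 1)) := by
  rw [prodDiff, LinearMap.comp_apply, LinearMap.comp_apply, LinearEquiv.coe_coe, LinearEquiv.coe_coe,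
    finsuppTensorFinsupp'_symm_single_eq_single_one_tmul, LinearMap.add_apply,
    TensorProduct.map_tmul, TensorProduct.map_tmul, map_add,
    LinearMap.id_apply, finsuppTensorFinsupp'_tmul_single, lenSign_single,
    ← TensorProduct.smul_tmul', map_smul, finsuppTensorFinsupp'_single_tmul]

/-- Künneth: linear exactness is inherited by products. -/
theorem LinExact.prod {d : (ι →₀ k) →ₗ[k] (ι →₀ k)} {d' : (κ →₀ k) →ₗ[k] (κ →₀ k)}
    (hd : IsWeighted d S len wt) (hd' : IsWeighted d' T len' wt')
    (hle : ∀ i ∈ S, len i ≤ wt i) (hle' : ∀ i ∈ T, len' i ≤ wt' i)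
    (hE : LinExact d S len wt) (hE' : LinExact d' T len' wt') :
    LinExact (prodDiff d d' len) (S ×ˢ T) (fun x => len x.1 + len' x.2)
      (fun x => wt x.1 + wt' x.2) := by
  obtain ⟨h, hsign, hh⟩ := hd.exists_homotopy hE
  obtain ⟨h', -, hh'⟩ := hd'.exists_homotopy hE'
  intro n p hnp
  -- The differentials are controlled only on S and T. Precomposing with the truncations makes the
  -- first one square to zero on the whole space.
  suffices ExactOn (prodDiff (d ∘ₗ keep k S) (d' ∘ₗ keep k T) len)
      (stratum (S ×ˢ T) (fun x => len x.1 + len' x.2) (fun x => wt x.1 + wt' x.2) n p)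
      (stratum (S ×ˢ T) (fun x => len x.1 + len' x.2) (fun x => wt x.1 + wt' x.2) (n + 1) p) by
    refine this.congr ?_
    rintro ⟨i, j⟩ hij
    have hi : i ∈ S ∧ j ∈ T := by
      rcases hij with hij | hij
      · exact hij.1
      · exact hij.1
    rw [prodDiff_single, prodDiff_single, LinearMap.comp_apply, LinearMap.comp_apply,
      keep_of_mem (single_mem_supported k _ hi.1), keep_of_mem (single_mem_supported k _ hi.2)]
  have hmem := hd.comp_keep_mem
  have hmem' := hd'.comp_keep_mem
  set e := d ∘ₗ keep k S with he
  set e' := d' ∘ₗ keep k T with he'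
  have hse : lenSign k len ∘ₗ e = -(e ∘ₗ lenSign k len) :=
    lenSign_comp_of_parity fun i => supported_mono (fun j hj => Or.inl hj.2.2.1) (hmem i)
  have hee : e ∘ₗ e = 0 := by
    refine lhom_ext' fun i => LinearMap.ext_ring ?_
    simp only [LinearMap.comp_apply, lsingle_apply, LinearMap.zero_apply]
    by_cases hi : i ∈ S
    · have h1 := hmem i
      rw [he, LinearMap.comp_apply, keep_of_mem (supported_mono (fun j hj => hj.2.1) h1),
        LinearMap.comp_apply, keep_of_mem (single_mem_supported k _ hi), hd.sq i hi]
    · rw [he, LinearMap.comp_apply d _ (single i 1),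
        keep_of_mem_compl (single_mem_supported k _ hi), map_zero, map_zero]
  intro f hf hdf
  set E := finsuppTensorFinsupp' k ι κ with hE
  set ε := lenSign k len with hε
  set π := LinearMap.id - e ∘ₗ h - h ∘ₗ e with hπ
  set π' := LinearMap.id - e' ∘ₗ h' - h' ∘ₗ e' with hπ'
  set D : (ι →₀ k) ⊗[k] (κ →₀ k) →ₗ[k] (ι →₀ k) ⊗[k] (κ →₀ k) :=
    TensorProduct.map e LinearMap.id + TensorProduct.map ε e' with hD
  set H : (ι →₀ k) ⊗[k] (κ →₀ k) →ₗ[k] (ι →₀ k) ⊗[k] (κ →₀ k) :=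
    TensorProduct.map h LinearMap.id + TensorProduct.map (π ∘ₗ ε) h' with hH
  have hprod : ∀ z, prodDiff e e' len z = E (D (E.symm z)) := fun z => rfl
  have hεε : ∀ v, ε (ε v) = v := LinearMap.congr_fun lenSign_sq
  have hεe : ∀ v, ε (e v) = -e (ε v) := LinearMap.congr_fun hse
  have hεh : ∀ v, ε (h v) = -h (ε v) := LinearMap.congr_fun hsign
  have hee0 : ∀ v, e (e v) = 0 := LinearMap.congr_fun hee
  have key : ∀ z, D (H z) + H (D z) + TensorProduct.map π π' z = z :=
    fun z => TensorProduct.homotopy_map hεε hεe hεh hee0 hD hH z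
  -- If the total length is less than the total weight, then the same holds in one of the two
  -- factors, and the defect vanishes there.
  have hππ : TensorProduct.map π π' (E.symm f) = 0 := by
    suffices (TensorProduct.map π π' ∘ₗ E.symm.toLinearMap) f = 
        (0 : (ι × κ →₀ k) →ₗ[k] (ι →₀ k) ⊗[k] (κ →₀ k)) f from
      this
    refine map_eq_of_supported ?_ hf
    rintro ⟨i, j⟩ ⟨⟨hi, hj⟩, h1, h2⟩
    rw [LinearMap.comp_apply, LinearEquiv.coe_coe,
      finsuppTensorFinsupp'_symm_single_eq_single_one_tmul, TensorProduct.map_tmul,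
      LinearMap.zero_apply]
    have h3 := hle i hi
    have h4 := hle' j hj
    simp only at h1 h2 hi hj
    by_cases h5 : len i < wt i
    · have h6 : π (single i 1) = 0 := by
        rw [hπ, LinearMap.sub_apply, LinearMap.sub_apply, LinearMap.id_apply, sub_sub]
        exact sub_eq_zero.2 (hh i hi h5).symm
      rw [h6, TensorProduct.zero_tmul]
    · have h6 : π' (single j 1) = 0 := by
        rw [hπ', LinearMap.sub_apply, LinearMap.sub_apply, LinearMap.id_apply, sub_sub]
        exact sub_eq_zero.2 (hh' j hj (by omega)).symm
      rw [h6, TensorProduct.tmul_zero]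
  have hDf : D (E.symm f) = 0 := by
    rw [hprod] at hdf
    exact (LinearEquiv.map_eq_zero_iff E).1 hdf
  have hbound : prodDiff e e' len (E (H (E.symm f))) = f := by
    have := key (E.symm f)
    rw [hDf, map_zero, add_zero, hππ, add_zero] at this
    rw [hprod, LinearEquiv.symm_apply_apply, this, LinearEquiv.apply_symm_apply]
  -- The homotopies were not recorded as homogeneous. The differential is, so truncating to the
  -- right stratum does not change the boundary.
  refine ⟨keep k _ (E (H (E.symm f))), supported_mono Set.inter_subset_right
      (keep_mem (S := Set.univ) _ (by rw [supported_univ]; trivial)), ?_⟩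
  rw [map_keep_of_supported (S := Set.univ) _ _ (by rw [supported_univ]; trivial), hbound,
    keep_of_mem hf]
  · rintro ⟨i, j⟩ - ⟨⟨hi, hj⟩, h1, h2⟩
    rw [prodDiff_single]
    simp only at h1 h2 hi hj
    refine add_mem (map_mem_of_supported (fun i' hi' => ?_) (hmem i))
      (Submodule.smul_mem _ _ (map_mem_of_supported (fun j' hj' => ?_) (hmem' j)))
    · rw [lmapDomain_apply, mapDomain_single]
      obtain ⟨-, h3, h4, h5⟩ := hi'
      exact single_mem_supported k _ ⟨⟨h3, hj⟩, by simp only; omega, by simp only; omega⟩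
    · rw [lmapDomain_apply, mapDomain_single]
      obtain ⟨-, h3, h4, h5⟩ := hj'
      exact single_mem_supported k _ ⟨⟨hi, h3⟩, by simp only; omega, by simp only; omega⟩
  · rintro ⟨i, j⟩ - hij
    rw [prodDiff_single]
    refine add_mem (map_mem_of_supported (fun i' hi' => ?_) (hmem i))
      (Submodule.smul_mem _ _ (map_mem_of_supported (fun j' hj' => ?_) (hmem' j)))
    · rw [lmapDomain_apply, mapDomain_single]
      obtain ⟨h0, h3, h4, h5⟩ := hi'
      refine single_mem_supported k _ fun h6 => hij ?_
      obtain ⟨⟨h6, h7⟩, h8, h9⟩ := h6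
      simp only at h6 h7 h8 h9
      exact ⟨⟨h0, h7⟩, by simp only; omega, by simp only; omega⟩
    · rw [lmapDomain_apply, mapDomain_single]
      obtain ⟨h0, h3, h4, h5⟩ := hj'
      refine single_mem_supported k _ fun h6 => hij ?_
      obtain ⟨⟨h6, h7⟩, h8, h9⟩ := h6
      simp only at h6 h7 h8 h9
      exact ⟨⟨h6, h0⟩, by simp only; omega, by simp only; omega⟩

end Product

section Filtration

variable {b : (ι →₀ k) →ₗ[k] (ι →₀ k)} {S : Set ι} {len wt : ι → ℕ}

/-- On `S`, the map `b` is a differential lowering the length by one and not lowering the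
weight. -/
structure IsFiltered (b : (ι →₀ k) →ₗ[k] (ι →₀ k)) (S : Set ι) (len wt : ι → ℕ) : Prop where
  mem : ∀ i ∈ S, b (single i 1) ∈ supported k k {j | j ∈ S ∧ len j + 1 = len i ∧ wt i ≤ wt j}
  sq : ∀ i ∈ S, b (b (single i 1)) = 0

/-- The weight-preserving part of a linear map. -/
noncomputable def leading (wt : ι → ℕ) (b : (ι →₀ k) →ₗ[k] (ι →₀ k)) :
    (ι →₀ k) →ₗ[k] (ι →₀ k) :=
  linearCombination k fun i => keep k {j | wt j = wt i} (b (single i 1))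

theorem leading_single (wt : ι → ℕ) (b : (ι →₀ k) →ₗ[k] (ι →₀ k)) (i : ι) :
    leading wt b (single i 1) = keep k {j | wt j = wt i} (b (single i 1)) := by
  rw [leading, linearCombination_single, one_smul]

/-- The indices in `S` of given length and weight at least `p`. -/
def layerStratum (S : Set ι) (len wt : ι → ℕ) (n p : ℕ) : Set ι :=
  {i | i ∈ S ∧ len i = n ∧ p ≤ wt i}

/-- Since the weight never drops, terms of weight above p cannot contribute to the part of weight p.
-/
theorem IsFiltered.keep_map (hb : IsFiltered b S len wt) {p : ℕ} {f : ι →₀ k}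
    (hf : f ∈ supported k k {i | i ∈ S ∧ p ≤ wt i}) :
    keep k {i | wt i = p} (b f) = leading wt b (keep k {i | wt i = p} f) := by
  refine map_eq_of_supported (T := keep k {i | wt i = p} ∘ₗ b)
    (T' := leading wt b ∘ₗ keep k {i | wt i = p}) ?_ hf
  rintro i ⟨hi, hp⟩
  rw [LinearMap.comp_apply, LinearMap.comp_apply]
  by_cases h : wt i = p
  · rw [keep_of_mem (A := {i | wt i = p}) (single_mem_supported k _ h), leading_single, h]
  · rw [keep_of_mem_compl (A := {i | wt i = p}) (single_mem_supported k _ h), map_zero]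
    refine keep_of_mem_compl (supported_mono ?_ (hb.mem i hi))
    rintro j ⟨-, -, hj⟩ (hj' : wt j = p)
    omega

theorem IsFiltered.isWeighted (hb : IsFiltered b S len wt) :
    IsWeighted (leading wt b) S len wt := by
  refine ⟨fun i hi => ?_, fun i hi => ?_⟩
  · rw [leading_single]
    refine supported_mono ?_ (keep_mem _ (hb.mem i hi))
    rintro j ⟨⟨h1, h2, -⟩, h3⟩
    exact ⟨h1, h2, h3⟩
  · rw [leading_single, ← hb.keep_map, hb.sq i hi, map_zero]
    exact supported_mono (t := {j | j ∈ S ∧ wt i ≤ wt j}) (fun j hj => ⟨hj.1, hj.2.2⟩)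
      (hb.mem i hi)

theorem IsFiltered.map_mem_layer (hb : IsFiltered b S len wt) {n p : ℕ} {f : ι →₀ k}
    (hf : f ∈ supported k k (layerStratum S len wt (n + 1) p)) :
    b f ∈ supported k k (layerStratum S len wt n p) := by
  refine map_mem_of_supported (fun i hi => supported_mono ?_ (hb.mem i hi.1)) hf
  rintro j ⟨h1, h2, h3⟩
  obtain ⟨-, h4, h5⟩ := hi
  exact ⟨h1, by omega, by omega⟩

theorem IsFiltered.map_map (hb : IsFiltered b S len wt) {f : ι →₀ k}
    (hf : f ∈ supported k k S) : b (b f) = 0 :=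
  map_eq_of_supported (T := b ∘ₗ b) (T' := 0) hb.sq hf

/-- The complex of a filtration is exact below the filtration degree in every layer if and only if
its leading part is linearly exact. -/
theorem IsFiltered.linExact_iff (hb : IsFiltered b S len wt) {N : ℕ} (hN : ∀ i ∈ S, wt i ≤ N) :
    LinExact (leading wt b) S len wt ↔
      ∀ n p, n < p → ExactOn b (layerStratum S len wt n p) (layerStratum S len wt (n + 1) p) := by
  have mS : ∀ n p, layerStratum S len wt n p ⊆ {i | i ∈ S ∧ p ≤ wt i} :=
    fun n p i hi => ⟨hi.1, hi.2.2⟩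
  have mS' : ∀ n p, layerStratum S len wt n p ⊆ S := fun n p i hi => hi.1
  have mup : ∀ n p f, f ∈ supported k k (layerStratum S len wt n p) →
      keep k {i | wt i = p} f = 0 → f ∈ supported k k (layerStratum S len wt n (p + 1)) := by
    intro n p f hf h0
    have := (Submodule.mem_inf (p := supported k k (layerStratum S len wt n p))).2
      ⟨hf, mem_compl_of_keep h0⟩
    rw [← supported_inter] at this
    refine supported_mono ?_ this
    rintro i ⟨⟨h1, h2, h3⟩, h4 : ¬ wt i = p⟩
    exact ⟨h1, h2, by omega⟩
  have mdown : ∀ n p p', p ≤ p' →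
      supported k k (layerStratum S len wt n p') ≤ supported k k (layerStratum S len wt n p) := by
    intro n p p' hp
    refine supported_mono ?_
    rintro i ⟨h1, h2, h3⟩
    exact ⟨h1, h2, by omega⟩
  have mstr : ∀ n p,
      supported k k (stratum S len wt n p) ≤ supported k k (layerStratum S len wt n p) := by
    intro n p
    refine supported_mono ?_
    rintro i ⟨h1, h2, h3⟩
    exact ⟨h1, h2, h3.ge⟩
  have mkeep : ∀ n p f, f ∈ supported k k (layerStratum S len wt n p) →
      keep k {i | wt i = p} f ∈ supported k k (stratum S len wt n p) := by
    intro n p f hf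
    refine supported_mono ?_ (keep_mem _ hf)
    rintro i ⟨⟨h1, h2, h3⟩, h4⟩
    exact ⟨h1, h2, h4⟩
  constructor
  · intro hE
    -- Descending induction on p, with m bounding the distance to the layers above N, which are
    -- empty.
    suffices ∀ m p, N < p + m → ∀ n, n < p →
        ExactOn b (layerStratum S len wt n p) (layerStratum S len wt (n + 1) p) from
      fun n p hnp => this (N + 1) p (by omega) n hnp
    intro m
    induction m with
    | zero =>
      intro p hp n _ f hf _
      have hempty : layerStratum S len wt n p = ∅ := by
        refine Set.eq_empty_iff_forall_notMem.2 ?_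
        rintro i ⟨h1, h2, h3⟩
        have := hN i h1
        omega
      rw [hempty, supported_empty, Submodule.mem_bot] at hf
      exact ⟨0, zero_mem _, by rw [map_zero, hf]⟩
    | succ m ih =>
      intro p hp n hnp f hf hbf
      -- The weight p part of f is a boundary for the leading differential. Subtracting the full
      -- boundary of g pushes f into the next layer.
      obtain ⟨g, hg, hdg⟩ := hE n p hnp _ (mkeep n p f hf)
        (by rw [← hb.keep_map (supported_mono (mS n p) hf), hbf, map_zero])
      have hg' := mstr _ _ hg
      have h1 := sub_mem hf (hb.map_mem_layer hg')
      have h2 : keep k {i | wt i = p} g = g := keep_of_mem (supported_mono (fun i hi => hi.2.2) hg)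
      obtain ⟨g', hg'', h3⟩ := ih (p + 1) (by omega) n (by omega) _
        (mup n p _ h1 (by
          rw [map_sub, hb.keep_map (supported_mono (mS _ p) hg'), h2, hdg, sub_self]))
        (by rw [map_sub, hbf, hb.map_map (supported_mono (mS' _ p) hg'), sub_zero])
      exact ⟨g + g', add_mem hg' (mdown _ _ _ (by omega) hg''), by rw [map_add, h3]; abel⟩
  · intro H n p hnp f hf hdf
    have hf' := mstr _ _ hf
    have h2 : keep k {i | wt i = p} f = f := keep_of_mem (supported_mono (fun i hi => hi.2.2) hf)
    have hbf0 : keep k {i | wt i = p} (b f) = 0 := by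
      rw [hb.keep_map (supported_mono (mS n p) hf'), h2, hdf]
    -- A cycle of the leading part need not be a cycle of b, but its boundary lies in the next layer
    -- and is a boundary there by exactness one length lower. Subtracting g makes f a genuine cycle
    -- without changing its weight p part.
    obtain ⟨g, hg, hbg⟩ : ∃ g ∈ supported k k (layerStratum S len wt n (p + 1)), b g = b f := by
      cases n with
      | zero =>
        refine ⟨0, zero_mem _, ?_⟩
        rw [map_zero]
        refine ((Submodule.mem_bot k).1 (map_mem_of_supported (fun i hi => ?_) hf')).symm
        rw [← supported_empty]
        refine supported_mono ?_ (hb.mem i hi.1)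
        rintro j ⟨-, hj, -⟩
        have := hi.2.1
        omega
      | succ n =>
        exact H n (p + 1) (by omega) _ (mup _ _ _ (hb.map_mem_layer hf') hbf0)
          (hb.map_map (supported_mono (mS' _ p) hf'))
    have hg' := mdown n p (p + 1) (by omega) hg
    obtain ⟨h, hh, hbh⟩ := H n p hnp (f - g) (sub_mem hf' hg') (by rw [map_sub, hbg, sub_self])
    refine ⟨keep k {i | wt i = p} h, mkeep _ _ _ hh, ?_⟩
    rw [← hb.keep_map (supported_mono (mS _ p) hh), hbh, map_sub, h2,
      keep_of_mem_compl (f := g), sub_zero]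
    refine supported_mono ?_ hg
    rintro i ⟨-, -, h3⟩ (h4 : wt i = p)
    omega

end Filtration

end Finsupp

/-! ### Chains between two points, their weights, and products -/

section

open Finsupp

namespace ChainList

variable {P : Type v}

section Between

variable [PartialOrder P]

/-- `x < z₁ < ⋯ < zₙ < y` for the list `[z₁, …, zₙ]`. -/
def Between : P → List P → P → Prop
  | x, [], y => x < y
  | x, z :: L, y => x < z ∧ Between z L y

theorem Between.lt {x y : P} {L : List P} (h : Between x L y) : x < y := by
  induction L generalizing x with
  | nil => exact h
  | cons z L ih => exact h.1.trans (ih h.2)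

theorem Between.mem_lt {x y z : P} {L : List P} (h : Between x L y) (hz : z ∈ L) :
    x < z ∧ z < y := by
  induction L generalizing x with
  | nil => cases hz
  | cons w L ih =>
    rcases List.mem_cons.1 hz with rfl | hz
    · exact ⟨h.1, h.2.lt⟩
    · exact ⟨h.1.trans (ih h.2 hz).1, (ih h.2 hz).2⟩

theorem Between.of_lt {x x' y : P} {L : List P} (h : Between x L y) (hx : x' < x) :
    Between x' L y := by
  cases L with
  | nil => exact hx.trans h
  | cons z L => exact ⟨hx.trans h.1, h.2⟩

theorem between_append {x y z : P} {L₁ L₂ : List P} :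
    Between x (L₁ ++ z :: L₂) y ↔ Between x L₁ z ∧ Between z L₂ y := by
  induction L₁ generalizing x with
  | nil => exact Iff.rfl
  | cons w L ih =>
    change x < w ∧ Between w (L ++ z :: L₂) y ↔ (x < w ∧ _) ∧ _
    rw [ih, and_assoc]

theorem Between.of_sublist {x y : P} {L L' : List P} (h : Between x L y) (hs : L'.Sublist L) :
    Between x L' y := by
  induction hs generalizing x with
  | slnil => exact h
  | cons a _ ih => exact (ih h.2).of_lt h.1
  | cons_cons a _ ih => exact ⟨h.1, ih h.2⟩

theorem Between.sublist_of_subset {x y : P} {L L' : List P} (h : Between x L y)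
    (h' : Between x L' y) (hs : L' ⊆ L) : L'.Sublist L := by
  induction L generalizing x L' with
  | nil => rw [List.subset_nil.1 hs]
  | cons a L ih =>
    cases L' with
    | nil => exact List.nil_sublist _
    | cons b L' =>
      by_cases hab : b = a
      · subst hab
        refine (ih h.2 h'.2 fun v hv => ?_).cons_cons _
        exact (List.mem_cons.1 (hs (List.mem_cons_of_mem _ hv))).resolve_left
          (h'.2.mem_lt hv).1.ne'
      · have hb : b ∈ L := (List.mem_cons.1 (hs List.mem_cons_self)).resolve_left hab
        have hlt := (h.2.mem_lt hb).1
        refine (ih h.2 (L' := b :: L') ⟨hlt, h'.2⟩ fun v hv => ?_).cons _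
        refine (List.mem_cons.1 (hs hv)).resolve_left ?_
        rintro rfl
        rcases List.mem_cons.1 hv with rfl | hv
        · exact hab rfl
        · exact lt_irrefl _ (hlt.trans (h'.2.mem_lt hv).1)

theorem Between.nodup {x y : P} {L : List P} (h : Between x L y) : L.Nodup := by
  induction L generalizing x with
  | nil => exact List.nodup_nil
  | cons z L ih =>
    exact List.nodup_cons.2 ⟨fun hz => lt_irrefl _ (h.2.mem_lt hz).1, ih h.2⟩

theorem Between.eq_of_mem_iff {x y : P} {L L' : List P} (h : Between x L y)
    (h' : Between x L' y) (hs : ∀ v, v ∈ L ↔ v ∈ L') : L = L' :=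
  (h'.sublist_of_subset h fun v hv => (hs v).1 hv).antisymm
    (h.sublist_of_subset h' fun v hv => (hs v).2 hv)

theorem Between.comparable {x y u v : P} {L : List P} (h : Between x L y) (hu : u ∈ L)
    (hv : v ∈ L) : u ≤ v ∨ v ≤ u := by
  induction L generalizing x with
  | nil => cases hu
  | cons z L ih =>
    rcases List.mem_cons.1 hu with hu | hu <;> rcases List.mem_cons.1 hv with hv | hv
    · exact Or.inl (hu.trans hv.symm).le
    · exact Or.inl (hu ▸ (h.2.mem_lt hv).1.le)
    · exact Or.inr (hv ▸ (h.2.mem_lt hu).1.le)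
    · exact ih h.2 hu hv

/-- The totally ordered set is listed by repeatedly removing a minimal element. -/
theorem exists_between (s : Finset P) {x y : P} (hxy : x < y)
    (hs : ∀ v ∈ s, x < v ∧ v < y) (hc : ∀ u ∈ s, ∀ v ∈ s, u ≤ v ∨ v ≤ u) :
    ∃ L, Between x L y ∧ ∀ v, v ∈ L ↔ v ∈ s := by
  classical
  induction hn : s.card generalizing s x with
  | zero =>
    rw [Finset.card_eq_zero] at hn
    exact ⟨[], hxy, by simp [hn]⟩
  | succ n ih =>
    obtain ⟨z, hz⟩ := s.exists_minimal (Finset.card_pos.1 (by omega))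
    obtain ⟨hzs, hmin⟩ := hz
    obtain ⟨L, hL, hLs⟩ := ih (s.erase z) (x := z) (hs z hzs).2
      (fun v hv => by
        obtain ⟨hne, hv⟩ := Finset.mem_erase.1 hv
        refine ⟨lt_of_le_of_ne ?_ hne.symm, (hs v hv).2⟩
        rcases hc z hzs v hv with h | h
        · exact h
        · exact hmin hv h)
      (fun u hu v hv => hc u (Finset.mem_of_mem_erase hu) v (Finset.mem_of_mem_erase hv))
      (by rw [Finset.card_erase_of_mem hzs, hn]; rfl)
    refine ⟨z :: L, ⟨(hs z hzs).1, hL⟩, fun v => ?_⟩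
    rw [List.mem_cons, hLs, Finset.mem_erase]
    by_cases h : v = z
    · subst h; simp [hzs]
    · simp [h]

end Between

/-- The total length of the steps of a chain from `x` to `y`. -/
def weight (ℓ : P → P → ℕ) : P → List P → P → ℕ
  | x, [], y => ℓ x y
  | x, z :: L, y => ℓ x z + weight ℓ z L y

/-- `ℓ x y` is the maximal number of steps in a chain from `x` to `y`. -/
structure IsLength [PartialOrder P] (ℓ : P → P → ℕ) : Prop where
  add_le : ∀ {x y z : P}, x < y → y < z → ℓ x y + ℓ y z ≤ ℓ x z
  exists_chain : ∀ {x y : P}, x < y → ∃ L, Between x L y ∧ L.length + 1 = ℓ x y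

section Length

variable {ℓ : P → P → ℕ}

theorem weight_append (x y z : P) (L₁ L₂ : List P) :
    weight ℓ x (L₁ ++ z :: L₂) y = weight ℓ x L₁ z + weight ℓ z L₂ y := by
  induction L₁ generalizing x with
  | nil => rfl
  | cons w L ih =>
    change ℓ x w + weight ℓ w (L ++ z :: L₂) y = ℓ x w + weight ℓ w L z + _
    rw [ih, add_assoc]

variable [PartialOrder P]

/-- Omitting an intermediate point joins two steps into one, and the joint step is at least as long
by superadditivity. Hence erasing points never lowers the weight. -/
theorem IsLength.weight_cons_le (hℓ : IsLength ℓ) {x y z : P} {L : List P} (hx : x < z)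
    (h : Between z L y) : ℓ x z + weight ℓ z L y ≤ weight ℓ x L y := by
  cases L with
  | nil => exact hℓ.add_le hx h
  | cons w L =>
    have := hℓ.add_le hx h.1
    simp only [weight]
    omega

theorem IsLength.length_le_weight (hℓ : IsLength ℓ) {x y : P} {L : List P} (h : Between x L y) :
    L.length + 1 ≤ weight ℓ x L y := by
  have hpos : ∀ {x y : P}, x < y → 1 ≤ ℓ x y := by
    intro x y hxy
    obtain ⟨L, -, hL⟩ := hℓ.exists_chain hxy
    omega
  induction L generalizing x with
  | nil => exact hpos h
  | cons z L ih =>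
    have h1 := ih h.2
    have h2 := hpos h.1
    simp only [weight, List.length_cons]
    omega

theorem IsLength.weight_le_of_sublist (hℓ : IsLength ℓ) {x y : P} {L L' : List P}
    (h : Between x L y) (hs : L'.Sublist L) : weight ℓ x L y ≤ weight ℓ x L' y := by
  induction hs generalizing x with
  | slnil => exact le_rfl
  | cons a hs ih =>
    have h1 := ih h.2
    have h2 := hℓ.weight_cons_le h.1 (h.2.of_sublist hs)
    simp only [weight]
    omega
  | cons_cons a _ ih =>
    have h1 := ih h.2
    simp only [weight]
    omega

theorem IsLength.weight_le (hℓ : IsLength ℓ) {x y : P} {L : List P} (h : Between x L y) :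
    weight ℓ x L y ≤ ℓ x y :=
  hℓ.weight_le_of_sublist h (List.nil_sublist L)

/-- Each step is filled in by a longest chain. Thus a weight of at least p means being contained in
a chain with at least p steps, which links the weight filtration to the sequential layers. -/
theorem IsLength.exists_refinement (hℓ : IsLength ℓ) {x y : P} {L : List P}
    (h : Between x L y) : ∃ L', Between x L' y ∧ L.Sublist L' ∧ L'.length + 1 = weight ℓ x L y := by
  induction L generalizing x with
  | nil =>
    obtain ⟨L, hL, hl⟩ := hℓ.exists_chain h
    exact ⟨L, hL, List.nil_sublist _, hl⟩
  | cons z L ih =>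
    obtain ⟨L', h1, h2, h3⟩ := ih h.2
    obtain ⟨M, h4, h5⟩ := hℓ.exists_chain h.1
    refine ⟨M ++ z :: L', between_append.2 ⟨h4, h1⟩,
      (h2.cons_cons z).trans (List.sublist_append_right _ _), ?_⟩
    simp only [weight, List.length_append, List.length_cons]
    omega

end Length

section Erasures

variable (k : Type u) [Field k]

open Classical in
/-- The alternating sum of the lists obtained by erasing an entry that is not in `m`. -/
noncomputable def erasures (m : Set P) : List P → (List P →₀ k)
  | [] => 0
  | z :: L => if z ∈ m then lmapDomain k k (List.cons z) (erasures m L)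
      else single L 1 - lmapDomain k k (List.cons z) (erasures m L)

/-- The linear extension of `erasures`. -/
noncomputable def faceMap (m : Set P) : (List P →₀ k) →ₗ[k] (List P →₀ k) :=
  linearCombination k (erasures k m)

variable {k} {m : Set P}

theorem faceMap_single (L : List P) : faceMap k m (single L 1) = erasures k m L := by
  rw [faceMap, linearCombination_single, one_smul]

theorem erasures_cons_of_mem {z : P} (hz : z ∈ m) (L : List P) :
    erasures k m (z :: L) = lmapDomain k k (List.cons z) (erasures k m L) :=
  if_pos hz

theorem erasures_cons_of_notMem {z : P} (hz : z ∉ m) (L : List P) :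
    erasures k m (z :: L) = single L 1 - lmapDomain k k (List.cons z) (erasures k m L) :=
  if_neg hz

theorem faceMap_cons_of_mem {z : P} (hz : z ∈ m) (f : List P →₀ k) :
    faceMap k m (lmapDomain k k (List.cons z) f) =
      lmapDomain k k (List.cons z) (faceMap k m f) := by
  refine LinearMap.congr_fun (f := faceMap k m ∘ₗ lmapDomain k k (List.cons z))
    (g := lmapDomain k k (List.cons z) ∘ₗ faceMap k m) ?_ f
  refine lhom_ext' fun L => LinearMap.ext_ring ?_
  simp only [LinearMap.comp_apply, lsingle_apply]
  rw [lmapDomain_apply, mapDomain_single, faceMap_single, faceMap_single, erasures_cons_of_mem hz]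

theorem faceMap_cons_of_notMem {z : P} (hz : z ∉ m) (f : List P →₀ k) :
    faceMap k m (lmapDomain k k (List.cons z) f) =
      f - lmapDomain k k (List.cons z) (faceMap k m f) := by
  refine LinearMap.congr_fun (f := faceMap k m ∘ₗ lmapDomain k k (List.cons z))
    (g := LinearMap.id - lmapDomain k k (List.cons z) ∘ₗ faceMap k m) ?_ f
  refine lhom_ext' fun L => LinearMap.ext_ring ?_
  simp only [LinearMap.comp_apply, lsingle_apply, LinearMap.sub_apply, LinearMap.id_apply]
  rw [lmapDomain_apply, mapDomain_single, faceMap_single, faceMap_single,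
    erasures_cons_of_notMem hz]

theorem faceMap_erasures (L : List P) : faceMap k m (erasures k m L) = 0 := by
  induction L with
  | nil => rw [erasures, map_zero]
  | cons z L ih =>
    by_cases hz : z ∈ m
    · rw [erasures_cons_of_mem hz, faceMap_cons_of_mem hz, ih, map_zero]
    · rw [erasures_cons_of_notMem hz, map_sub, faceMap_cons_of_notMem hz, ih, faceMap_single,
        map_zero, sub_zero, sub_self]

theorem erasures_congr {m' : Set P} {L : List P} (h : ∀ z ∈ L, z ∈ m ↔ z ∈ m') :
    erasures k m L = erasures k m' L := by
  induction L with
  | nil => rfl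
  | cons z L ih =>
    have ih' := ih fun w hw => h w (List.mem_cons_of_mem _ hw)
    by_cases hz : z ∈ m
    · rw [erasures_cons_of_mem hz, erasures_cons_of_mem ((h z List.mem_cons_self).1 hz), ih']
    · rw [erasures_cons_of_notMem hz,
        erasures_cons_of_notMem (fun h' => hz ((h z List.mem_cons_self).2 h')), ih']

/-- The Leibniz rule for a chain cut at a fixed point. Erasures beyond z pick up one sign for each
point of L₁, as none of these is fixed. -/
theorem erasures_append {z : P} (hz : z ∈ m) (L₁ L₂ : List P) (h : ∀ v ∈ L₁, v ∉ m) :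
    erasures k m (L₁ ++ z :: L₂) =
      lmapDomain k k (fun L => L ++ z :: L₂) (erasures k m L₁) +
        (-1 : k) ^ L₁.length • lmapDomain k k (fun L => L₁ ++ z :: L) (erasures k m L₂) := by
  induction L₁ with
  | nil =>
    simp only [erasures, map_zero, zero_add, List.length_nil, pow_zero, one_smul]
    exact erasures_cons_of_mem hz L₂
  | cons w L ih =>
    have hw := h w List.mem_cons_self
    rw [List.cons_append, erasures_cons_of_notMem hw, erasures_cons_of_notMem hw,
      ih fun v hv => h v (List.mem_cons_of_mem _ hv), map_add, map_sub, map_smul]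
    simp only [lmapDomain_lmapDomain, List.cons_append]
    rw [lmapDomain_single, List.length_cons, pow_succ, mul_neg_one, neg_smul]
    abel

variable {ℓ : P → P → ℕ} [PartialOrder P]

theorem IsLength.erasures_mem (hℓ : IsLength ℓ) {x y : P} {L : List P} (h : Between x L y) :
    erasures k m L ∈ supported k k {L' | Between x L' y ∧ L'.length + 1 = L.length ∧
      weight ℓ x L y ≤ weight ℓ x L' y ∧ ∀ z ∈ m, z ∈ L → z ∈ L'} := by
  induction L generalizing x with
  | nil => exact zero_mem _
  | cons z L ih =>
    have h1 : lmapDomain k k (List.cons z) (erasures k m L) ∈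
        supported k k {L' | Between x L' y ∧ L'.length + 1 = (z :: L).length ∧
          weight ℓ x (z :: L) y ≤ weight ℓ x L' y ∧ ∀ v ∈ m, v ∈ z :: L → v ∈ L'} := by
      refine map_mem_of_supported (fun L' hL' => ?_) (ih h.2)
      obtain ⟨h2, h3, h4, h5⟩ := hL'
      rw [lmapDomain_apply, mapDomain_single]
      refine single_mem_supported k _ ⟨⟨h.1, h2⟩, ?_, ?_, fun v hv hvL => ?_⟩
      · rw [List.length_cons, List.length_cons, h3]
      · simp only [weight]; omega
      · rcases List.mem_cons.1 hvL with rfl | hvL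
        · exact List.mem_cons_self
        · exact List.mem_cons_of_mem _ (h5 v hv hvL)
    by_cases hz : z ∈ m
    · rwa [erasures_cons_of_mem hz]
    · rw [erasures_cons_of_notMem hz]
      refine sub_mem (single_mem_supported k _ ⟨h.2.of_lt h.1, rfl, hℓ.weight_cons_le h.1 h.2,
        fun v hv hvL => (List.mem_cons.1 hvL).resolve_left ?_⟩) h1
      rintro rfl
      exact hz hv

/-- The chains from `x` to `y` passing through all points of `F`. -/
def chainSet (x y : P) (F : List P) : Set (List P) :=
  {L | Between x L y ∧ ∀ z ∈ F, z ∈ L}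

theorem IsLength.isFiltered (hℓ : IsLength ℓ) (x y : P) (F : List P) :
    IsFiltered (faceMap k {z | z ∈ F}) (chainSet x y F) (fun L => L.length + 1)
      (fun L => weight ℓ x L y) := by
  refine ⟨fun L hL => ?_, fun L _ => ?_⟩
  · rw [faceMap_single]
    refine supported_mono ?_ (hℓ.erasures_mem hL.1)
    rintro L' ⟨h1, h2, h3, h4⟩
    exact ⟨⟨h1, fun z hz => h4 z hz (hL.2 z hz)⟩, congrArg (· + 1) h2, h3⟩
  · rw [faceMap_single, faceMap_erasures]

/-- Linear exactness of the complex of chains from `x` to `y` through `F`. -/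
def LinExactThrough (k : Type u) [Field k] (ℓ : P → P → ℕ) (x y : P) (F : List P) : Prop :=
  LinExact (leading (fun L => weight ℓ x L y) (faceMap k {z | z ∈ F})) (chainSet x y F)
    (fun L => L.length + 1) (fun L => weight ℓ x L y)

theorem eq_and_eq_of_append_eq {x z : P} {L₁ L₂ M₁ M₂ : List P} (h : Between x L₁ z)
    (h' : Between x M₁ z) (heq : L₁ ++ z :: L₂ = M₁ ++ z :: M₂) : L₁ = M₁ ∧ L₂ = M₂ := by
  induction L₁ generalizing x M₁ with
  | nil =>
    cases M₁ with
    | nil => exact ⟨rfl, (List.cons.inj heq).2⟩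
    | cons b M₁ =>
      obtain ⟨rfl, -⟩ := List.cons.inj heq
      exact absurd h'.2.lt (lt_irrefl _)
  | cons a L₁ ih =>
    cases M₁ with
    | nil =>
      obtain ⟨rfl, -⟩ := List.cons.inj heq
      exact absurd h.2.lt (lt_irrefl _)
    | cons b M₁ =>
      obtain ⟨rfl, heq'⟩ := List.cons.inj heq
      obtain ⟨rfl, rfl⟩ := ih h.2 h'.2 heq'
      exact ⟨rfl, rfl⟩

/-- A chain through z is a pair of chains below and above z, with steps and weights adding up. The
complex is therefore the tensor product of two complexes, to which the Künneth argument applies. -/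
theorem IsLength.linExactThrough_cons (hℓ : IsLength ℓ) {x y z : P} {F : List P}
    (hF : Between z F y) (h₁ : LinExactThrough k ℓ x z []) (h₂ : LinExactThrough k ℓ z y F) :
    LinExactThrough k ℓ x y (z :: F) := by
  have hprod := LinExact.prod (hℓ.isFiltered (k := k) x z []).isWeighted
    (hℓ.isFiltered (k := k) z y F).isWeighted (fun L hL => hℓ.length_le_weight hL.1)
    (fun L hL => hℓ.length_le_weight hL.1) h₁ h₂
  have himage : ∀ n p, stratum (chainSet x y (z :: F)) (fun L => L.length + 1)
      (fun L => weight ℓ x L y) n p = (fun q : List P × List P => q.1 ++ z :: q.2) ''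
        stratum (chainSet x z [] ×ˢ chainSet z y F)
          (fun q => (q.1.length + 1) + (q.2.length + 1))
          (fun q => weight ℓ x q.1 z + weight ℓ z q.2 y) n p := by
    intro n p
    ext L
    constructor
    · rintro ⟨⟨hL, hLF⟩, hn, hp⟩
      obtain ⟨L₁, L₂, rfl⟩ := List.append_of_mem (hLF z List.mem_cons_self)
      obtain ⟨hL₁, hL₂⟩ := between_append.1 hL
      refine ⟨(L₁, L₂), ⟨⟨⟨hL₁, fun v hv => absurd hv List.not_mem_nil⟩, hL₂, fun v hv => ?_⟩,
        ?_, ?_⟩, rfl⟩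
      · have hzv := (hF.mem_lt hv).1
        rcases List.mem_append.1 (hLF v (List.mem_cons_of_mem _ hv)) with h | h
        · exact absurd (hzv.trans (hL₁.mem_lt h).2) (lt_irrefl _)
        · exact (List.mem_cons.1 h).resolve_left hzv.ne'
      · simp only [List.length_append, List.length_cons] at hn ⊢
        omega
      · exact (weight_append x y z L₁ L₂).symm.trans hp
    · rintro ⟨⟨L₁, L₂⟩, ⟨⟨hL₁, hL₂⟩, hn, hp⟩, rfl⟩
      refine ⟨⟨between_append.2 ⟨hL₁.1, hL₂.1⟩, fun v hv => ?_⟩, ?_, ?_⟩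
      · rcases List.mem_cons.1 hv with rfl | hv
        · exact List.mem_append_right _ List.mem_cons_self
        · exact List.mem_append_right _ (List.mem_cons_of_mem _ (hL₂.2 v hv))
      · simp only [List.length_append, List.length_cons] at hn ⊢
        omega
      · exact (weight_append x y z L₁ L₂).trans hp
  intro n p hnp
  rw [himage, himage]
  refine (exactOn_image_iff (S := chainSet x z [] ×ˢ chainSet z y F) ?_ (fun q hq => hq.1)
    (fun q hq => hq.1) ?_ ?_).2 (hprod n p hnp)
  · rintro ⟨L₁, L₂⟩ ⟨hL₁, -⟩ ⟨M₁, M₂⟩ ⟨hM₁, -⟩ heq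
    obtain ⟨h1, h2⟩ := eq_and_eq_of_append_eq hL₁.1 hM₁.1 heq
    exact Prod.ext h1 h2
  · rintro ⟨L₁, L₂⟩ ⟨hL₁, hL₂⟩
    rw [prodDiff_single]
    refine add_mem (map_mem_of_supported (fun L hL => ?_)
        ((hℓ.isFiltered (k := k) x z []).isWeighted.mem L₁ hL₁))
      (Submodule.smul_mem _ _ (map_mem_of_supported (fun L hL => ?_)
        ((hℓ.isFiltered (k := k) z y F).isWeighted.mem L₂ hL₂)))
    · rw [lmapDomain_apply, mapDomain_single]
      exact single_mem_supported k _ ⟨hL.1, hL₂⟩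
    · rw [lmapDomain_apply, mapDomain_single]
      exact single_mem_supported k _ ⟨hL₁, hL.1⟩
  · rintro ⟨L₁, L₂⟩ ⟨hL₁, hL₂⟩
    rw [prodDiff_single, leading_single, leading_single, leading_single, faceMap_single,
      faceMap_single, faceMap_single, erasures_append (m := {v | v ∈ z :: F}) List.mem_cons_self,
      map_add, map_add, map_smul, map_smul, keep_mapDomain, keep_mapDomain]
    · have e1 : erasures k {v | v ∈ z :: F} L₁ = erasures k {v | v ∈ ([] : List P)} L₁ := by
        refine erasures_congr fun v hv => ⟨fun hvF => ?_, fun h => absurd h List.not_mem_nil⟩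
        have hvz := (hL₁.1.mem_lt hv).2
        rcases List.mem_cons.1 hvF with rfl | hvF
        · exact absurd hvz (lt_irrefl _)
        · exact absurd (hvz.trans (hF.mem_lt hvF).1) (lt_irrefl _)
      have e2 : erasures k {v | v ∈ z :: F} L₂ = erasures k {v | v ∈ F} L₂ := by
        refine erasures_congr fun v hv =>
          ⟨fun hvF => (List.mem_cons.1 hvF).resolve_left (hL₂.1.mem_lt hv).1.ne',
            fun hvF => List.mem_cons_of_mem _ hvF⟩
      have s1 : (fun L => L ++ z :: L₂) ⁻¹'
          {L | weight ℓ x L y = weight ℓ x (L₁ ++ z :: L₂) y} =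
          {L | weight ℓ x L z = weight ℓ x L₁ z} := by
        ext L
        simp only [Set.mem_preimage, Set.mem_ofPred_eq, weight_append]
        omega
      have s2 : (fun L => L₁ ++ z :: L) ⁻¹'
          {L | weight ℓ x L y = weight ℓ x (L₁ ++ z :: L₂) y} =
          {L | weight ℓ z L y = weight ℓ z L₂ y} := by
        ext L
        simp only [Set.mem_preimage, Set.mem_ofPred_eq, weight_append]
        omega
      rw [e1, e2, s1, s2]
      simp only [lmapDomain_lmapDomain]
      -- The product differential uses the number of steps, one more than the number of points, and
      -- adds one again; the two extra signs cancel.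
      rw [pow_succ, pow_succ, mul_assoc, neg_one_mul, neg_neg, mul_one]
    · intro v hv hvF
      have hvz := (hL₁.1.mem_lt hv).2
      rcases List.mem_cons.1 hvF with rfl | hvF
      · exact absurd hvz (lt_irrefl _)
      · exact absurd (hvz.trans (hF.mem_lt hvF).1) (lt_irrefl _)

/-- Linear exactness of all intervals implies that of all links. -/
theorem IsLength.linExactThrough (hℓ : IsLength ℓ)
    (h : ∀ x y : P, x < y → LinExactThrough k ℓ x y []) {x y : P} {F : List P}
    (hF : Between x F y) : LinExactThrough k ℓ x y F := by
  induction F generalizing x with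
  | nil => exact h x y hF
  | cons z F ih => exact hℓ.linExactThrough_cons hF.2 (h x z hF.1) (ih hF.2)

end Erasures

end ChainList

end

/-! ### The bar construction of lists of classes as a sum of chain complexes -/

section

open Finsupp

namespace PathBasis

variable {k : Type u} [Field k] {R : Type w} [Ring R] {O Q : Type v} [Fintype O]
  (β : PathBasis k R O Q)

/-- The differential of the bar construction with coefficients in `k`, as a linear map. -/
noncomputable def barLinear : (List Q →₀ k) →ₗ[k] (List Q →₀ k) where
  toFun := β.bar k
  map_add' := map_add _
  map_smul' c f := by
    -- Multiplication by a scalar is a change of coefficients, with which the differential commutes.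
    have h : ∀ f : List Q →₀ k,
        Finsupp.mapRange.addMonoidHom (AddMonoidHom.mulLeft c) f = c • f := fun f => by
      ext l
      rfl
    rw [← h, bar_mapRange, h]
    rfl

theorem barLinear_apply (f : List Q →₀ k) : β.barLinear f = β.bar k f := rfl

theorem listExactAt_iff (i p : ℕ) : β.ListExactAt i p ↔
    ExactOn β.barLinear (stratum {l | β.Valid l} List.length β.wt i p)
      (stratum {l | β.Valid l} List.length β.wt (i + 1) p) := by
  have h : ∀ i (f : List Q →₀ k), f ∈ β.listChain i p ↔
      f ∈ supported k k (stratum {l | β.Valid l} List.length β.wt i p) := by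
    intro i f
    rw [mem_supported', listChain, Finsupp.mem_constrained]
    refine forall_congr' fun l => ?_
    rw [AddSubgroup.mem_cell]
    constructor
    · rintro (h | h) h'
      · exact h
      · exact absurd h.1 h'
    · intro h'
      by_cases hl : l ∈ stratum {l | β.Valid l} List.length β.wt i p
      · exact Or.inr ⟨hl, trivial⟩
      · exact Or.inl (h' hl)
  simp only [ListExactAt, ExactOn, h, barLinear_apply]

end PathBasis

namespace ReducedIncidence

open ChainList

variable {P : Type v} [PartialOrder P] (r : Setoid (NonemptyInterval P))

open Classical in
/-- The class of the interval `[x,y]`; the class of `[x,x]` if `x ≤ y` does not hold. -/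
noncomputable def intervalClass (x y : P) : Quotient r :=
  if h : x ≤ y then Quotient.mk r (cl h) else Quotient.mk r (NonemptyInterval.pure x)

variable {r} in
theorem intervalClass_of_le {x y : P} (h : x ≤ y) :
    intervalClass r x y = Quotient.mk r (cl h) := dif_pos h

/-- The classes of the steps of a chain from `x` to `y`. -/
noncomputable def steps : P → List P → P → List (Quotient r)
  | x, [], y => [intervalClass r x y]
  | x, z :: L, y => intervalClass r x z :: steps z L y

/-- The length of the class of an interval. -/
noncomputable def intervalLength (x y : P) : ℕ := length (intervalClass r x y)

variable {r}

/-- A list of classes with a given composite. -/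
def IsProduct : List (Quotient r) → Quotient r → Prop
  | [], _ => False
  | [a], c => a = c
  | a :: b :: l, c => ∃ d, IsProduct (b :: l) d ∧ Composes r a d c

theorem length_steps (x y : P) (L : List P) : (steps r x L y).length = L.length + 1 := by
  induction L generalizing x with
  | nil => rfl
  | cons z L ih => rw [steps, List.length_cons, ih, List.length_cons]

/-- The first point w after the start, the later steps and their weight do not depend on where the
chain starts. Erasing the point in front of w therefore affects only the first class. -/
theorem steps_eq_cons {z y : P} {L : List P} (h : Between z L y) :
    ∃ w t s, z < w ∧ ∀ x, steps r x L y = intervalClass r x w :: t ∧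
      weight (intervalLength r) x L y = intervalLength r x w + s := by
  cases L with
  | nil => exact ⟨y, [], 0, h, fun x => ⟨rfl, rfl⟩⟩
  | cons w L => exact ⟨w, _, _, h.1, fun x => ⟨rfl, rfl⟩⟩

theorem isProduct_cons {a c : Quotient r} {l : List (Quotient r)} (hl : l ≠ []) :
    IsProduct (a :: l) c ↔ ∃ d, IsProduct l d ∧ Composes r a d c := by
  cases l with
  | nil => exact absurd rfl hl
  | cons b l => exact Iff.rfl

theorem steps_ne_nil (x y : P) (L : List P) : steps r x L y ≠ [] := by
  cases L <;> exact List.cons_ne_nil _ _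

theorem isProduct_steps {x y : P} {L : List P} (h : Between x L y) :
    IsProduct (steps r x L y) (intervalClass r x y) := by
  induction L generalizing x with
  | nil => rfl
  | cons z L ih =>
    refine (isProduct_cons (steps_ne_nil _ _ _)).2 ⟨_, ih h.2, ?_⟩
    rw [intervalClass_of_le h.1.le, intervalClass_of_le h.2.lt.le,
      intervalClass_of_le (h.1.le.trans h.2.lt.le)]
    exact composes_mk _ _

section Axioms

variable [hr : Axioms r]

theorem IsProduct.unique {l : List (Quotient r)} {c c' : Quotient r} (h : IsProduct l c)
    (h' : IsProduct l c') : c = c' := by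
  induction l generalizing c c' with
  | nil => exact h.elim
  | cons a l ih =>
    cases l with
    | nil => exact h.symm.trans h'
    | cons b l =>
      obtain ⟨d, h1, h2⟩ := h
      obtain ⟨d', h1', h2'⟩ := h'
      rw [ih h1 h1'] at h2
      exact h2.unique h2'

/-- The rest of the list has a well-defined composite. This and the first class are the two classes
into which the first point cuts [x,y], and `eq_of_mk_eq` recovers the point from them. -/
theorem steps_injective {x y : P} {L L' : List P} (h : Between x L y) (h' : Between x L' y)
    (heq : steps r x L y = steps r x L' y) : L = L' := by
  induction L generalizing x L' with
  | nil =>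
    have := congrArg List.length heq
    rw [length_steps, length_steps] at this
    exact (List.length_eq_zero_iff.1 (by simpa using this.symm)).symm
  | cons z L ih =>
    cases L' with
    | nil =>
      have := congrArg List.length heq
      rw [length_steps, length_steps] at this
      simp at this
    | cons z' L' =>
      obtain ⟨h1, h2⟩ := List.cons.inj heq
      have h3 := (isProduct_steps h.2).unique (h2 ▸ isProduct_steps h'.2 : IsProduct _ _)
      have hz : z = z' := by
        rw [intervalClass_of_le h.1.le, intervalClass_of_le h'.1.le] at h1
        rw [intervalClass_of_le h.2.lt.le, intervalClass_of_le h'.2.lt.le] at h3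
        exact eq_of_mk_eq h1 h3
      subst hz
      rw [ih h.2 h'.2 h2]

section Finite

variable [LocallyFiniteOrder P]

theorem exists_between_of_long {n : ℕ} {x y : P} (hxy : x < y)
    (h : Long r (n + 1) (intervalClass r x y)) : ∃ L, Between x L y ∧ L.length = n := by
  induction n generalizing x with
  | zero => exact ⟨[], hxy, rfl⟩
  | succ n ih =>
    obtain ⟨a, b, ha, hc, hb⟩ := h
    rw [intervalClass_of_le hxy.le] at hc
    obtain ⟨z, h1, h2, rfl, rfl⟩ := hc.existsUnique
    rw [mk_mem_range_iff] at ha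
    have hzy : z < y := length_ne_zero_iff (r := r) (h := h2) |>.1 (by
      have := long_iff.1 hb
      omega)
    obtain ⟨L, hL, hl⟩ := ih hzy (by rwa [intervalClass_of_le h2])
    exact ⟨z :: L, ⟨lt_of_le_of_ne h1 ha, hL⟩, by rw [List.length_cons, hl]⟩

variable (r) in
theorem isLength_intervalLength : IsLength (intervalLength r) where
  add_le {x y z} hxy hyz := by
    rw [intervalLength, intervalLength, intervalLength, intervalClass_of_le hxy.le,
      intervalClass_of_le hyz.le, intervalClass_of_le (hxy.le.trans hyz.le)]
    exact (composes_mk _ _).length_le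
  exists_chain {x y} hxy := by
    have hpos : intervalLength r x y ≠ 0 := by
      rw [intervalLength, intervalClass_of_le hxy.le]
      exact length_ne_zero_iff.2 hxy
    obtain ⟨n, hn⟩ := Nat.exists_eq_succ_of_ne_zero hpos
    obtain ⟨L, hL, hl⟩ := exists_between_of_long (r := r) (n := n) hxy (long_iff.2 hn.ge)
    exact ⟨L, hL, by rw [hl, hn]⟩

end Finite

end Axioms

end ReducedIncidence

namespace ReducedIncidenceAlgebra

open ReducedIncidence ChainList

variable (k : Type u) [Field k] {P : Type v} [PartialOrder P] [LocallyFiniteOrder P]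
  (r : Setoid (NonemptyInterval P)) [hr : Axioms r]

attribute [local instance] pointFintype

theorem valid_steps {x y : P} {L : List P} (h : Between x L y) :
    (grBasis k r).Valid (steps r x L y) := by
  induction L generalizing x with
  | nil =>
    refine (grBasis k r).valid_cons.2 ⟨?_, fun b hb => (Option.some_ne_none _ hb.symm).elim,
      (grBasis k r).valid_nil⟩
    rw [intervalClass_of_le (le_of_lt h)]
    exact length_ne_zero_iff.2 h
  | cons z L ih =>
    refine (grBasis k r).valid_cons.2 ⟨?_, fun b hb => ?_, ih h.2⟩
    · rw [intervalClass_of_le h.1.le]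
      exact length_ne_zero_iff.2 h.1
    · obtain ⟨w, t, s, hw, hs⟩ := steps_eq_cons (r := r) h.2
      rw [(hs z).1] at hb
      obtain rfl := Option.some.inj hb
      rw [intervalClass_of_le h.1.le, intervalClass_of_le hw.le]
      rfl

theorem wt_steps (x y : P) (L : List P) :
    (grBasis k r).wt (steps r x L y) = weight (intervalLength r) x L y := by
  induction L generalizing x with
  | nil => exact (grBasis k r).wt_cons _ _
  | cons z L ih => rw [steps, PathBasis.wt_cons, ih]; rfl

/-- Composites are taken for the partial composition of classes, with no condition on lengths, so a
composable list always has one, even where its product in the graded ring is zero. -/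
theorem exists_isProduct {l : List (Quotient r)} (hl : (grBasis k r).Valid l) (h0 : l ≠ []) :
    ∃ c, IsProduct l c ∧ ∀ b ∈ l.head?, source c = source b := by
  induction l with
  | nil => exact absurd rfl h0
  | cons a l ih =>
    obtain ⟨h1, h2, h3⟩ := (grBasis k r).valid_cons.1 hl
    by_cases hn : l = []
    · subst hn
      exact ⟨a, rfl, fun b hb => by rw [Option.some.inj hb]⟩
    · obtain ⟨d, hd, hs⟩ := ih h3 hn
      obtain ⟨b, l, rfl⟩ := List.exists_cons_of_ne_nil hn
      obtain ⟨c, hc⟩ := exists_composes_iff.2 ((h2 b rfl).trans (hs b rfl).symm)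
      exact ⟨c, ⟨d, hd, hc⟩, fun b hb => by rw [← Option.some.inj hb, hc.source]⟩

/-- Invariance places any factorization of the class of [x,y] inside the chosen representative, one
factor at a time. -/
theorem exists_steps {l : List (Quotient r)} (hl : (grBasis k r).Valid l) {x y : P} (hxy : x ≤ y)
    (h : IsProduct l (Quotient.mk r (cl hxy))) : ∃ L, Between x L y ∧ steps r x L y = l := by
  induction l generalizing x with
  | nil => exact h.elim
  | cons a l ih =>
    obtain ⟨h1, -, h3⟩ := (grBasis k r).valid_cons.1 hl
    cases l with
    | nil =>
      obtain rfl : a = _ := h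
      exact ⟨[], length_ne_zero_iff.1 h1, by rw [steps, intervalClass_of_le hxy]⟩
    | cons b l =>
      obtain ⟨d, hd, hc⟩ := h
      obtain ⟨z, h4, h5, rfl, rfl⟩ := hc.existsUnique
      obtain ⟨L, hL, hs⟩ := ih h3 h5 hd
      exact ⟨z :: L, ⟨length_ne_zero_iff.1 h1, hL⟩, by rw [steps, hs, intervalClass_of_le h4]⟩

/-- Merging two neighbouring classes erases the point between them. The graded product vanishes
exactly if this changes the weight, so the bar differential is the weight-preserving part of the
alternating sum of erasures. -/
theorem bar_steps {x y : P} {L : List P} (h : Between x L y) :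
    (grBasis k r).barLinear (single (steps r x L y) 1) =
      lmapDomain k k (fun L => steps r x L y)
        (keep k {L' | weight (intervalLength r) x L' y = weight (intervalLength r) x L y}
          (erasures k {z | z ∈ ([] : List P)} L)) := by
  rw [PathBasis.barLinear_apply]
  induction L generalizing x with
  | nil => simp [steps, erasures, PathBasis.bar_cons]
  | cons z L ih =>
    rw [steps, PathBasis.bar_cons, ih h.2, erasures_cons_of_notMem (m := {z | z ∈ ([] : List P)})
      (fun h => List.not_mem_nil h), map_sub, map_sub, keep_mapDomain]
    congr 1
    · obtain ⟨w, t, s, hzw, hs⟩ := steps_eq_cons (r := r) h.2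
      rw [(hs z).1, PathBasis.merge_cons]
      have hiff : L ∈ {L' | weight (intervalLength r) x L' y =
          weight (intervalLength r) x (z :: L) y} ↔
          intervalLength r x w = intervalLength r x z + intervalLength r z w := by
        change weight (intervalLength r) x L y =
          intervalLength r x z + weight (intervalLength r) z L y ↔ _
        rw [(hs x).2, (hs z).2]
        omega
      have hcomp : Composes r (intervalClass r x z) (intervalClass r z w)
          (intervalClass r x w) := by
        rw [intervalClass_of_le h.1.le, intervalClass_of_le hzw.le,
          intervalClass_of_le (h.1.le.trans hzw.le)]
        exact composes_mk _ _
      change (mul? (intervalClass r x z) (intervalClass r z w)).elim 0 _ = _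
      by_cases hL : L ∈ {L' | weight (intervalLength r) x L' y =
          weight (intervalLength r) x (z :: L) y}
      · rw [keep_of_mem (single_mem_supported k _ hL), lmapDomain_single, (hs x).1,
          mul?_eq_some.2 ⟨hcomp, hiff.1 hL⟩]
        rfl
      · rw [keep_of_mem_compl (single_mem_supported k _ hL), map_zero]
        cases hm : mul? (intervalClass r x z) (intervalClass r z w) with
        | none => rfl
        | some c =>
          obtain ⟨h1, h2⟩ := mul?_eq_some.1 hm
          rw [h1.unique hcomp] at h2
          exact absurd (hiff.2 h2) hL
    · rw [lmapDomain_lmapDomain]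
      have hset : List.cons z ⁻¹' {L' | weight (intervalLength r) x L' y =
          weight (intervalLength r) x (z :: L) y} =
          {L' | weight (intervalLength r) z L' y = weight (intervalLength r) z L y} := by
        ext L'
        exact Nat.add_left_cancel_iff
      rw [hset]
      exact lmapDomain_lmapDomain _ _ _

open Classical in
/-- The composite of a list of classes, if it exists. -/
noncomputable def composite? (l : List (Quotient r)) : Option (Quotient r) :=
  if h : ∃ c, IsProduct l c then some h.choose else none

theorem composite?_eq_some {l : List (Quotient r)} {c : Quotient r} :
    composite? r l = some c ↔ IsProduct l c := by
  unfold composite?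
  constructor
  · intro h
    split_ifs at h with h'
    exact Option.some.inj h ▸ h'.choose_spec
  · intro h
    have h' : ∃ c, IsProduct l c := ⟨c, h⟩
    rw [dif_pos h', h'.choose_spec.unique h]

theorem image_steps {x y : P} (hxy : x ≤ y) (n p : ℕ) :
    (fun L => steps r x L y) '' stratum (chainSet x y []) (fun L => L.length + 1)
        (fun L => weight (intervalLength r) x L y) n p =
      stratum {l | (grBasis k r).Valid l} List.length (grBasis k r).wt n p ∩
        {l | composite? r l = some (Quotient.mk r (cl hxy))} := by
  ext l
  constructor
  · rintro ⟨L, ⟨⟨h1, -⟩, h2, h3⟩, rfl⟩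
    refine ⟨⟨valid_steps k r h1, (length_steps _ _ _).trans h2, (wt_steps k r _ _ _).trans h3⟩,
      (composite?_eq_some r).2 ?_⟩
    rw [← intervalClass_of_le hxy]
    exact isProduct_steps h1
  · rintro ⟨⟨h1, h2, h3⟩, h4⟩
    obtain ⟨L, hL, rfl⟩ := exists_steps k r h1 hxy ((composite?_eq_some r).1 h4)
    exact ⟨L, ⟨⟨hL, fun z hz => absurd hz List.not_mem_nil⟩, (length_steps _ _ _).symm.trans h2,
      (wt_steps k r _ _ _).symm.trans h3⟩, rfl⟩

theorem barLinear_mem_composite {l : List (Quotient r)} (hl : (grBasis k r).Valid l)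
    (h0 : l ≠ []) : (grBasis k r).barLinear (single l 1) ∈
      supported k k {l' | composite? r l' = composite? r l} := by
  obtain ⟨c, hc, -⟩ := exists_isProduct k r hl h0
  obtain ⟨x, y, hxy, rfl⟩ := exists_rep c
  obtain ⟨L, hL, rfl⟩ := exists_steps k r hl hxy hc
  rw [bar_steps k r hL]
  refine map_mem_of_supported (fun L' hL' => ?_) (supported_mono Set.inter_subset_left
    (keep_mem _ ((isLength_intervalLength r).erasures_mem (m := {z | z ∈ ([] : List P)}) hL)))
  rw [lmapDomain_single]
  refine single_mem_supported k _ ?_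
  rw [Set.mem_ofPred_eq, (composite?_eq_some r).2 hc, composite?_eq_some,
    ← intervalClass_of_le hxy]
  exact isProduct_steps hL'.1

theorem exactOn_fiber_iff {x y : P} (hxy : x ≤ y) (n p : ℕ) :
    ExactOn (grBasis k r).barLinear
        (stratum {l | (grBasis k r).Valid l} List.length (grBasis k r).wt n p ∩
          {l | composite? r l = some (Quotient.mk r (cl hxy))})
        (stratum {l | (grBasis k r).Valid l} List.length (grBasis k r).wt (n + 1) p ∩
          {l | composite? r l = some (Quotient.mk r (cl hxy))}) ↔
      ExactOn (leading (fun L => weight (intervalLength r) x L y)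
          (faceMap k {z | z ∈ ([] : List P)}))
        (stratum (chainSet x y []) (fun L => L.length + 1)
          (fun L => weight (intervalLength r) x L y) n p)
        (stratum (chainSet x y []) (fun L => L.length + 1)
          (fun L => weight (intervalLength r) x L y) (n + 1) p) := by
  have hw := ((isLength_intervalLength r).isFiltered (k := k) x y []).isWeighted
  rw [← image_steps, ← image_steps]
  refine exactOn_image_iff (S := chainSet x y []) (fun L hL L' hL' h =>
    steps_injective hL.1 hL'.1 h) (fun L hL => hL.1) (fun L hL => hL.1)
    (fun L hL => supported_mono (fun L' hL' => hL'.1) (hw.mem L hL)) (fun L hL => ?_)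
  rw [leading_single, faceMap_single, bar_steps k r hL.1]

/-- The bar differential preserves composites, so exactness is tested for one composite at a time,
and there the complex is that of the chains in any representing interval. -/
theorem listExactAt_iff_linExactThrough :
    (∀ i p : ℕ, i + 1 < p → (grBasis k r).ListExactAt (i + 1) p) ↔
      ∀ x y : P, x < y → LinExactThrough k (intervalLength r) x y [] := by
  have hne : ∀ n p (l : List (Quotient r)),
      l ∈ stratum {l | (grBasis k r).Valid l} List.length (grBasis k r).wt (n + 1) p → l ≠ [] := by
    rintro n p l ⟨-, h, -⟩ rfl
    exact absurd h (Nat.succ_ne_zero n).symm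
  simp only [PathBasis.listExactAt_iff]
  constructor
  · intro H x y hxy n p hnp
    cases n with
    | zero =>
      intro f hf _
      refine ⟨0, zero_mem _, ?_⟩
      have hempty : stratum (chainSet x y []) (fun L => L.length + 1)
          (fun L => weight (intervalLength r) x L y) 0 p = ∅ := by
        refine Set.eq_empty_iff_forall_notMem.2 ?_
        rintro L ⟨-, h, -⟩
        exact absurd h (Nat.succ_ne_zero _)
      rw [hempty, supported_empty, Submodule.mem_bot] at hf
      rw [hf, map_zero]
    | succ n =>
      exact (exactOn_fiber_iff k r hxy.le (n + 1) p).1 (exactOn_fiber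
        (fun l hl => barLinear_mem_composite k r hl.1 (hne _ _ l hl)) (H n p hnp) _)
  · intro H n p hnp
    refine exactOn_of_fibers (c := composite? r)
      (fun l hl => barLinear_mem_composite k r hl.1 (hne _ _ l hl)) fun c => ?_
    -- The summand without a composite is zero, since valid nonempty lists have one. The summand of
    -- an identity is zero, since no chain leads from x to x.
    cases c with
    | none =>
      intro f hf _
      refine ⟨0, zero_mem _, ?_⟩
      have hempty : stratum {l | (grBasis k r).Valid l} List.length (grBasis k r).wt (n + 1) p ∩
          {l | composite? r l = none} = ∅ := by
        refine Set.eq_empty_iff_forall_notMem.2 ?_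
        rintro l ⟨hl, h⟩
        obtain ⟨c, hc, -⟩ := exists_isProduct k r hl.1 (hne _ _ l hl)
        rw [Set.mem_ofPred_eq, (composite?_eq_some r).2 hc] at h
        exact Option.some_ne_none _ h
      rw [hempty, supported_empty, Submodule.mem_bot] at hf
      rw [hf, map_zero]
    | some c =>
      obtain ⟨x, y, hxy, rfl⟩ := exists_rep c
      refine (exactOn_fiber_iff k r hxy (n + 1) p).2 ?_
      rcases hxy.lt_or_eq with hlt | rfl
      · exact H x y hlt (n + 1) p hnp
      · intro f hf _
        refine ⟨0, zero_mem _, ?_⟩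
        have hempty : stratum (chainSet x x []) (fun L => L.length + 1)
            (fun L => weight (intervalLength r) x L x) (n + 1) p = ∅ := by
          refine Set.eq_empty_iff_forall_notMem.2 ?_
          rintro L ⟨h, -⟩
          exact lt_irrefl _ h.1.lt
        rw [hempty, supported_empty, Submodule.mem_bot] at hf
        rw [hf, map_zero]

end ReducedIncidenceAlgebra

end

/-! ### Simplicial boundaries, links and sequential layers of order complexes -/

section

open Finsupp

theorem FaceComplex.reducedHomologyVanishes_iff (k : Type u) [Field k] {V : Type v} [LinearOrder V]
    (Δ : FaceComplex V) (i : ℤ) : Δ.ReducedHomologyVanishes k i ↔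
      ExactOn (FaceComplex.boundary k V) {G | G ∈ Δ.faces ∧ (G.card : ℤ) - 1 = i}
        {G | G ∈ Δ.faces ∧ (G.card : ℤ) - 1 = i + 1} := by
  constructor
  · intro H f hf hdf
    exact H ⟨hf, hdf⟩
  · rintro H f ⟨hf, hdf⟩
    exact H f hf hdf

theorem FaceComplex.boundary_single (k : Type u) [Field k] {V : Type v} [LinearOrder V]
    (G : Finset V) : FaceComplex.boundary k V (single G 1) =
      ∑ v ∈ G, single (G.erase v) ((-1 : k) ^ (G.filter (· < v)).card) := by
  rw [FaceComplex.boundary, linearCombination_single, one_smul]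

/-- A new least vertex shifts the position of every other vertex by one. This is the recursion that
defines `erasures`. -/
theorem FaceComplex.boundary_insert (k : Type u) [Field k] {V : Type v} [LinearOrder V]
    {G : Finset V} {v : V} (h : ∀ u ∈ G, v < u) :
    FaceComplex.boundary k V (single (insert v G) 1) =
      single G 1 - lmapDomain k k (insert v) (FaceComplex.boundary k V (single G 1)) := by
  have hv : v ∉ G := fun hv => lt_irrefl _ (h v hv)
  rw [boundary_single, boundary_single, Finset.sum_insert hv, map_sum, sub_eq_add_neg,
    ← Finset.sum_neg_distrib]
  congr 1
  · rw [Finset.erase_insert hv, Finset.filter_eq_empty_iff.2, Finset.card_empty, pow_zero]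
    intro u hu
    rcases Finset.mem_insert.1 hu with rfl | hu
    · exact lt_irrefl _
    · exact (h u hu).not_gt
  · refine Finset.sum_congr rfl fun u hu => ?_
    rw [lmapDomain_single, Finset.erase_insert_of_ne (h u hu).ne, Finset.filter_insert,
      if_pos (h u hu), Finset.card_insert_of_notMem fun h' => hv (Finset.mem_filter.1 h').1,
      pow_succ, mul_neg_one, single_neg]

namespace ChainList

variable {P : Type v} {V : Type x} [LinearOrder V] {val : V → P}

open Classical in
/-- The set of the vertices of a list that are not in `m`. -/
noncomputable def faceOf (hval : Function.Injective val) (m : Set P) (L : List P) : Finset V :=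
  (L.toFinset.filter (· ∉ m)).preimage val hval.injOn

variable {hval : Function.Injective val} {m : Set P}

theorem mem_faceOf {L : List P} {v : V} : v ∈ faceOf hval m L ↔ val v ∈ L ∧ val v ∉ m := by
  simp [faceOf]

theorem faceOf_cons_of_mem {z : P} (hz : z ∈ m) (L : List P) :
    faceOf hval m (z :: L) = faceOf hval m L := by
  ext v
  rw [mem_faceOf, mem_faceOf, List.mem_cons]
  constructor
  · rintro ⟨h | h, h'⟩
    · exact absurd (h ▸ hz) h'
    · exact ⟨h, h'⟩
  · rintro ⟨h, h'⟩
    exact ⟨Or.inr h, h'⟩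

theorem faceOf_cons_of_notMem {v : V} (hv : val v ∉ m) (L : List P) :
    faceOf hval m (val v :: L) = insert v (faceOf hval m L) := by
  ext u
  rw [Finset.mem_insert, mem_faceOf, mem_faceOf, List.mem_cons]
  constructor
  · rintro ⟨h | h, h'⟩
    · exact Or.inl (hval h)
    · exact Or.inr ⟨h, h'⟩
  · rintro (rfl | ⟨h, h'⟩)
    · exact ⟨Or.inl rfl, hv⟩
    · exact ⟨Or.inr h, h'⟩

variable [PartialOrder P]

/-- The order of the vertices extends that of the poset, so listing a chain upwards lists the face
in the orientation order and the signs agree. Points of m belong to no face and contribute no sign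
on either side. -/
theorem boundary_faceOf (k : Type u) [Field k] (hlt : ∀ u v, val u < val v → u < v) {x y : P}
    {L : List P} (h : Between x L y) (hL : ∀ z ∈ L, z ∈ Set.range val) :
    FaceComplex.boundary k V (single (faceOf hval m L) 1) =
      lmapDomain k k (faceOf hval m) (erasures k m L) := by
  induction L generalizing x with
  | nil =>
    have : faceOf hval m [] = ∅ := by
      ext v
      rw [mem_faceOf]
      simp
    rw [this, FaceComplex.boundary_single, Finset.sum_empty, erasures, map_zero]
  | cons z L ih =>
    have ih' := ih h.2 fun w hw => hL w (List.mem_cons_of_mem _ hw)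
    by_cases hz : z ∈ m
    · rw [faceOf_cons_of_mem hz, erasures_cons_of_mem hz, ih', lmapDomain_lmapDomain]
      simp only [faceOf_cons_of_mem hz]
    · obtain ⟨v, rfl⟩ := hL z List.mem_cons_self
      rw [faceOf_cons_of_notMem hz, erasures_cons_of_notMem hz, FaceComplex.boundary_insert k, ih',
        map_sub, lmapDomain_single, lmapDomain_lmapDomain, lmapDomain_lmapDomain]
      · simp only [faceOf_cons_of_notMem hz]
      · exact fun u hu => hlt _ _ (h.2.mem_lt (mem_faceOf.1 hu).1).1

variable {x y : P}

theorem faceOf_injOn (hr : Set.range val = Set.Ioo x y) (F : List P) :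
    Set.InjOn (faceOf hval {z | z ∈ F}) (chainSet x y F) := by
  have key : ∀ L ∈ chainSet x y F, ∀ L' ∈ chainSet x y F,
      faceOf hval {z | z ∈ F} L = faceOf hval {z | z ∈ F} L' → ∀ z ∈ L, z ∈ L' := by
    intro L hL L' hL' heq z hz
    by_cases hzF : z ∈ F
    · exact hL'.2 z hzF
    · obtain ⟨v, rfl⟩ : z ∈ Set.range val := hr ▸ hL.1.mem_lt hz
      exact (mem_faceOf.1 (heq ▸ mem_faceOf.2 ⟨hz, hzF⟩ :
        v ∈ faceOf hval {z | z ∈ F} L')).1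
  exact fun L hL L' hL' heq => hL.1.eq_of_mem_iff hL'.1 fun z =>
    ⟨key L hL L' hL' heq z, key L' hL' L hL heq.symm z⟩

theorem card_of_mem_iff (hval : Function.Injective val) (hr : Set.range val = Set.Ioo x y)
    {L : List P} (h : Between x L y) {S : Finset V} (hS : ∀ v, v ∈ S ↔ val v ∈ L) :
    S.card = L.length := by
  classical
  rw [← List.toFinset_card_of_nodup h.nodup, ← Finset.card_image_of_injective S hval]
  congr 1
  ext z
  rw [Finset.mem_image, List.mem_toFinset]
  constructor
  · rintro ⟨v, hv, rfl⟩
    exact (hS v).1 hv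
  · intro hz
    obtain ⟨v, rfl⟩ : z ∈ Set.range val := hr ▸ h.mem_lt hz
    exact ⟨v, (hS v).2 hz, rfl⟩

theorem exists_between_of_face (hr : Set.range val = Set.Ioo x y) (hxy : x < y) (S : Finset V)
    (hS : ∀ u ∈ S, ∀ v ∈ S, val u ≤ val v ∨ val v ≤ val u) (hval : Function.Injective val) :
    ∃ L, Between x L y ∧ ∀ v, v ∈ S ↔ val v ∈ L := by
  classical
  obtain ⟨L, hL, hLS⟩ := exists_between (S.image val) hxy
    (fun z hz => by
      obtain ⟨v, -, rfl⟩ := Finset.mem_image.1 hz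
      have : val v ∈ Set.Ioo x y := hr ▸ Set.mem_range_self v
      exact this)
    (fun z hz w hw => by
      obtain ⟨u, hu, rfl⟩ := Finset.mem_image.1 hz
      obtain ⟨v, hv, rfl⟩ := Finset.mem_image.1 hw
      exact hS u hu v hv)
  refine ⟨L, hL, fun v => ?_⟩
  rw [hLS, Finset.mem_image]
  exact ⟨fun h => ⟨v, h, rfl⟩, fun ⟨u, hu, e⟩ => hval e ▸ hu⟩

section Link

variable {Δ : FaceComplex V} {ℓ : P → P → ℕ} {F : List P} {F₀ : Finset V}

/-- A face G of the link corresponds to the chain L formed by G and F. Its number of steps is |L| +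
1 = |G| + |F| + 1, and dim G = |G| − 1, whence the shift by |F| + 2. A refinement of maximal size
yields the larger face required by the layer; conversely a larger face bounds the weight from below.
-/
theorem IsLength.image_layerStratum (hℓ : IsLength ℓ) (hr : Set.range val = Set.Ioo x y)
    (hΔ : ∀ G, G ∈ Δ.faces ↔ ∀ u ∈ G, ∀ v ∈ G, val u ≤ val v ∨ val v ≤ val u)
    (hF : Between x F y) (hF₀ : ∀ v, v ∈ F₀ ↔ val v ∈ F) {i j : ℤ} {n p : ℕ}
    (hn : (n : ℤ) = i + F.length + 2) (hp : (p : ℤ) = j + F.length + 2) :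
    faceOf hval {z | z ∈ F} '' layerStratum (chainSet x y F) (fun L => L.length + 1)
        (fun L => weight ℓ x L y) n p =
      {G | G ∈ ((Δ.link F₀).layer j).faces ∧ (G.card : ℤ) - 1 = i} := by
  have hdisj : ∀ L, F₀ ∩ faceOf hval {z | z ∈ F} L = ∅ := by
    intro L
    rw [Finset.eq_empty_iff_forall_notMem]
    intro v hv
    obtain ⟨h1, h2⟩ := Finset.mem_inter.1 hv
    exact (mem_faceOf.1 h2).2 ((hF₀ v).1 h1)
  have hunion : ∀ L ∈ chainSet x y F, ∀ v,
      v ∈ F₀ ∪ faceOf hval {z | z ∈ F} L ↔ val v ∈ L := by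
    intro L hL v
    rw [Finset.mem_union, hF₀, mem_faceOf]
    constructor
    · rintro (h | h)
      · exact hL.2 _ h
      · exact h.1
    · intro h
      by_cases hv : val v ∈ F
      · exact Or.inl hv
      · exact Or.inr ⟨h, hv⟩
  have hcardF := card_of_mem_iff hval hr hF hF₀
  have hcard : ∀ L ∈ chainSet x y F,
      F.length + (faceOf hval {z | z ∈ F} L).card = L.length := by
    intro L hL
    rw [← hcardF, ← Finset.card_union_of_disjoint (Finset.disjoint_iff_inter_eq_empty.2 (hdisj L)),
      card_of_mem_iff hval hr hL.1 (hunion L hL)]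
  have hlink : ∀ L ∈ chainSet x y F, faceOf hval {z | z ∈ F} L ∈ (Δ.link F₀).faces := by
    intro L hL
    refine ⟨(hΔ _).2 fun u hu v hv => hL.1.comparable (mem_faceOf.1 hu).1 (mem_faceOf.1 hv).1,
      (hΔ _).2 fun u hu v hv => hL.1.comparable ((hunion L hL u).1 hu) ((hunion L hL v).1 hv),
      hdisj L⟩
  have hlist : ∀ G ∈ (Δ.link F₀).faces,
      ∃ L ∈ chainSet x y F, faceOf hval {z | z ∈ F} L = G := by
    rintro G ⟨-, h1, h2⟩
    obtain ⟨L, hL, hLG⟩ := exists_between_of_face hr hF.lt _ ((hΔ _).1 h1) hval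
    refine ⟨L, ⟨hL, fun z hz => ?_⟩, ?_⟩
    · obtain ⟨v, rfl⟩ : z ∈ Set.range val := hr ▸ hF.mem_lt hz
      exact (hLG v).1 (Finset.mem_union_left _ ((hF₀ v).2 hz))
    · ext v
      rw [mem_faceOf, ← hLG, Finset.mem_union]
      constructor
      · rintro ⟨h | h, h'⟩
        · exact absurd ((hF₀ v).1 h) h'
        · exact h
      · refine fun h => ⟨Or.inr h, fun h' => ?_⟩
        have : v ∈ F₀ ∩ G := Finset.mem_inter.2 ⟨(hF₀ v).2 h', h⟩
        rw [h2] at this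
        exact Finset.notMem_empty _ this
  ext G
  constructor
  · rintro ⟨L, ⟨hL, h1, h2⟩, rfl⟩
    have hc := hcard L hL
    obtain ⟨L', h3, h4, h5⟩ := hℓ.exists_refinement hL.1
    have hL' : L' ∈ chainSet x y F := ⟨h3, fun z hz => h4.subset (hL.2 z hz)⟩
    have hc' := hcard L' hL'
    refine ⟨⟨_, hlink L' hL', ?_, fun v hv => ?_⟩, ?_⟩
    · simp only at h2
      omega
    · exact mem_faceOf.2 ⟨h4.subset (mem_faceOf.1 hv).1, (mem_faceOf.1 hv).2⟩
    · simp only at h1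
      omega
  · rintro ⟨⟨H, hH, hj, hGH⟩, hi⟩
    obtain ⟨L', hL', rfl⟩ := hlist H hH
    obtain ⟨L, hL, rfl⟩ := hlist G ((Δ.link F₀).down_closed _ hH _ hGH)
    have hc := hcard L hL
    have hc' := hcard L' hL'
    refine ⟨L, ⟨hL, ?_, ?_⟩, rfl⟩
    · simp only
      omega
    · have hsub : L ⊆ L' := by
        intro z hz
        obtain ⟨v, rfl⟩ : z ∈ Set.range val := hr ▸ hL.1.mem_lt hz
        rw [← hunion L' hL']
        exact Finset.union_subset_union_right hGH ((hunion L hL v).2 hz)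
      have h1 := hℓ.weight_le_of_sublist hL'.1 (hL'.1.sublist_of_subset hL.1 hsub)
      have h2 := hℓ.length_le_weight hL'.1
      simp only
      omega

/-- Sequential acyclicity is exactness below the diagonal in every layer of the weight filtration,
so `IsFiltered.linExact_iff` turns it into a condition on the leading part. -/
theorem IsLength.isSequentiallyAcyclic_link_iff (k : Type u) [Field k] (hℓ : IsLength ℓ)
    (hval : Function.Injective val) (hlt : ∀ u v, val u < val v → u < v)
    (hr : Set.range val = Set.Ioo x y)
    (hΔ : ∀ G, G ∈ Δ.faces ↔ ∀ u ∈ G, ∀ v ∈ G, val u ≤ val v ∨ val v ≤ val u)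
    (hF : Between x F y) (hF₀ : ∀ v, v ∈ F₀ ↔ val v ∈ F) :
    (Δ.link F₀).IsSequentiallyAcyclic k ↔ LinExactThrough k ℓ x y F := by
  have hb := hℓ.isFiltered (k := k) x y F
  rw [LinExactThrough, hb.linExact_iff fun L hL => hℓ.weight_le hL.1]
  have hiff : ∀ (i j : ℤ) (n p : ℕ), (n : ℤ) = i + F.length + 2 → (p : ℤ) = j + F.length + 2 →
      (((Δ.link F₀).layer j).ReducedHomologyVanishes k i ↔
        ExactOn (faceMap k {z | z ∈ F})
          (layerStratum (chainSet x y F) (fun L => L.length + 1) (fun L => weight ℓ x L y) n p)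
          (layerStratum (chainSet x y F) (fun L => L.length + 1) (fun L => weight ℓ x L y)
            (n + 1) p)) := by
    intro i j n p hn hp
    rw [FaceComplex.reducedHomologyVanishes_iff,
      ← hℓ.image_layerStratum (hval := hval) hr hΔ hF hF₀ hn hp,
      ← hℓ.image_layerStratum (hval := hval) hr hΔ hF hF₀ (n := n + 1) (i := i + 1)
        (by push_cast; omega) hp]
    refine exactOn_image_iff (S := chainSet x y F) (faceOf_injOn hr F) (fun L hL => hL.1)
      (fun L hL => hL.1) (fun L hL => supported_mono (fun L' hL' => hL'.1) (hb.mem L hL))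
      (fun L hL => ?_)
    rw [faceMap_single, boundary_faceOf k hlt hL.1 fun z hz => hr ▸ hL.1.mem_lt hz]
  constructor
  · intro H n p hnp
    -- These are the degrees i < -1: a chain through F has at least |F| + 1 steps, so nothing lives
    -- there.
    by_cases hn : n < F.length + 1
    · intro f hf _
      refine ⟨0, zero_mem _, ?_⟩
      have hempty : layerStratum (chainSet x y F) (fun L => L.length + 1)
          (fun L => weight ℓ x L y) n p = ∅ := by
        refine Set.eq_empty_iff_forall_notMem.2 ?_
        rintro L ⟨hL, h1, -⟩
        have := (hL.1.sublist_of_subset hF hL.2).length_le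
        simp only at h1
        omega
      rw [hempty, supported_empty, Submodule.mem_bot] at hf
      rw [hf, map_zero]
    · have e := hiff (n - F.length - 2) (p - F.length - 2) n p (by omega) (by omega)
      -- Sequential acyclicity says nothing for j above the dimension, but the layer then has no
      -- faces and its homology vanishes.
      by_cases hface : ∃ G ∈ (Δ.link F₀).faces, (p - F.length - 2 : ℤ) ≤ (G.card : ℤ) - 1
      · exact e.1 (H _ _ (by omega) (by omega) hface)
      · refine e.1 fun f hf => ?_
        have h0 : f ∈ supported k k (∅ : Set (Finset V)) := by
          refine supported_mono ?_ hf.1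
          rintro G ⟨⟨H, h1, h2, -⟩, -⟩
          exact hface ⟨H, h1, h2⟩
        rw [supported_empty, Submodule.mem_bot] at h0
        rw [h0]
        exact zero_mem _
  · intro H i j hi hij _
    exact (hiff i j (i + F.length + 2).toNat (j + F.length + 2).toNat (by omega) (by omega)).2
      (H _ _ (by omega))

end Link

section Poset

variable {ℓ : P → P → ℕ}

theorem mem_orderComplex_iff {Q : Set P} (G : Finset Q) : G ∈ (orderComplex Q).faces ↔
    ∀ u ∈ G, ∀ v ∈ G, (u : P) ≤ v ∨ (v : P) ≤ u := by
  constructor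
  · intro h u hu v hv
    by_cases huv : u = v
    · exact Or.inl (huv ▸ le_rfl)
    · exact h hu hv huv
  · intro h u hu v hv _
    exact h u hu v hv

theorem linearExtensionOrder_lt {Q : Type*} [PartialOrder Q] {u v : Q} (h : u < v) :
    (linearExtensionOrder Q).lt u v :=
  lt_of_le_of_ne (α := LinearExtension Q) (toLinearExtension.monotone h.le) h.ne

theorem IsLength.isSequentiallyAcyclic_link_orderComplex_iff (k : Type u) [Field k]
    (hℓ : IsLength ℓ) {F : List P} (hF : Between x F y) {F₀ : Finset (Set.Ioo x y)}
    (hF₀ : ∀ v, v ∈ F₀ ↔ (v : P) ∈ F) :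
    @FaceComplex.IsSequentiallyAcyclic k _ _ (linearExtensionOrder (Set.Ioo x y))
      (@FaceComplex.link _ (linearExtensionOrder (Set.Ioo x y)).toDecidableEq
        (orderComplex (Set.Ioo x y)) F₀) ↔ LinExactThrough k ℓ x y F :=
  @IsLength.isSequentiallyAcyclic_link_iff P (Set.Ioo x y) (linearExtensionOrder (Set.Ioo x y))
    Subtype.val _ x y _ ℓ F F₀ k _ hℓ Subtype.val_injective
    (fun _ _ h => linearExtensionOrder_lt (Subtype.coe_lt_coe.1 h)) Subtype.range_val
    mem_orderComplex_iff hF hF₀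

/-- All open intervals are sequentially Cohen–Macaulay if and only if the complexes of chains in
all open intervals are linearly exact. -/
theorem IsLength.posetIsSequentiallyCohenMacaulay_iff (k : Type u) [Field k] (hℓ : IsLength ℓ) :
    (∀ x y : P, x < y → PosetIsSequentiallyCohenMacaulay k (Set.Ioo x y)) ↔
      ∀ x y : P, x < y → LinExactThrough k ℓ x y [] := by
  constructor
  · intro H x y hxy
    -- The link of the empty face already gives the condition for the interval itself.
    exact (hℓ.isSequentiallyAcyclic_link_orderComplex_iff k (F := []) hxy (F₀ := ∅)
      (fun v => by simp)).1 (H x y hxy ∅ ((mem_orderComplex_iff _).2 (by simp)))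
  · intro H x y hxy F₀ hF₀
    obtain ⟨F, hF, hFF₀⟩ := @exists_between_of_face P (Set.Ioo x y)
      (linearExtensionOrder (Set.Ioo x y)) Subtype.val _ x y Subtype.range_val hxy F₀
      ((mem_orderComplex_iff _).1 hF₀) Subtype.val_injective
    exact (hℓ.isSequentiallyAcyclic_link_orderComplex_iff k hF hFF₀).2 (hℓ.linExactThrough H hF)

/-- The only face has dimension -1, which leaves no pair -1 ≤ i < j to test. -/
theorem posetIsSequentiallyCohenMacaulay_of_isEmpty (k : Type u) [Field k] {Q : Type*}
    [PartialOrder Q] [IsEmpty Q] : PosetIsSequentiallyCohenMacaulay k Q := by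
  intro F _ i j hi hij hface
  obtain ⟨G, -, hG⟩ := hface
  rw [Finset.eq_empty_of_isEmpty G, Finset.card_empty] at hG
  exact absurd hG (by simp only [Nat.cast_zero]; omega)

end Poset

end ChainList

end

theorem corollary1p13 {k : Type u} [Field k] {P : Type v} [PartialOrder P] [LocallyFiniteOrder P]
    (r : Setoid (NonemptyInterval P)) [ReducedIncidence.Axioms r] :
    IsNongradedKoszulRing (ReducedIncidenceAlgebra.degreeZero k r)
        (ReducedIncidenceAlgebra.properIdeal k r) ↔
      ∀ x y : P, x ≤ y → PosetIsSequentiallyCohenMacaulay k (Set.Ioo x y) := by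
  rw [ReducedIncidenceAlgebra.isNongradedKoszulRing_iff,
    ReducedIncidenceAlgebra.listExactAt_iff_linExactThrough,
    ← (ReducedIncidence.isLength_intervalLength r).posetIsSequentiallyCohenMacaulay_iff k]
  refine ⟨fun H x y hxy => ?_, fun H x y hxy => H x y hxy.le⟩
  rcases hxy.lt_or_eq with hlt | rfl
  · exact H x y hlt
  -- The chain complexes see only intervals with x < y; the degenerate ones have empty interior and
  -- satisfy the condition trivially.
  · have : IsEmpty (Set.Ioo x x) := Set.isEmpty_coe_sort.2 (Set.Ioo_self x)
    exact ChainList.posetIsSequentiallyCohenMacaulay_of_isEmpty k
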